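/- Let $d\ge 2$ be an integer, let $p>d$ and $q\in[\max(2,\tfrac p2),\,p)$ be real numbers, let $U\subset\mathbb R^d$ be a bounded open set and $T>0$. Let $A=(a_{ij})_{1\le i,j\le d}$ be a (not necessarily symmetric) matrix of measurable functions on $U$ for which there are constants $\lambda,M>0$ with $$\sum_{i,j=1}^d a_{ij}(x)\xi_i\xi_j\ge\lambda\|\xi\|^2,\qquad \max_{1\le i,j\le d}|a_{ij}(x)|\le M\qquad\text{for all }\xi\in\mathbb R^d\text{ and a.e. }x\in U.$$ Let $\mathbf B\in L^p(U,\mathbb R^d)$, let $\psi\in L^q(U)$ with $\psi\ge c_0$ a.e. on $U$ for a constant $c_0>0$, and let $u\in H^{1,2}(U\times(0,T))\cap L^\infty(U\times(0,T))$, where $H^{1,2}(U\times(0,T))$ is the space of $L^2$-functions on $U\times(0,T)$ whose first order weak derivatives in space and in time are all in $L^2$. Suppose that $$\iint_{U\times(0,T)}(u\,\partial_t\varphi)\,\psi\,dx\,dt=\iint_{U\times(0,T)}\langle A\nabla u,\nabla\varphi\rangle+\langle\mathbf B,\nabla u\rangle\varphi\,dx\,dt\qquad\text{for all }\varphi\in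 C_0^\infty(U\times(0,T)),$$ where $\nabla$ is the gradient in the space variable. Let $(\bar x,\bar t)\in U\times(0,T)$; for $\varrho>0$ let $R_{\bar x}(\varrho)$ be the open cube in $\mathbb R^d$ with centre $\bar x$ and edge length $\varrho$ (edges parallel to the coordinate axes), and let $Q(\varrho):=R_{\bar x}(\varrho)\times(\bar t-\varrho^2,\bar t)$. If $r>0$ and $Q(3r)\subset U\times(0,T)$, then $$\|u\|_{L^\infty(Q(r))}\le C\,\|u\|_{L^{\frac{2p}{p-2},2}(Q(2r))},\qquad\text{where}\quad \|u\|_{L^{a,b}(Q(\varrho))}:=\Big\|\,\|u(\cdot,t)\|_{L^a(R_{\bar x}(\varrho),\,dx)}\Big\|_{L^b((\bar t-\varrho^2,\bar t),\,dt)}.$$ Here $C>0$ is a constant that depends only on $d$, $p$, $q$, $r$, $\lambda$, $M$, $c_0$ and on upper bounds for $\|\mathbf B\|_{L^p(R_{\bar x}(3r))}$ and $\|\psi\|_{L^q(R_{\bar x}(3r))}$. -/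

import Mathlib

open MeasureTheory Set
open scoped NNReal ENNReal ContDiff

noncomputable section

/-- `ℝ^d` with the Euclidean norm. -/
abbrev Space (d : ℕ) : Type := EuclideanSpace ℝ (Fin d)

/-- Space-time `ℝ^d × ℝ`; its `volume` is the product Lebesgue measure `dx dt`. -/
abbrev SpaceTime (d : ℕ) : Type := Space d × ℝ

/-- The `i`-th spatial coordinate direction in space-time. -/
def spaceDir {d : ℕ} (i : Fin d) : SpaceTime d := (EuclideanSpace.single i 1, 0)

/-- The time direction in space-time. -/
def timeDir (d : ℕ) : SpaceTime d := (0, 1)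

/-- `φ ∈ C_0^∞(Ω)`: smooth with compact support contained in `Ω`. -/
structure IsTestFunction {d : ℕ} (Ω : Set (SpaceTime d)) (φ : SpaceTime d → ℝ) : Prop where
  smooth : ContDiff ℝ ∞ φ
  compact : HasCompactSupport φ
  support_subset : tsupport φ ⊆ Ω

/-- `g` is the weak derivative of `f` on `Ω` in the direction `v`. -/
structure IsWeakDeriv {d : ℕ} (Ω : Set (SpaceTime d)) (v : SpaceTime d)
    (f g : SpaceTime d → ℝ) : Prop where
  locallyIntegrable : LocallyIntegrableOn f Ω volume
  locallyIntegrable_deriv : LocallyIntegrableOn g Ω volume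
  integral_eq : ∀ φ : SpaceTime d → ℝ, IsTestFunction Ω φ →
    ∫ z in Ω, f z * fderiv ℝ φ z v = -∫ z in Ω, g z * φ z

/-- The Sobolev space `H^{1,2}(Ω)` on an open subset `Ω` of space-time: `f` and all its first order
weak derivatives (the spatial ones and the one in time) belong to `L^2(Ω)`. -/
structure MemH12 {d : ℕ} (Ω : Set (SpaceTime d)) (f : SpaceTime d → ℝ) : Prop where
  memLp : MemLp f 2 (volume.restrict Ω)
  space_deriv : ∀ i : Fin d, ∃ g : SpaceTime d → ℝ,
    MemLp g 2 (volume.restrict Ω) ∧ IsWeakDeriv Ω (spaceDir i) f g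
  time_deriv : ∃ g : SpaceTime d → ℝ,
    MemLp g 2 (volume.restrict Ω) ∧ IsWeakDeriv Ω (timeDir d) f g

/-- `Du` is the weak spatial gradient of `u` on `Ω`, and it is square integrable. -/
structure IsWeakSpatialGradient {d : ℕ} (Ω : Set (SpaceTime d)) (u : SpaceTime d → ℝ)
    (Du : SpaceTime d → Space d) : Prop where
  memLp : MemLp Du 2 (volume.restrict Ω)
  isWeakDeriv : ∀ i : Fin d, IsWeakDeriv Ω (spaceDir i) u (fun z => Du z i)

/-- `u` solves, on `U × (0,T)`,
`∬ (u ∂_t φ) ψ dx dt = ∬ ⟨A ∇u, ∇φ⟩ + ⟨B, ∇u⟩ φ dx dt` for all `φ ∈ C_0^∞(U × (0,T))`,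
where `∇` is the (weak) gradient in the space variable.
(The weak gradient is unique up to null sets.) -/
def IsWeakSolution {d : ℕ} (U : Set (Space d)) (T : ℝ)
    (A : Space d → Matrix (Fin d) (Fin d) ℝ) (B : Space d → Space d) (ψ : Space d → ℝ)
    (u : SpaceTime d → ℝ) : Prop :=
  ∃ Du : SpaceTime d → Space d, IsWeakSpatialGradient (U ×ˢ Ioo 0 T) u Du ∧
    ∀ φ : SpaceTime d → ℝ, IsTestFunction (U ×ˢ Ioo 0 T) φ →
      ∫ z in U ×ˢ Ioo 0 T, u z * fderiv ℝ φ z (timeDir d) * ψ z.1 =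
        ∫ z in U ×ˢ Ioo 0 T,
          ((∑ i, ∑ j, A z.1 i j * Du z j * fderiv ℝ φ z (spaceDir i))
            + (∑ i, B z.1 i * Du z i) * φ z)

/-- The open cube `R_x(r)` of edge length `r` centred at `x`. -/
def cube {d : ℕ} (x : Space d) (r : ℝ) : Set (Space d) := {y | ∀ i, |y i - x i| < r / 2}

/-- The time interval `(t - r², t)`. -/
def timeInterval (t r : ℝ) : Set ℝ := Ioo (t - r ^ 2) t

/-- The parabolic cylinder `Q(r) = R_x(r) × (t - r², t)`. -/
def paraCylinder {d : ℕ} (x : Space d) (t r : ℝ) : Set (SpaceTime d) := cube x r ×ˢ timeInterval t r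

/-- The norm of `L^{a,b}(V × I)`: the `L^b(I)`-norm in `t` of the `L^a(V)`-norm in `x`. -/
def mixedNorm {d : ℕ} (f : SpaceTime d → ℝ) (a b : ℝ≥0∞) (V : Set (Space d)) (I : Set ℝ) : ℝ≥0∞ :=
  eLpNorm (fun t : ℝ => eLpNorm (fun x : Space d => f (x, t)) a (volume.restrict V)) b
    (volume.restrict I)

end

/-!
The estimate is proved by Moser iteration. Let `a = 2p / (p - 2)`, so that `2/p + 2/a = 1`, and let
`κ = 1/d - 1/p > 0` and `σ = 1 + κ`.

*Energy estimate.* The equation is tested with `η h(u) h'(u)`, where `h ≥ 0` is convex and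
`η = ζ(x)² χ(t)² θ(t)` is a cut-off. The time term then becomes `∬ ψ ∂ₜη h(u)² / 2`: after
approximating `u` by smooth functions, `∂ₜu` only enters through a total time derivative, and this
is harmless because `ψ` does not depend on time (`IsEnergySolution.integral_identity`). Ellipticity
and Young's inequality (`energy_inequality`, `energy_le`) bound the space-time integral of
`|∇h(u)|²` (`lintegral_gradient_le`) and, as `ψ ≥ c₀`, the `L²(dx)` norms of `h(u)` at almost every
time (`ae_lintegral_slice_le`) by a multiple of `∬ (ψ + 1 + |B|²) h(u)²` on a slightly larger
cylinder. By Hölder's inequality with the weight in `L^{p/2}` (`exists_weight_bound`; this is where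
`q ≥ p/2` is used), the latter is at most a constant times the squared `L^{a,2}` norm of `h(u)`.

*Gain of integrability.* The gradient is in `L²`, but on a bounded set it may be taken in `L^s` with
`1/s = 1/2 + κ/2`, for which `1 ≤ s < 2` even when `d = 2`; the Sobolev inequality then gives
`L^b` in space with `1/b = 1/s - 1/d = 1/a - κ/2` (`lintegral_sobolev_le`). Interpolating between
`L^b` and `L²` in space (`lintegral_rpow_interpolation`) bounds the `L^{aσ,2σ}` norm of `h(u)` on
the smaller cylinder by its `L^{a,2}` norm on the larger one (`mixedPower_step`).

*Iteration.* With `h(s) = (s² + δ)^{σⁿ/2}`, the step passes from the exponents `(aσⁿ, 2σⁿ)` to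
`(aσⁿ⁺¹, 2σⁿ⁺¹)` for `(u² + δ)^{1/2}`. On cylinders shrinking from `2r` to `r` the constants grow
only geometrically, so their accumulated effect is finite (`le_moserConst_mul_rpow`), and
`n → ∞` gives the supremum bound (`eLpNorm_top_le_of_mixedPower_le`). The constants do not depend on
`δ`, which is sent to `0` (`IsEnergySolution.eLpNorm_top_le`).
-/

open Filter Topology Metric ContinuousLinearMap
open scoped Convolution

noncomputable section

/-! ### Mollification in `L²` -/

section Mollification

variable {E : Type*} [NormedAddCommGroup E] [NormedSpace ℝ E] [FiniteDimensional ℝ E]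
  [MeasureSpace E] [BorelSpace E] [(volume : Measure E).IsAddHaarMeasure]

/-- Convolution with the normalised bump `φ`. -/
def mollify (φ : ContDiffBump (0 : E)) (g : E → ℝ) : E → ℝ :=
  φ.normed volume ⋆[lsmul ℝ ℝ, volume] g

omit [BorelSpace E] [(volume : Measure E).IsAddHaarMeasure] in
theorem mollify_apply (φ : ContDiffBump (0 : E)) (g : E → ℝ) (x : E) :
    mollify φ g x = ∫ t, φ.normed volume t * g (x - t) := rfl

theorem mollify_apply_swap (φ : ContDiffBump (0 : E)) (g : E → ℝ) (x : E) :
    mollify φ g x = ∫ y, φ.normed volume (x - y) * g y := by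
  rw [mollify, convolution_eq_swap]; rfl

theorem lintegral_normed_bump (φ : ContDiffBump (0 : E)) :
    ∫⁻ t, ENNReal.ofReal (φ.normed volume t) = 1 := by
  rw [← ofReal_integral_eq_lintegral_ofReal φ.integrable_normed
    (Eventually.of_forall φ.nonneg_normed), φ.integral_normed, ENNReal.ofReal_one]

theorem contDiff_mollify (φ : ContDiffBump (0 : E)) {g : E → ℝ} (hg : LocallyIntegrable g) :
    ContDiff ℝ ∞ (mollify φ g) :=
  φ.hasCompactSupport_normed.contDiff_convolution_left _ φ.contDiff_normed hg

/-- The derivative of a mollification falls on the bump. -/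
theorem fderiv_mollify_apply (φ : ContDiffBump (0 : E)) {g : E → ℝ} (hg : LocallyIntegrable g)
    (z v : E) : fderiv ℝ (mollify φ g) z v = ∫ t, fderiv ℝ (φ.normed volume) t v * g (z - t) := by
  have hN : ContDiff ℝ 1 (φ.normed (volume : Measure E)) := φ.contDiff_normed
  have hNs : HasCompactSupport (φ.normed (volume : Measure E)) := φ.hasCompactSupport_normed
  have h1 := hNs.hasFDerivAt_convolution_left (lsmul ℝ ℝ) hN hg z
  have hint := (hNs.fderiv ℝ).convolutionExists_left ((lsmul ℝ ℝ).precompL E)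
      (hN.continuous_fderiv one_ne_zero) hg z
  rw [mollify, h1.fderiv, convolution_def, ContinuousLinearMap.integral_apply hint]
  simp only [precompL_apply, lsmul_apply, smul_eq_mul]

theorem abs_mollify_le (φ : ContDiffBump (0 : E)) {g : E → ℝ} {L : ℝ}
    (hL : ∀ x, |g x| ≤ L) (x : E) : |mollify φ g x| ≤ L := by
  rw [mollify_apply, ← Real.norm_eq_abs]
  calc ‖∫ t, φ.normed volume t * g (x - t)‖ ≤ ∫ t, φ.normed volume t * L := by
        refine norm_integral_le_of_norm_le (φ.integrable_normed.mul_const L)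
          (Eventually.of_forall fun t => ?_)
        rw [norm_mul, Real.norm_of_nonneg (φ.nonneg_normed t)]
        exact mul_le_mul_of_nonneg_left (hL _) (φ.nonneg_normed t)
    _ = L := by rw [integral_mul_const, φ.integral_normed, one_mul]

/-- Mollification does not increase the `L²` norm (Jensen's inequality). -/
theorem eLpNorm_mollify_le (φ : ContDiffBump (0 : E)) {g : E → ℝ}
    (hg : AEStronglyMeasurable g volume) :
    eLpNorm (mollify φ g) 2 volume ≤ eLpNorm g 2 volume := by
  set N : E → ℝ≥0∞ := fun t => ENNReal.ofReal (φ.normed volume t) with hN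
  have hNm : Measurable N := φ.continuous_normed.measurable.ennreal_ofReal
  have hprod : AEMeasurable (fun z : E × E => ‖g (z.1 - z.2)‖ₑ ^ 2) (volume.prod volume) :=
    ((hg.comp_quasiMeasurePreserving
      (quasiMeasurePreserving_sub_of_right_invariant volume volume)).enorm).pow_const 2
  have hslice : ∀ x : E, AEMeasurable (fun t => ‖g (x - t)‖ₑ ^ 2) volume := fun x =>
    (hg.comp_quasiMeasurePreserving
      (quasiMeasurePreserving_sub_left_of_right_invariant volume x)).enorm.pow_const 2
  have key : ∀ x, ‖mollify φ g x‖ₑ ^ 2 ≤ ∫⁻ t, N t * ‖g (x - t)‖ₑ ^ 2 := by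
    intro x
    have h1 : ‖mollify φ g x‖ₑ ≤ ∫⁻ t, N t * ‖g (x - t)‖ₑ := by
      rw [mollify_apply]
      refine (enorm_integral_le_lintegral_enorm _).trans (lintegral_mono fun t => ?_)
      rw [enorm_mul, Real.enorm_of_nonneg (φ.nonneg_normed t)]
    have h2 : ∫⁻ t, N t * ‖g (x - t)‖ₑ ≤ (∫⁻ t, N t * ‖g (x - t)‖ₑ ^ 2) ^ (1 / 2 : ℝ) := by
      have := ENNReal.lintegral_mul_norm_pow_le (μ := (volume : Measure E)) hNm.aemeasurable
        (hNm.aemeasurable.mul (hslice x)) (p := 1 / 2) (q := 1 / 2) (by norm_num) (by norm_num)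
        (by norm_num)
      rw [lintegral_normed_bump, ENNReal.one_rpow, one_mul] at this
      refine le_trans (le_of_eq (lintegral_congr fun t => ?_)) this
      simp only [Pi.mul_apply]
      rw [← ENNReal.mul_rpow_of_nonneg _ _ (by norm_num : (0 : ℝ) ≤ 1 / 2), ← mul_assoc, ← pow_two,
        ← mul_pow, ← ENNReal.rpow_natCast, ← ENNReal.rpow_mul]
      norm_num
    calc ‖mollify φ g x‖ₑ ^ 2 ≤ ((∫⁻ t, N t * ‖g (x - t)‖ₑ ^ 2) ^ (1 / 2 : ℝ)) ^ 2 := by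
          gcongr; exact h1.trans h2
      _ = _ := by
          rw [← ENNReal.rpow_natCast, ← ENNReal.rpow_mul]; norm_num
  rw [eLpNorm_eq_lintegral_rpow_enorm_toReal (by norm_num) (by norm_num),
    eLpNorm_eq_lintegral_rpow_enorm_toReal (by norm_num) (by norm_num)]
  simp only [ENNReal.toReal_ofNat]
  refine ENNReal.rpow_le_rpow ?_ (by norm_num)
  simp only [ENNReal.rpow_ofNat]
  calc ∫⁻ x, ‖mollify φ g x‖ₑ ^ 2 ≤ ∫⁻ x, ∫⁻ t, N t * ‖g (x - t)‖ₑ ^ 2 := lintegral_mono key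
    _ = ∫⁻ t, ∫⁻ x, N t * ‖g (x - t)‖ₑ ^ 2 :=
        lintegral_lintegral_swap ((hNm.comp measurable_snd).aemeasurable.mul hprod)
    _ = ∫⁻ t, N t * ∫⁻ x, ‖g x‖ₑ ^ 2 := by
        refine lintegral_congr fun t => ?_
        rw [lintegral_const_mul' _ _ ENNReal.ofReal_ne_top,
          lintegral_sub_right_eq_self (fun x => ‖g x‖ₑ ^ 2) t]
    _ = _ := by
        rw [lintegral_mul_const _ hNm, lintegral_normed_bump, one_mul]

/-- Mollifications converge in `L²`. -/
theorem tendsto_eLpNorm_mollify_sub {φ : ℕ → ContDiffBump (0 : E)}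
    (hφ : Tendsto (fun n => (φ n).rOut) atTop (𝓝 0)) {g : E → ℝ} (hg : MemLp g 2 volume) :
    Tendsto (fun n => eLpNorm (mollify (φ n) g - g) 2 volume) atTop (𝓝 0) := by
  rw [ENNReal.tendsto_nhds_zero]
  intro ε hε
  have hε3 : ε / 3 ≠ 0 := (ENNReal.div_pos hε.ne' (by norm_num)).ne'
  obtain ⟨k, hks, hk, hkc, hkm⟩ := hg.exists_hasCompactSupport_eLpNorm_sub_le (by norm_num) hε3
  have hgl : LocallyIntegrable g := hg.locallyIntegrable (by norm_num)
  have hkl : LocallyIntegrable k := hkc.locallyIntegrable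
  obtain ⟨S, hS⟩ : ∃ S, ∀ x, |k x| ≤ S := by
    obtain ⟨S, hS⟩ := hkc.bounded_above_of_compact_support hks
    exact ⟨S, hS⟩
  have hlim : Tendsto (fun n => eLpNorm (mollify (φ n) k - k) 2 volume) atTop (𝓝 0) := by
    have hK : IsCompact (cthickening 1 (tsupport k)) := hks.isCompact.cthickening
    have hφ1 : ∀ᶠ n in atTop, (φ n).rOut < 1 := hφ.eventually_lt_const one_pos
    have hzero : ∀ᶠ n in atTop, ∀ x ∉ cthickening 1 (tsupport k), (mollify (φ n) k - k) x = 0 := by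
      filter_upwards [hφ1] with n hn x hx
      have hd : ∀ y ∈ ball x 1, k y = 0 := by
        intro y hy
        by_contra hne
        exact hx (mem_cthickening_of_dist_le x y 1 _ (subset_tsupport k hne)
          (by rw [dist_comm]; exact (mem_ball.1 hy).le))
      have hx0 : k x = 0 := hd x (mem_ball_self one_pos)
      have : mollify (φ n) k x = k x :=
        ContDiffBump.normed_convolution_eq_right (φ := φ n) fun y hy => by
          rw [hd y (ball_subset_ball hn.le hy), hx0]
      simp [this]
    have hint : Tendsto (fun n => ∫⁻ x in cthickening 1 (tsupport k),
        ‖(mollify (φ n) k - k) x‖ₑ ^ 2) atTop (𝓝 (∫⁻ x in cthickening 1 (tsupport k), 0)) := by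
      refine tendsto_lintegral_of_dominated_convergence (fun _ => ENNReal.ofReal (2 * S) ^ 2)
        (fun n => ?_) (fun n => ?_) ?_ ?_
      · exact (((contDiff_mollify (φ n) hkl).continuous.sub hkc).measurable.enorm).pow_const 2
      · refine Eventually.of_forall fun x => ?_
        dsimp only
        gcongr
        rw [Real.enorm_eq_ofReal_abs]
        refine ENNReal.ofReal_le_ofReal ?_
        have h1 := abs_mollify_le (φ n) hS x
        have h2 := hS x
        calc |(mollify (φ n) k - k) x| ≤ |mollify (φ n) k x| + |k x| := abs_sub _ _
          _ ≤ 2 * S := by linarith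
      · rw [lintegral_const]
        exact ENNReal.mul_ne_top (by finiteness) (by simpa using hK.measure_lt_top.ne)
      · refine Eventually.of_forall fun x => ?_
        have h := ContDiffBump.convolution_tendsto_right_of_continuous (μ := volume) hφ hkc x
        have h2 : Tendsto (fun n => (mollify (φ n) k - k) x) atTop (𝓝 (k x - k x)) :=
          h.sub tendsto_const_nhds
        rw [sub_self] at h2
        have h3 := ENNReal.Tendsto.pow (n := 2) h2.enorm
        simpa using h3
    rw [lintegral_zero] at hint
    have h4 := hint.ennrpow_const (1 / 2 : ℝ)
    rw [ENNReal.zero_rpow_of_pos (by norm_num)] at h4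
    refine h4.congr' ?_
    filter_upwards [hzero] with n hn
    rw [eLpNorm_eq_lintegral_rpow_enorm_toReal (by norm_num) (by norm_num)]
    simp only [ENNReal.toReal_ofNat, ENNReal.rpow_ofNat]
    congr 1
    rw [← lintegral_indicator hK.measurableSet]
    refine lintegral_congr fun x => ?_
    by_cases hx : x ∈ cthickening 1 (tsupport k)
    · rw [indicator_of_mem hx]
    · rw [indicator_of_notMem hx, hn x hx]; simp
  have hev := (ENNReal.tendsto_nhds_zero.1 hlim) (ε / 3) (pos_iff_ne_zero.2 hε3)
  filter_upwards [hev] with n hn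
  have hsub : mollify (φ n) (g - k) = mollify (φ n) g - mollify (φ n) k := by
    ext x
    have e1 : Integrable (fun t => (φ n).normed volume t * g (x - t)) :=
      ((φ n).hasCompactSupport_normed.convolutionExists_left (lsmul ℝ ℝ)
        (φ n).continuous_normed hgl x)
    have e2 : Integrable (fun t => (φ n).normed volume t * k (x - t)) :=
      ((φ n).hasCompactSupport_normed.convolutionExists_left (lsmul ℝ ℝ)
        (φ n).continuous_normed hkl x)
    rw [Pi.sub_apply, mollify_apply, mollify_apply, mollify_apply, ← integral_sub e1 e2]
    simp only [Pi.sub_apply, mul_sub]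
  have hdec : mollify (φ n) g - g = mollify (φ n) (g - k) + (mollify (φ n) k - k) + (k - g) := by
    rw [hsub]; abel
  have hmg : AEStronglyMeasurable (mollify (φ n) (g - k)) volume :=
    (contDiff_mollify (φ n) (hgl.sub hkl)).continuous.aestronglyMeasurable
  have hmk : AEStronglyMeasurable (mollify (φ n) k - k) volume :=
    ((contDiff_mollify (φ n) hkl).continuous.sub hkc).aestronglyMeasurable
  calc eLpNorm (mollify (φ n) g - g) 2 volume
      ≤ eLpNorm (mollify (φ n) (g - k)) 2 volume + eLpNorm (mollify (φ n) k - k) 2 volume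
        + eLpNorm (k - g) 2 volume := by
        rw [hdec]
        refine (eLpNorm_add_le (hmg.add hmk) (hkc.aestronglyMeasurable.sub hg.1)
          (by norm_num)).trans ?_
        gcongr
        exact eLpNorm_add_le hmg hmk (by norm_num)
    _ ≤ ε / 3 + ε / 3 + ε / 3 := by
        gcongr
        · exact (eLpNorm_mollify_le _ (hg.1.sub hkc.aestronglyMeasurable)).trans hk
        · rw [eLpNorm_sub_comm]; exact hk
    _ = ε := ENNReal.add_thirds ε

end Mollification

/-! ### Smooth approximation of functions with weak derivatives -/

instance instIsAddHaarMeasureSpaceTime (d : ℕ) :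
    (volume : Measure (SpaceTime d)).IsAddHaarMeasure :=
  Measure.prod.instIsAddHaarMeasure _ _

/-- Mollification commutes with weak differentiation away from the boundary: the translated bump
`y ↦ φ (z - y)` is then a test function. -/
theorem fderiv_mollify_indicator {d : ℕ} {Ω : Set (SpaceTime d)} (hΩ : MeasurableSet Ω)
    {v : SpaceTime d} {f g : SpaceTime d → ℝ} (hfg : IsWeakDeriv Ω v f g)
    (hf : LocallyIntegrable (Ω.indicator f)) (φ : ContDiffBump (0 : SpaceTime d))
    {z : SpaceTime d} (hz : closedBall z φ.rOut ⊆ Ω) :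
    fderiv ℝ (mollify φ (Ω.indicator f)) z v = mollify φ (Ω.indicator g) z := by
  have hN : ContDiff ℝ 1 (φ.normed (volume : Measure (SpaceTime d))) := φ.contDiff_normed
  have hN' : ContDiff ℝ ∞ (φ.normed (volume : Measure (SpaceTime d))) := φ.contDiff_normed
  set N := φ.normed (volume : Measure (SpaceTime d)) with hNdef
  have hNs : HasCompactSupport N := φ.hasCompactSupport_normed
  have h3 : fderiv ℝ (mollify φ (Ω.indicator f)) z v
      = ∫ t, fderiv ℝ N t v * Ω.indicator f (z - t) := fderiv_mollify_apply φ hf z v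
  have h4 : ∫ t, fderiv ℝ N t v * Ω.indicator f (z - t)
      = ∫ y, fderiv ℝ N (z - y) v * Ω.indicator f y := by
    rw [← integral_sub_left_eq_self (fun t => fderiv ℝ N t v * Ω.indicator f (z - t)) volume z]
    simp
  have htest : IsTestFunction Ω (fun y => N (z - y)) := by
    have hs : Function.support (fun y => N (z - y)) ⊆ closedBall z φ.rOut := by
      intro y hy
      have : z - y ∈ Function.support N := hy
      rw [hNdef, φ.support_normed_eq, mem_ball, dist_zero_right] at this
      rw [mem_closedBall, dist_comm, dist_eq_norm]
      exact this.le
    have hts : tsupport (fun y => N (z - y)) ⊆ closedBall z φ.rOut :=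
      closure_minimal hs isClosed_closedBall
    exact ⟨hN'.comp (contDiff_const.sub contDiff_id),
      (isCompact_closedBall z φ.rOut).of_isClosed_subset (isClosed_tsupport _) hts,
      hts.trans hz⟩
  have hder : ∀ y, fderiv ℝ (fun y => N (z - y)) y v = -fderiv ℝ N (z - y) v := by
    intro y
    have ha : HasFDerivAt N (fderiv ℝ N (z - y)) (z - y) :=
      (hN.differentiable one_ne_zero _).hasFDerivAt
    have hb : HasFDerivAt (fun y => z - y) (-ContinuousLinearMap.id ℝ (SpaceTime d)) y :=
      (hasFDerivAt_id y).const_sub z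
    have hc : HasFDerivAt (fun y => N (z - y)) _ y := ha.comp y hb
    rw [hc.fderiv]
    simp
  have h5 := hfg.integral_eq _ htest
  rw [h3, h4, mollify_apply_swap]
  simp_rw [hder] at h5
  rw [← integral_indicator hΩ, ← integral_indicator hΩ] at h5
  have e1 : ∫ y, fderiv ℝ N (z - y) v * Ω.indicator f y
      = -∫ y, Ω.indicator (fun y => f y * -fderiv ℝ N (z - y) v) y := by
    rw [← integral_neg]
    congr 1; ext y
    by_cases hy : y ∈ Ω
    · simp only [indicator_of_mem hy]; ring
    · simp only [indicator_of_notMem hy]; ring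
  have e2 : ∫ y, N (z - y) * Ω.indicator g y = ∫ y, Ω.indicator (fun y => g y * N (z - y)) y := by
    congr 1; ext y
    by_cases hy : y ∈ Ω
    · simp only [indicator_of_mem hy]; ring
    · simp only [indicator_of_notMem hy]; ring
  rw [e1, e2, h5, neg_neg]

/-- The functions `un n` are smooth, bounded by `L`, and approximate `u` on `K`
almost everywhere, together with `L²(K)`-approximation of the weak derivatives `Du` and `ut`. -/
structure IsSmoothApprox {d : ℕ} (K : Set (SpaceTime d)) (u : SpaceTime d → ℝ)
    (Du : SpaceTime d → Space d) (ut : SpaceTime d → ℝ) (L : ℝ)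
    (un : ℕ → SpaceTime d → ℝ) : Prop where
  smooth : ∀ n, ContDiff ℝ ∞ (un n)
  bound : ∀ n z, |un n z| ≤ L
  tendsto_ae : ∀ᵐ z ∂(volume.restrict K), Tendsto (fun n => un n z) atTop (𝓝 (u z))
  tendsto_space : ∀ i, Tendsto (fun n => eLpNorm (fun z => fderiv ℝ (un n) z (spaceDir i) - Du z i)
    2 (volume.restrict K)) atTop (𝓝 0)
  tendsto_time : Tendsto (fun n => eLpNorm (fun z => fderiv ℝ (un n) z (timeDir d) - ut z)
    2 (volume.restrict K)) atTop (𝓝 0)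

/-- A bounded function with square integrable weak derivatives has smooth approximations on compact
subsets of an open set: its mollifications. -/
theorem exists_isSmoothApprox {d : ℕ} {Ω K : Set (SpaceTime d)} (hΩ : IsOpen Ω)
    (hK : IsCompact K) (hKΩ : K ⊆ Ω) {u : SpaceTime d → ℝ} {Du : SpaceTime d → Space d}
    {ut : SpaceTime d → ℝ} {L : ℝ} (hu : Measurable u) (hL : ∀ z, |u z| ≤ L)
    (hDu : IsWeakSpatialGradient Ω u Du) (hut : MemLp ut 2 (volume.restrict Ω))
    (hut' : IsWeakDeriv Ω (timeDir d) u ut) :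
    ∃ un, IsSmoothApprox K u Du ut L un := by
  -- `u` is extended by zero outside `Ω`; this does not affect the mollifications near `K`
  have hL0 : 0 ≤ L := (abs_nonneg _).trans (hL 0)
  have hm := hΩ.measurableSet
  have hLi : ∀ x, |Ω.indicator u x| ≤ L := by
    intro x
    by_cases hx : x ∈ Ω
    · rw [indicator_of_mem hx]; exact hL x
    · rw [indicator_of_notMem hx, abs_zero]; exact hL0
  have hloc : LocallyIntegrable (Ω.indicator u) := by
    refine (locallyIntegrable_const L).mono (hu.indicator hm).aestronglyMeasurable
      (Eventually.of_forall fun x => ?_)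
    rw [Real.norm_eq_abs, Real.norm_of_nonneg hL0]
    exact hLi x
  let φ : ℕ → ContDiffBump (0 : SpaceTime d) := fun n =>
    ⟨1 / ((n : ℝ) + 1) / 2, 1 / ((n : ℝ) + 1), by positivity, half_lt_self (by positivity)⟩
  have hφ : Tendsto (fun n => (φ n).rOut) atTop (𝓝 0) := tendsto_one_div_add_atTop_nhds_zero_nat
  have hφ2 : ∀ᶠ n in atTop, (φ n).rOut ≤ 2 * (φ n).rIn :=
    Eventually.of_forall fun n => by simp only [φ]; linarith
  obtain ⟨δ, hδ, hδΩ⟩ := hK.exists_cthickening_subset_open hΩ hKΩ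
  have hball : ∀ᶠ n in atTop, ∀ z ∈ K, closedBall z (φ n).rOut ⊆ Ω := by
    filter_upwards [hφ.eventually_lt_const hδ] with n hn z hz
    exact (closedBall_subset_closedBall hn.le).trans
      ((closedBall_subset_cthickening hz δ).trans hδΩ)
  have key : ∀ (v : SpaceTime d) (g : SpaceTime d → ℝ), IsWeakDeriv Ω v u g →
      MemLp g 2 (volume.restrict Ω) → Tendsto (fun n => eLpNorm (fun z =>
        fderiv ℝ (mollify (φ n) (Ω.indicator u)) z v - g z) 2 (volume.restrict K))
        atTop (𝓝 0) := by
    intro v g hg hg2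
    have hlim := tendsto_eLpNorm_mollify_sub hφ ((memLp_indicator_iff_restrict hm).2 hg2)
    refine tendsto_of_tendsto_of_tendsto_of_le_of_le' tendsto_const_nhds hlim
      (Eventually.of_forall fun _ => zero_le) ?_
    filter_upwards [hball] with n hn
    refine le_trans (le_of_eq ?_) (eLpNorm_mono_measure _ (Measure.restrict_le_self (s := K)))
    refine eLpNorm_congr_ae ?_
    filter_upwards [ae_restrict_mem hK.measurableSet] with z hz
    rw [fderiv_mollify_indicator hm hg hloc (φ n) (hn z hz), Pi.sub_apply,
      indicator_of_mem (hKΩ hz)]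
  refine ⟨fun n => mollify (φ n) (Ω.indicator u), fun n => contDiff_mollify _ hloc,
    fun n z => abs_mollify_le _ hLi z, ?_, fun i => key _ _ (hDu.isWeakDeriv i) ?_,
    key _ _ hut' hut⟩
  · have h := ContDiffBump.ae_convolution_tendsto_right_of_locallyIntegrable
      (μ := (volume : Measure (SpaceTime d))) hφ hφ2 hloc
    filter_upwards [ae_restrict_of_ae (s := K) h, ae_restrict_mem hK.measurableSet] with z hz hzK
    rw [indicator_of_mem (hKΩ hzK)] at hz
    exact hz
  · exact (EuclideanSpace.proj (𝕜 := ℝ) i).comp_memLp' hDu.memLp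

/-! ### Limits of integrals of products -/

section ConvInt

variable {α : Type*} [MeasurableSpace α] {μ : Measure α}

/-- `X n` and `Y` are integrable and the integrals of `X n` converge to the integral of `Y`. -/
structure IntegralTendsto (μ : Measure α) (X : ℕ → α → ℝ) (Y : α → ℝ) : Prop where
  integrable : ∀ n, Integrable (X n) μ
  integrable_lim : Integrable Y μ
  tendsto : Tendsto (fun n => ∫ z, X n z ∂μ) atTop (𝓝 (∫ z, Y z ∂μ))

theorem IntegralTendsto.add {X X' : ℕ → α → ℝ} {Y Y' : α → ℝ} (h : IntegralTendsto μ X Y)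
    (h' : IntegralTendsto μ X' Y') :
    IntegralTendsto μ (fun n z => X n z + X' n z) (fun z => Y z + Y' z) where
  integrable n := (h.integrable n).add (h'.integrable n)
  integrable_lim := h.integrable_lim.add h'.integrable_lim
  tendsto := by
    rw [integral_add h.integrable_lim h'.integrable_lim]
    refine (h.tendsto.add h'.tendsto).congr fun n => ?_
    rw [integral_add (h.integrable n) (h'.integrable n)]

theorem IntegralTendsto.sum {ι : Type*} (s : Finset ι) {X : ι → ℕ → α → ℝ} {Y : ι → α → ℝ}
    (h : ∀ i ∈ s, IntegralTendsto μ (X i) (Y i)) :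
    IntegralTendsto μ (fun n z => ∑ i ∈ s, X i n z) (fun z => ∑ i ∈ s, Y i z) where
  integrable n := integrable_finsetSum _ fun i hi => (h i hi).integrable n
  integrable_lim := integrable_finsetSum _ fun i hi => (h i hi).integrable_lim
  tendsto := by
    rw [integral_finsetSum _ fun i hi => (h i hi).integrable_lim]
    refine (tendsto_finsetSum s fun i hi => (h i hi).tendsto).congr fun n => ?_
    rw [integral_finsetSum _ fun i hi => (h i hi).integrable n]

theorem ae_abs_le_of_tendsto {c : ℕ → α → ℝ} {c' : α → ℝ} {C : ℝ}
    (hb : ∀ n, ∀ z, |c n z| ≤ C)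
    (hlim : ∀ᵐ z ∂μ, Tendsto (fun n => c n z) atTop (𝓝 (c' z))) : ∀ᵐ z ∂μ, |c' z| ≤ C := by
  filter_upwards [hlim] with z hz
  exact le_of_tendsto' hz.abs fun n => hb n z

/-- Dominated convergence for an integrable function times uniformly bounded factors. -/
theorem integralTendsto_mul_of_bounded {f : α → ℝ} (hf : Integrable f μ) {c : ℕ → α → ℝ}
    {c' : α → ℝ} {C : ℝ} (hm : ∀ n, AEStronglyMeasurable (c n) μ) (hb : ∀ n, ∀ z, |c n z| ≤ C)
    (hlim : ∀ᵐ z ∂μ, Tendsto (fun n => c n z) atTop (𝓝 (c' z))) :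
    IntegralTendsto μ (fun n z => f z * c n z) (fun z => f z * c' z) where
  integrable n := hf.mul_bdd (hm n) (Eventually.of_forall fun z => hb n z)
  integrable_lim := hf.mul_bdd (aestronglyMeasurable_of_tendsto_ae atTop hm hlim)
    (ae_abs_le_of_tendsto hb hlim)
  tendsto := by
    refine tendsto_integral_of_dominated_convergence (fun z => |f z| * C)
      (fun n => hf.1.mul (hm n)) (hf.abs.mul_const C) (fun n => Eventually.of_forall fun z => ?_) ?_
    · rw [norm_mul]
      exact mul_le_mul_of_nonneg_left (hb n z) (norm_nonneg _)
    · filter_upwards [hlim] with z hz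
      exact hz.const_mul _

/-- Strong `L²` convergence is preserved under multiplication by uniformly bounded factors that
converge almost everywhere. -/
theorem tendsto_eLpNorm_mul_of_bounded {g : ℕ → α → ℝ} {g' : α → ℝ} (hg' : MemLp g' 2 μ)
    (hg : ∀ n, AEStronglyMeasurable (g n) μ)
    (hlimg : Tendsto (fun n => eLpNorm (fun z => g n z - g' z) 2 μ) atTop (𝓝 0))
    {c : ℕ → α → ℝ} {c' : α → ℝ} {C : ℝ} (hm : ∀ n, AEStronglyMeasurable (c n) μ)
    (hb : ∀ n, ∀ z, |c n z| ≤ C)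
    (hlim : ∀ᵐ z ∂μ, Tendsto (fun n => c n z) atTop (𝓝 (c' z))) :
    Tendsto (fun n => eLpNorm (fun z => c n z * g n z - c' z * g' z) 2 μ) atTop (𝓝 0) := by
  have hm' : AEStronglyMeasurable c' μ := aestronglyMeasurable_of_tendsto_ae atTop hm hlim
  have hb' := ae_abs_le_of_tendsto hb hlim
  have h1 : Tendsto (fun n => eLpNorm (fun z => (c n z - c' z) * g' z) 2 μ) atTop (𝓝 0) := by
    have hint : Tendsto (fun n => ∫⁻ z, ‖(c n z - c' z) * g' z‖ₑ ^ 2 ∂μ) atTop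
        (𝓝 (∫⁻ _, 0 ∂μ)) := by
      refine tendsto_lintegral_of_dominated_convergence'
        (fun z => (ENNReal.ofReal (2 * C) * ‖g' z‖ₑ) ^ 2)
        (fun n => (((hm n).sub hm').mul hg'.1).enorm.pow_const 2) (fun n => ?_) ?_ ?_
      · filter_upwards [hb'] with z hz
        rw [enorm_mul, Real.enorm_eq_ofReal_abs]
        gcongr
        calc |c n z - c' z| ≤ |c n z| + |c' z| := abs_sub _ _
          _ ≤ 2 * C := by linarith [hb n z]
      · simp_rw [mul_pow]
        rw [lintegral_const_mul' _ _ (by finiteness)]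
        refine ENNReal.mul_ne_top (by finiteness) ?_
        have := lintegral_rpow_enorm_lt_top_of_eLpNorm_lt_top (by norm_num) (by norm_num) hg'.2
        simpa using this.ne
      · filter_upwards [hlim] with z hz
        have h2 : Tendsto (fun n => (c n z - c' z) * g' z) atTop (𝓝 ((c' z - c' z) * g' z)) :=
          (hz.sub tendsto_const_nhds).mul_const _
        rw [sub_self, zero_mul] at h2
        simpa using ENNReal.Tendsto.pow (n := 2) h2.enorm
    rw [lintegral_zero] at hint
    have h4 := hint.ennrpow_const (1 / 2 : ℝ)
    rw [ENNReal.zero_rpow_of_pos (by norm_num)] at h4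
    refine h4.congr fun n => ?_
    rw [eLpNorm_eq_lintegral_rpow_enorm_toReal (by norm_num) (by norm_num)]
    simp only [ENNReal.toReal_ofNat, ENNReal.rpow_ofNat]
  have h2 : Tendsto (fun n => ENNReal.ofReal C * eLpNorm (fun z => g n z - g' z) 2 μ
      + eLpNorm (fun z => (c n z - c' z) * g' z) 2 μ) atTop (𝓝 0) := by
    have := (ENNReal.Tendsto.const_mul hlimg (Or.inr ENNReal.ofReal_ne_top)
      (a := ENNReal.ofReal C)).add
      h1
    simpa using this
  refine tendsto_of_tendsto_of_tendsto_of_le_of_le tendsto_const_nhds h2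
    (fun _ => zero_le) fun n => ?_
  have hsplit : (fun z => c n z * g n z - c' z * g' z)
      = (fun z => c n z * (g n z - g' z)) + fun z => (c n z - c' z) * g' z := by
    ext z; simp only [Pi.add_apply]; ring
  dsimp only
  rw [hsplit]
  refine (eLpNorm_add_le ((hm n).mul ((hg n).sub hg'.1)) (((hm n).sub hm').mul hg'.1)
    (by norm_num)).trans ?_
  refine add_le_add ?_ le_rfl
  refine eLpNorm_le_mul_eLpNorm_of_ae_le_mul (Eventually.of_forall fun z => ?_) 2
  exact (norm_mul _ _).le.trans (mul_le_mul_of_nonneg_right (hb n z) (norm_nonneg _))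

theorem integralTendsto_mul_of_tendsto_eLpNorm {f : α → ℝ} (hf : MemLp f 2 μ) {g : ℕ → α → ℝ}
    {g' : α → ℝ} (hg' : MemLp g' 2 μ) (hg : ∀ n, MemLp (g n) 2 μ)
    (hlimg : Tendsto (fun n => eLpNorm (fun z => g n z - g' z) 2 μ) atTop (𝓝 0)) :
    IntegralTendsto μ (fun n z => f z * g n z) (fun z => f z * g' z) where
  integrable n := hf.integrable_mul (hg n)
  integrable_lim := hf.integrable_mul hg'
  tendsto := by
    refine tendsto_integral_of_L1' _ (hf.integrable_mul hg').1
      (Eventually.of_forall fun n => hf.integrable_mul (hg n)) ?_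
    have h2 : Tendsto (fun n => eLpNorm f 2 μ * eLpNorm (fun z => g n z - g' z) 2 μ) atTop
        (𝓝 0) := by
      simpa using ENNReal.Tendsto.const_mul hlimg (Or.inr hf.2.ne)
    refine tendsto_of_tendsto_of_tendsto_of_le_of_le tendsto_const_nhds h2
      (fun _ => zero_le) fun n => ?_
    have : (f * g n - f * g') = f • (fun z => g n z - g' z) := by
      ext z; simp [mul_sub]
    change eLpNorm (f * g n - f * g') 1 μ ≤ _
    rw [this]
    exact eLpNorm_smul_le_mul_eLpNorm ((hg n).1.sub hg'.1) hf.1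

end ConvInt

theorem Continuous.exists_forall_abs_le {F : ℝ → ℝ} (hF : Continuous F) (L : ℝ) :
    ∃ C, ∀ s, |s| ≤ L → |F s| ≤ C := by
  obtain ⟨C, hC⟩ := (isCompact_Icc (a := -L) (b := L)).exists_bound_of_continuousOn hF.continuousOn
  exact ⟨C, fun s hs => hC s (abs_le.1 hs)⟩

theorem IsTestFunction.exists_abs_le {d : ℕ} {Ω : Set (SpaceTime d)} {η : SpaceTime d → ℝ}
    (h : IsTestFunction Ω η) : ∃ C, ∀ z, |η z| ≤ C :=
  h.smooth.continuous.bounded_above_of_compact_support h.compact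

theorem IsTestFunction.exists_abs_fderiv_le {d : ℕ} {Ω : Set (SpaceTime d)}
    {η : SpaceTime d → ℝ} (h : IsTestFunction Ω η) (v : SpaceTime d) :
    ∃ C, ∀ z, |fderiv ℝ η z v| ≤ C :=
  (h.smooth.continuous_fderiv_apply (by simp)|>.comp
    (continuous_id.prodMk continuous_const) :
      Continuous fun z => fderiv ℝ η z v).bounded_above_of_compact_support
    (h.compact.fderiv_apply ℝ v)

theorem fderiv_eq_zero_of_notMem_tsupport {d : ℕ} {η : SpaceTime d → ℝ}
    {z : SpaceTime d} (hz : z ∉ tsupport η) (v : SpaceTime d) : fderiv ℝ η z v = 0 := by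
  have : z ∉ tsupport (fderiv ℝ η) := fun h => hz (tsupport_fderiv_subset ℝ h)
  rw [image_eq_zero_of_notMem_tsupport this]; rfl

/-- Integration by parts in time against a weight that does not depend on time. -/
theorem integral_mul_fderiv_timeDir_eq_zero {d : ℕ} {U : Set (Space d)} (hU : IsOpen U)
    {T : ℝ} {ψ : Space d → ℝ}
    (hψ : Integrable ψ (volume.restrict U)) {η : SpaceTime d → ℝ}
    (hη : IsTestFunction (U ×ˢ Ioo 0 T) η) :
    ∫ z in U ×ˢ Ioo 0 T, ψ z.1 * fderiv ℝ η z (timeDir d) = 0 := by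
  have hcont : Continuous fun z => fderiv ℝ η z (timeDir d) :=
    (hη.smooth.continuous_fderiv_apply (by simp)).comp (continuous_id.prodMk continuous_const)
  obtain ⟨C, hC⟩ := hη.exists_abs_fderiv_le (timeDir d)
  have hint : IntegrableOn (fun z : SpaceTime d => ψ z.1 * fderiv ℝ η z (timeDir d))
      (U ×ˢ Ioo 0 T) (volume.prod volume) := by
    have h1 : Integrable (fun z : SpaceTime d => ψ z.1)
        ((volume.restrict U).prod (volume.restrict (Ioo 0 T))) := hψ.comp_fst _
    rw [Measure.prod_restrict] at h1
    exact h1.mul_bdd hcont.aestronglyMeasurable (Eventually.of_forall hC)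
  rw [Measure.volume_eq_prod, setIntegral_prod _ hint]
  refine (setIntegral_congr_fun hU.measurableSet fun x hx => ?_).trans (integral_zero _ _)
  dsimp only
  rw [integral_const_mul]
  refine mul_eq_zero_of_right _ ?_
  have hline : ∀ t : ℝ, HasDerivAt (fun t => η (x, t)) (fderiv ℝ η (x, t) (timeDir d)) t := by
    intro t
    have h1 : HasFDerivAt η (fderiv ℝ η (x, t)) (x, t) :=
      (hη.smooth.differentiable (by simp) _).hasFDerivAt
    have h2 : HasDerivAt (fun t : ℝ => ((x, t) : SpaceTime d)) (timeDir d) t :=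
      (hasDerivAt_const t x).prodMk (hasDerivAt_id t)
    exact h1.comp_hasDerivAt t h2
  have hcs : HasCompactSupport (fun t => η (x, t)) := by
    refine HasCompactSupport.intro (hη.compact.isCompact.image continuous_snd) fun t ht => ?_
    exact image_eq_zero_of_notMem_tsupport fun h => ht ⟨_, h, rfl⟩
  have hcs' : HasCompactSupport (fun t => fderiv ℝ η (x, t) (timeDir d)) := by
    refine HasCompactSupport.intro (hη.compact.isCompact.image continuous_snd) fun t ht => ?_
    exact fderiv_eq_zero_of_notMem_tsupport (fun h => ht ⟨_, h, rfl⟩) _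
  have hx1 : Continuous fun t : ℝ => ((x, t) : SpaceTime d) := by fun_prop
  have h0 := integral_eq_zero_of_hasDerivAt_of_integrable hline
    ((hcont.comp hx1).integrable_of_hasCompactSupport hcs')
    ((hη.smooth.continuous.comp hx1).integrable_of_hasCompactSupport hcs)
  refine (setIntegral_eq_integral_of_forall_compl_eq_zero fun t ht => ?_).trans h0
  refine fderiv_eq_zero_of_notMem_tsupport (fun h => ht ?_) _
  exact (hη.support_subset h).2

/-! ### Testing the equation with functions of the solution -/

/-- A bounded weak solution `u` of the equation with bounded measurable, uniformly elliptic matrix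
`A`, square integrable drift `B` and weight `ψ`, together with a choice of its weak
spatial gradient `Du` and its weak time derivative `ut`; `L` bounds `|u|` everywhere. -/
structure IsEnergySolution {d : ℕ} (U : Set (Space d)) (T : ℝ)
    (A : Space d → Matrix (Fin d) (Fin d) ℝ) (B : Space d → Space d) (ψ : Space d → ℝ)
    (lam M c₀ L : ℝ) (u : SpaceTime d → ℝ) (Du : SpaceTime d → Space d)
    (ut : SpaceTime d → ℝ) : Prop where
  isOpen : IsOpen U
  isBounded : Bornology.IsBounded U
  lam_pos : 0 < lam
  M_pos : 0 < M
  c₀_pos : 0 < c₀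
  measurable_A : ∀ i j, AEStronglyMeasurable (fun x => A x i j) (volume.restrict U)
  elliptic : ∀ᵐ x ∂(volume.restrict U), ∀ ξ : Space d,
    lam * ‖ξ‖ ^ 2 ≤ ∑ i, ∑ j, A x i j * ξ i * ξ j
  bound_A : ∀ᵐ x ∂(volume.restrict U), ∀ i j, |A x i j| ≤ M
  memLp_B : MemLp B 2 (volume.restrict U)
  memLp_ψ : MemLp ψ 2 (volume.restrict U)
  le_ψ : ∀ᵐ x ∂(volume.restrict U), c₀ ≤ ψ x
  measurable_u : Measurable u
  bound_u : ∀ z, |u z| ≤ L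
  grad : IsWeakSpatialGradient (U ×ˢ Ioo 0 T) u Du
  memLp_ut : MemLp ut 2 (volume.restrict (U ×ˢ Ioo 0 T))
  isWeakDeriv_ut : IsWeakDeriv (U ×ˢ Ioo 0 T) (timeDir d) u ut
  equation : ∀ φ : SpaceTime d → ℝ, IsTestFunction (U ×ˢ Ioo 0 T) φ →
    ∫ z in U ×ˢ Ioo 0 T, u z * fderiv ℝ φ z (timeDir d) * ψ z.1 =
      ∫ z in U ×ˢ Ioo 0 T,
        ((∑ i, ∑ j, A z.1 i j * Du z j * fderiv ℝ φ z (spaceDir i))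
          + (∑ i, B z.1 i * Du z i) * φ z)

namespace IsEnergySolution

variable {d : ℕ} {U : Set (Space d)} {T : ℝ} {A : Space d → Matrix (Fin d) (Fin d) ℝ}
  {B : Space d → Space d} {ψ : Space d → ℝ} {lam M c₀ L : ℝ} {u : SpaceTime d → ℝ}
  {Du : SpaceTime d → Space d} {ut : SpaceTime d → ℝ}

theorem isOpen_prod (h : IsEnergySolution U T A B ψ lam M c₀ L u Du ut) :
    IsOpen (U ×ˢ Ioo 0 T) := h.isOpen.prod isOpen_Ioo

theorem volume_lt_top (h : IsEnergySolution U T A B ψ lam M c₀ L u Du ut) :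
    volume (U ×ˢ Ioo 0 T) < ⊤ :=
  (h.isBounded.prod (isBounded_Ioo 0 T)).measure_lt_top

theorem restrict_prod (U : Set (Space d)) (T : ℝ) :
    (volume.restrict (U ×ˢ Ioo 0 T) : Measure (SpaceTime d))
      = (volume.restrict U).prod (volume.restrict (Ioo 0 T)) := by
  rw [Measure.prod_restrict, Measure.volume_eq_prod]

theorem ae_comp_fst {P : Space d → Prop} (hP : ∀ᵐ x ∂(volume.restrict U), P x) :
    ∀ᵐ z ∂(volume.restrict (U ×ˢ Ioo 0 T)), P (z : SpaceTime d).1 := by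
  rw [restrict_prod]
  exact Measure.quasiMeasurePreserving_fst.ae hP

theorem memLp_comp_fst {f : Space d → ℝ} {p : ℝ≥0∞} (hf : MemLp f p (volume.restrict U)) :
    MemLp (fun z : SpaceTime d => f z.1) p (volume.restrict (U ×ˢ Ioo 0 T)) := by
  rw [restrict_prod]
  exact hf.comp_fst _

theorem aestronglyMeasurable_A (h : IsEnergySolution U T A B ψ lam M c₀ L u Du ut) (i j : Fin d) :
    AEStronglyMeasurable (fun z : SpaceTime d => A z.1 i j) (volume.restrict (U ×ˢ Ioo 0 T)) := by
  rw [restrict_prod]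
  exact (h.measurable_A i j).comp_fst

theorem memLp_Du (h : IsEnergySolution U T A B ψ lam M c₀ L u Du ut) (i : Fin d) :
    MemLp (fun z => Du z i) 2 (volume.restrict (U ×ˢ Ioo 0 T)) :=
  (EuclideanSpace.proj (𝕜 := ℝ) i).comp_memLp' h.grad.memLp

theorem memLp_B_apply (h : IsEnergySolution U T A B ψ lam M c₀ L u Du ut) (i : Fin d) :
    MemLp (fun x => B x i) 2 (volume.restrict U) :=
  (EuclideanSpace.proj (𝕜 := ℝ) i).comp_memLp' h.memLp_B

/-- The weak equation tested with `η F(u)`, where `G' = F`. No time derivative of `u` appears in the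
result: testing with `η F(uₙ)` for smooth `uₙ → u` leaves the term `∬ ψ η u F'(u) ∂ₜu` in the limit,
and this is removed by `∬ ψ ∂ₜ(η H(uₙ)) = 0` with `H(s) = s F(s) - G(s)`. -/
theorem integral_identity (h : IsEnergySolution U T A B ψ lam M c₀ L u Du ut)
    {η : SpaceTime d → ℝ} (hη : IsTestFunction (U ×ˢ Ioo 0 T) η) {F G : ℝ → ℝ}
    (hF : ContDiff ℝ ∞ F) (hG : ∀ s, HasDerivAt G (F s) s) :
    IntegrableOn (fun z => ((∑ i, ∑ j, (A z.1 i j * Du z j * fderiv ℝ η z (spaceDir i) * F (u z)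
        + A z.1 i j * Du z j * η z * (deriv F (u z) * Du z i)))
        + ∑ i, B z.1 i * Du z i * η z * F (u z)))
      (U ×ˢ Ioo 0 T) ∧
    ∫ z in U ×ˢ Ioo 0 T, ψ z.1 * fderiv ℝ η z (timeDir d) * G (u z) =
      ∫ z in U ×ˢ Ioo 0 T, ((∑ i, ∑ j, (A z.1 i j * Du z j * fderiv ℝ η z (spaceDir i) * F (u z)
        + A z.1 i j * Du z j * η z * (deriv F (u z) * Du z i)))
        + ∑ i, B z.1 i * Du z i * η z * F (u z)) := by
  have hF' : ContDiff ℝ ∞ (deriv F) := (contDiff_infty_iff_deriv.1 hF).2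
  have hGd : deriv G = F := funext fun s => (hG s).deriv
  have hGs : ContDiff ℝ ∞ G :=
    contDiff_infty_iff_deriv.2 ⟨fun s => (hG s).differentiableAt, hGd ▸ hF⟩
  -- `H' (s) = s F'(s)`
  set H : ℝ → ℝ := fun s => s * F s - G s with hHdef
  have hHs : ContDiff ℝ ∞ H := (contDiff_id.mul hF).sub hGs
  have hH : ∀ s, HasDerivAt H (s * deriv F s) s := by
    intro s
    have h1 : HasDerivAt H (1 * F s + s * deriv F s - F s) s :=
      ((hasDerivAt_id s).mul (hF.differentiable (by simp) s).hasDerivAt).sub (hG s)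
    rwa [one_mul, add_sub_cancel_left] at h1
  have hHd : ∀ s, deriv H s = s * deriv F s := fun s => (hH s).deriv
  set Ω : Set (SpaceTime d) := U ×ˢ Ioo 0 T with hΩdef
  set K := tsupport η with hKdef
  have hK : IsCompact K := hη.compact.isCompact
  have hKΩ : K ⊆ Ω := hη.support_subset
  have hΩo : IsOpen Ω := h.isOpen_prod
  set μ : Measure (SpaceTime d) := volume.restrict K with hμdef
  have hμΩ : μ ≤ volume.restrict Ω := Measure.restrict_mono hKΩ le_rfl
  have hKfin : volume K < ⊤ := hK.measure_lt_top
  have : IsFiniteMeasure μ := ⟨by rw [hμdef, Measure.restrict_apply_univ]; exact hKfin⟩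
  obtain ⟨un, hun⟩ := exists_isSmoothApprox hΩo hK hKΩ h.measurable_u h.bound_u h.grad h.memLp_ut
    h.isWeakDeriv_ut
  obtain ⟨Cη, hCη⟩ := hη.exists_abs_le
  choose C₁ hC₁ using hη.exists_abs_fderiv_le
  have hηm : ∀ {ν : Measure (SpaceTime d)}, AEStronglyMeasurable η ν :=
    hη.smooth.continuous.aestronglyMeasurable
  have hη1m : ∀ {ν : Measure (SpaceTime d)} (v : SpaceTime d),
      AEStronglyMeasurable (fun z => fderiv ℝ η z v) ν := fun v =>
    ((hη.smooth.continuous_fderiv_apply (by simp)).comp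
      (continuous_id.prodMk continuous_const)).aestronglyMeasurable
  have hund : ∀ n v, Continuous fun z => fderiv ℝ (un n) z v := fun n v =>
    ((hun.smooth n).continuous_fderiv_apply (by simp)).comp
      (continuous_id.prodMk continuous_const)
  have hundL : ∀ n v, MemLp (fun z => fderiv ℝ (un n) z v) 2 μ := by
    intro n v
    obtain ⟨C, hC⟩ := hK.exists_bound_of_continuousOn (hund n v).continuousOn
    refine MemLp.of_bound (hund n v).aestronglyMeasurable C ?_
    filter_upwards [ae_restrict_mem hK.measurableSet] with z hz using hC z hz
  -- convergence of bounded continuous functions of `un`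
  have hcomp : ∀ {Φ : ℝ → ℝ}, Continuous Φ → (∀ n, AEStronglyMeasurable (fun z => Φ (un n z)) μ) ∧
      (∃ C, ∀ n z, |Φ (un n z)| ≤ C) ∧
      ∀ᵐ z ∂μ, Tendsto (fun n => Φ (un n z)) atTop (𝓝 (Φ (u z))) := by
    intro Φ hΦ
    refine ⟨fun n => (hΦ.comp (hun.smooth n).continuous).aestronglyMeasurable, ?_, ?_⟩
    · obtain ⟨C, hC⟩ := hΦ.exists_forall_abs_le L
      exact ⟨C, fun n z => hC _ (hun.bound n z)⟩
    · filter_upwards [hun.tendsto_ae] with z hz using (hΦ.tendsto _).comp hz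
  -- bounded multiples
  have hmulη : ∀ {f : SpaceTime d → ℝ} {p : ℝ≥0∞}, MemLp f p μ →
      MemLp (fun z => f z * η z) p μ := by
    intro f p hf
    refine MemLp.of_le_mul (c := Cη) hf (hf.1.mul hηm) (Eventually.of_forall fun z => ?_)
    rw [norm_mul, mul_comm]
    exact mul_le_mul_of_nonneg_right (hCη z) (norm_nonneg _)
  have hmulη1 : ∀ {f : SpaceTime d → ℝ} {p : ℝ≥0∞} (v), MemLp f p μ →
      MemLp (fun z => f z * fderiv ℝ η z v) p μ := by
    intro f p v hf
    refine MemLp.of_le_mul (c := C₁ v) hf (hf.1.mul (hη1m v)) (Eventually.of_forall fun z => ?_)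
    rw [norm_mul, mul_comm]
    exact mul_le_mul_of_nonneg_right (hC₁ v z) (norm_nonneg _)
  have hψ : MemLp (fun z : SpaceTime d => ψ z.1) 2 μ := (memLp_comp_fst h.memLp_ψ).mono_measure hμΩ
  have huψ : MemLp (fun z : SpaceTime d => ψ z.1 * u z) 2 μ := by
    refine MemLp.of_le_mul (c := L) hψ (hψ.1.mul h.measurable_u.aestronglyMeasurable)
      (Eventually.of_forall fun z => ?_)
    rw [norm_mul, mul_comm]
    exact mul_le_mul_of_nonneg_right (h.bound_u z) (norm_nonneg _)
  have hD : ∀ i, MemLp (fun z => Du z i) 2 μ := fun i => (h.memLp_Du i).mono_measure hμΩ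
  have hAD : ∀ i j, MemLp (fun z : SpaceTime d => A z.1 i j * Du z j) 2 μ := by
    intro i j
    refine MemLp.of_le_mul (c := M) (hD j)
      (((h.aestronglyMeasurable_A i j).mono_measure hμΩ).mul (hD j).1) ?_
    filter_upwards [ae_mono hμΩ (ae_comp_fst h.bound_A)] with z hz
    rw [norm_mul]
    exact mul_le_mul_of_nonneg_right (hz i j) (norm_nonneg _)
  have hBD : ∀ i, Integrable (fun z : SpaceTime d => B z.1 i * Du z i * η z) μ := by
    intro i
    have h1 : MemLp (fun z : SpaceTime d => B z.1 i) 2 μ :=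
      (memLp_comp_fst (h.memLp_B_apply i)).mono_measure hμΩ
    exact (h1.integrable_mul (hD i)).mul_bdd hηm (Eventually.of_forall hCη)
  -- the elementary limits
  have lim0 : ∀ {f : SpaceTime d → ℝ} {Φ : ℝ → ℝ}, Integrable f μ → Continuous Φ →
      IntegralTendsto μ (fun n z => f z * Φ (un n z)) (fun z => f z * Φ (u z)) := by
    intro f Φ hf hΦ
    obtain ⟨a, ⟨C, b⟩, c⟩ := hcomp hΦ
    exact integralTendsto_mul_of_bounded hf a b c
  have lim1 : ∀ {f g : SpaceTime d → ℝ} {Φ : ℝ → ℝ} {v : SpaceTime d}, MemLp f 2 μ →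
      Continuous Φ → MemLp g 2 μ →
      Tendsto (fun n => eLpNorm (fun z => fderiv ℝ (un n) z v - g z) 2 μ) atTop (𝓝 0) →
      IntegralTendsto μ (fun n z => f z * (Φ (un n z) * fderiv ℝ (un n) z v))
        (fun z => f z * (Φ (u z) * g z)) := by
    intro f g Φ v hf hΦ hg hlim
    obtain ⟨a, ⟨C, b⟩, c⟩ := hcomp hΦ
    have hmem : ∀ n, MemLp (fun z => Φ (un n z) * fderiv ℝ (un n) z v) 2 μ := fun n => by
      refine MemLp.of_le_mul (c := C) (hundL n v) ((a n).mul (hundL n v).1)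
        (Eventually.of_forall fun z => ?_)
      rw [norm_mul]
      exact mul_le_mul_of_nonneg_right (b n z) (norm_nonneg _)
    have hmem' : MemLp (fun z => Φ (u z) * g z) 2 μ := by
      refine MemLp.of_le_mul (c := C) hg
        ((aestronglyMeasurable_of_tendsto_ae atTop a c).mul hg.1) ?_
      filter_upwards [ae_abs_le_of_tendsto b c] with z hz
      rw [norm_mul]
      exact mul_le_mul_of_nonneg_right hz (norm_nonneg _)
    exact integralTendsto_mul_of_tendsto_eLpNorm hf hmem' hmem
      (tendsto_eLpNorm_mul_of_bounded hg (fun n => (hundL n v).1) hlim a b c)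
  have hutK : MemLp ut 2 μ := h.memLp_ut.mono_measure hμΩ
  -- derivative of the test functions `η Φ(un)`
  have htest : ∀ {Φ : ℝ → ℝ} (n : ℕ), ContDiff ℝ ∞ Φ →
      IsTestFunction Ω (fun z => η z * Φ (un n z)) := by
    intro Φ n hΦ
    refine ⟨hη.smooth.mul (hΦ.comp (hun.smooth n)), hη.compact.mul_right, ?_⟩
    exact (tsupport_mul_subset_left (f := η)).trans hη.support_subset
  have hder : ∀ {Φ : ℝ → ℝ} (n : ℕ) (z v), ContDiff ℝ ∞ Φ →
      fderiv ℝ (fun z => η z * Φ (un n z)) z v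
        = fderiv ℝ η z v * Φ (un n z) + η z * (deriv Φ (un n z) * fderiv ℝ (un n) z v) := by
    intro Φ n z v hΦ
    have h1 : HasFDerivAt η (fderiv ℝ η z) z := (hη.smooth.differentiable (by simp) z).hasFDerivAt
    have h2 : HasFDerivAt (un n) (fderiv ℝ (un n) z) z :=
      ((hun.smooth n).differentiable (by simp) z).hasFDerivAt
    have h3 : HasDerivAt Φ (deriv Φ (un n z)) (un n z) :=
      (hΦ.differentiable (by simp) _).hasDerivAt
    have h4 : HasFDerivAt (fun z => η z * Φ (un n z)) _ z := h1.mul (h3.comp_hasFDerivAt z h2)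
    rw [h4.fderiv]
    simp only [_root_.add_apply, _root_.smul_apply, smul_eq_mul]
    ring
  have hout : ∀ z, z ∉ K → η z = 0 := fun z hz => image_eq_zero_of_notMem_tsupport hz
  have hout1 : ∀ z v, z ∉ K → fderiv ℝ η z v = 0 := fun z v hz =>
    fderiv_eq_zero_of_notMem_tsupport hz v
  have toK : ∀ {f : SpaceTime d → ℝ}, (∀ z, z ∉ K → f z = 0) →
      ∫ z in Ω, f z = ∫ z, f z ∂μ := fun {f} hf =>
    setIntegral_eq_of_subset_of_forall_sdiff_eq_zero hΩo.measurableSet hKΩ fun z hz => hf z hz.2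
  -- the two identities satisfied by `un`
  have eqn : ∀ n, ∫ z, (ψ z.1 * u z * fderiv ℝ η z (timeDir d) * F (un n z)
        + ψ z.1 * u z * η z * (deriv F (un n z) * fderiv ℝ (un n) z (timeDir d))) ∂μ
      = ∫ z, ((∑ i, ∑ j, (A z.1 i j * Du z j * fderiv ℝ η z (spaceDir i) * F (un n z)
        + A z.1 i j * Du z j * η z * (deriv F (un n z) * fderiv ℝ (un n) z (spaceDir i))))
        + ∑ i, B z.1 i * Du z i * η z * F (un n z)) ∂μ := by
    intro n
    have e := h.equation _ (htest n hF)
    rw [toK, toK] at e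
    · refine Eq.trans (integral_congr_ae (Eventually.of_forall fun z => ?_))
        (e.trans (integral_congr_ae (Eventually.of_forall fun z => ?_)))
      · dsimp only
        rw [hder n z _ hF]; ring
      · dsimp only
        congr 1
        · refine Finset.sum_congr rfl fun i _ => Finset.sum_congr rfl fun j _ => ?_
          rw [hder n z _ hF]; ring
        · rw [Finset.sum_mul]
          exact Finset.sum_congr rfl fun i _ => by ring
    · intro z hz
      simp only [hder n z _ hF, hout z hz, hout1 z _ hz]
      simp
    · intro z hz
      simp only [hder n z _ hF, hout z hz, hout1 z _ hz]
      simp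
  have eqn2 : ∀ n, ∫ z, (ψ z.1 * fderiv ℝ η z (timeDir d) * H (un n z)
      + ψ z.1 * η z * ((un n z * deriv F (un n z)) * fderiv ℝ (un n) z (timeDir d))) ∂μ = 0 := by
    intro n
    have : IsFiniteMeasure (volume.restrict U) :=
      ⟨by rw [Measure.restrict_apply_univ]; exact h.isBounded.measure_lt_top⟩
    have e := integral_mul_fderiv_timeDir_eq_zero h.isOpen
      (h.memLp_ψ.integrable (by norm_num)) (htest n hHs)
    rw [← hΩdef, toK] at e
    · rw [← e]
      refine integral_congr_ae (Eventually.of_forall fun z => ?_)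
      dsimp only
      rw [hder n z _ hHs, hHd]; ring
    · intro z hz
      rw [hder n z _ hHs, hout z hz, hout1 z _ hz]
      simp
  have hFc := hF.continuous
  have hF'c := hF'.continuous
  have L1 := (lim0 ((hmulη1 (timeDir d) huψ).integrable (by norm_num)) hFc).add
    (lim1 (hmulη huψ) hF'c hutK hun.tendsto_time)
  have L2 := (IntegralTendsto.sum Finset.univ fun i _ => IntegralTendsto.sum Finset.univ fun j _ =>
    (lim0 ((hmulη1 (spaceDir i) (hAD i j)).integrable (by norm_num)) hFc).add
      (lim1 (hmulη (hAD i j)) hF'c (hD i) (hun.tendsto_space i))).add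
    (IntegralTendsto.sum Finset.univ fun i _ => lim0 (hBD i) hFc)
  have L3 := (lim0 ((hmulη1 (timeDir d) hψ).integrable (by norm_num)) hHs.continuous).add
    (lim1 (hmulη hψ) (Φ := fun s => s * deriv F s) (continuous_id.mul hF'c) hutK hun.tendsto_time)
  have R1 := tendsto_nhds_unique (L1.tendsto.congr eqn) L2.tendsto
  have R2 := tendsto_nhds_unique (L3.tendsto.congr eqn2) tendsto_const_nhds
  refine ⟨IntegrableOn.of_forall_sdiff_eq_zero (s := K) L2.integrable_lim hΩo.measurableSet
    fun z hz => by simp [hout z hz.2, hout1 z _ hz.2], ?_⟩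
  rw [toK, toK]
  · rw [← R1, ← sub_zero (∫ z, (_ + _ : ℝ) ∂μ), ← R2,
      ← integral_sub L1.integrable_lim L3.integrable_lim]
    refine integral_congr_ae (Eventually.of_forall fun z => ?_)
    simp only [hHdef]
    ring
  · intro z hz
    simp [hout z hz, hout1 z _ hz]
  · intro z hz
    simp [hout1 z _ hz]

end IsEnergySolution

/-! ### The energy inequality -/

/-- The pointwise algebra behind the energy inequality: ellipticity against Young's inequality. -/
theorem energy_pointwise {lam X Y Z n N h h₁ h₂ ζ m κ β : ℝ} (hlam : 0 < lam)
    (hX : lam * n ^ 2 ≤ X) (hY : |Y| ≤ κ * (n * N)) (hZ : |Z| ≤ β * n)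
    (hh : 0 ≤ h) (hh₂ : 0 ≤ h₂) (hm : 0 ≤ m) :
    lam / 2 * (n ^ 2 * h₁ ^ 2 * ζ ^ 2 * m)
        - (4 * κ ^ 2 / lam * N ^ 2 + β ^ 2 / lam * ζ ^ 2) * h ^ 2 * m
      ≤ Y * (2 * ζ * m * h * h₁) + X * (ζ ^ 2 * m * (h₁ ^ 2 + h * h₂))
        + Z * (ζ ^ 2 * m * h * h₁) := by
  have h1 : lam * n ^ 2 * (h₁ ^ 2 * ζ ^ 2) ≤ X * (ζ ^ 2 * (h₁ ^ 2 + h * h₂)) := by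
    have hX0 : 0 ≤ X := le_trans (by positivity) hX
    calc lam * n ^ 2 * (h₁ ^ 2 * ζ ^ 2) ≤ X * (h₁ ^ 2 * ζ ^ 2) := by gcongr
      _ ≤ X * (ζ ^ 2 * (h₁ ^ 2 + h * h₂)) := by
        refine mul_le_mul_of_nonneg_left ?_ hX0
        have : 0 ≤ ζ ^ 2 * (h * h₂) := by positivity
        nlinarith
  have h2 : -(lam / 4 * (n ^ 2 * h₁ ^ 2 * ζ ^ 2) + 4 * κ ^ 2 / lam * N ^ 2 * h ^ 2)
      ≤ Y * (2 * ζ * h * h₁) := by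
    have ha : |Y * (2 * ζ * h * h₁)| ≤ 2 * (κ * N * h) * (n * (|ζ| * |h₁|)) := by
      rw [abs_mul, abs_mul, abs_mul, abs_mul, abs_two, abs_of_nonneg hh]
      calc |Y| * (2 * |ζ| * h * |h₁|) ≤ κ * (n * N) * (2 * |ζ| * h * |h₁|) := by gcongr
        _ = _ := by ring
    have hb : 2 * (κ * N * h) * (n * (|ζ| * |h₁|))
        ≤ lam / 4 * (n * (|ζ| * |h₁|)) ^ 2 + 4 / lam * (κ * N * h) ^ 2 := by
      have hs : 0 ≤ (lam * (n * (|ζ| * |h₁|)) - 4 * (κ * N * h)) ^ 2 / (4 * lam) := by positivity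
      have e : (lam * (n * (|ζ| * |h₁|)) - 4 * (κ * N * h)) ^ 2 / (4 * lam)
          = lam / 4 * (n * (|ζ| * |h₁|)) ^ 2 + 4 / lam * (κ * N * h) ^ 2
            - 2 * (κ * N * h) * (n * (|ζ| * |h₁|)) := by field_simp; ring
      linarith
    have hc : (n * (|ζ| * |h₁|)) ^ 2 = n ^ 2 * h₁ ^ 2 * ζ ^ 2 := by
      rw [mul_pow, mul_pow, sq_abs, sq_abs]; ring
    have hd : 4 / lam * (κ * N * h) ^ 2 = 4 * κ ^ 2 / lam * N ^ 2 * h ^ 2 := by ring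
    rw [hc, hd] at hb
    linarith [neg_abs_le (Y * (2 * ζ * h * h₁))]
  have h3 : -(lam / 4 * (n ^ 2 * h₁ ^ 2 * ζ ^ 2) + β ^ 2 / lam * ζ ^ 2 * h ^ 2)
      ≤ Z * (ζ ^ 2 * h * h₁) := by
    have ha : |Z * (ζ ^ 2 * h * h₁)| ≤ (β * |ζ| * h) * (n * (|ζ| * |h₁|)) := by
      rw [abs_mul, abs_mul, abs_mul, abs_of_nonneg hh, abs_pow]
      calc |Z| * (|ζ| ^ 2 * h * |h₁|) ≤ β * n * (|ζ| ^ 2 * h * |h₁|) := by gcongr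
        _ = _ := by ring
    have hb : (β * |ζ| * h) * (n * (|ζ| * |h₁|))
        ≤ lam / 4 * (n * (|ζ| * |h₁|)) ^ 2 + 1 / lam * (β * |ζ| * h) ^ 2 := by
      have hs : 0 ≤ (lam * (n * (|ζ| * |h₁|)) - 2 * (β * |ζ| * h)) ^ 2 / (4 * lam) := by positivity
      have e : (lam * (n * (|ζ| * |h₁|)) - 2 * (β * |ζ| * h)) ^ 2 / (4 * lam)
          = lam / 4 * (n * (|ζ| * |h₁|)) ^ 2 + 1 / lam * (β * |ζ| * h) ^ 2
            - (β * |ζ| * h) * (n * (|ζ| * |h₁|)) := by field_simp; ring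
      linarith
    have hc : (n * (|ζ| * |h₁|)) ^ 2 = n ^ 2 * h₁ ^ 2 * ζ ^ 2 := by
      rw [mul_pow, mul_pow, sq_abs, sq_abs]; ring
    have hd : 1 / lam * (β * |ζ| * h) ^ 2 = β ^ 2 / lam * ζ ^ 2 * h ^ 2 := by
      rw [mul_pow, mul_pow, sq_abs]; ring
    rw [hc, hd] at hb
    linarith [neg_abs_le (Z * (ζ ^ 2 * h * h₁))]
  calc _ = (lam * n ^ 2 * (h₁ ^ 2 * ζ ^ 2)
        + -(lam / 4 * (n ^ 2 * h₁ ^ 2 * ζ ^ 2) + 4 * κ ^ 2 / lam * N ^ 2 * h ^ 2)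
        + -(lam / 4 * (n ^ 2 * h₁ ^ 2 * ζ ^ 2) + β ^ 2 / lam * ζ ^ 2 * h ^ 2)) * m := by ring
    _ ≤ (X * (ζ ^ 2 * (h₁ ^ 2 + h * h₂)) + Y * (2 * ζ * h * h₁) + Z * (ζ ^ 2 * h * h₁)) * m :=
        mul_le_mul_of_nonneg_right (by linarith) hm
    _ = _ := by ring

theorem abs_apply_le_norm {d : ℕ} (ξ : Space d) (i : Fin d) : |ξ i| ≤ ‖ξ‖ :=
  PiLp.norm_apply_le ξ i

theorem abs_fderiv_single_le {d : ℕ} (ζ : Space d → ℝ) (x : Space d) (i : Fin d) :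
    |fderiv ℝ ζ x (EuclideanSpace.single i 1)| ≤ ‖fderiv ℝ ζ x‖ := by
  have := (fderiv ℝ ζ x).le_opNorm (EuclideanSpace.single i (1 : ℝ))
  simpa using this

theorem fderiv_sq_mul_spaceDir {d : ℕ} {ζ : Space d → ℝ} {m : ℝ → ℝ} (hζ : Differentiable ℝ ζ)
    (hm : Differentiable ℝ m) (z : SpaceTime d) (i : Fin d) :
    fderiv ℝ (fun z : SpaceTime d => ζ z.1 ^ 2 * m z.2) z (spaceDir i)
      = 2 * ζ z.1 * fderiv ℝ ζ z.1 (EuclideanSpace.single i 1) * m z.2 := by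
  have h1 : HasFDerivAt (fun z : SpaceTime d => ζ z.1) ((fderiv ℝ ζ z.1).comp (fst ℝ _ _)) z :=
    (hζ z.1).hasFDerivAt.comp z hasFDerivAt_fst
  have h2 : HasFDerivAt (fun z : SpaceTime d => m z.2) ((fderiv ℝ m z.2).comp (snd ℝ _ _)) z :=
    (hm z.2).hasFDerivAt.comp z hasFDerivAt_snd
  have h3 : HasFDerivAt (fun z : SpaceTime d => ζ z.1 ^ 2 * m z.2) _ z := (h1.pow 2).mul h2
  rw [h3.fderiv]
  simp [spaceDir]
  ring

theorem fderiv_sq_mul_timeDir {d : ℕ} {ζ : Space d → ℝ} {m : ℝ → ℝ} (hζ : Differentiable ℝ ζ)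
    (hm : Differentiable ℝ m) (z : SpaceTime d) :
    fderiv ℝ (fun z : SpaceTime d => ζ z.1 ^ 2 * m z.2) z (timeDir d)
      = ζ z.1 ^ 2 * deriv m z.2 := by
  have h1 : HasFDerivAt (fun z : SpaceTime d => ζ z.1) ((fderiv ℝ ζ z.1).comp (fst ℝ _ _)) z :=
    (hζ z.1).hasFDerivAt.comp z hasFDerivAt_fst
  have h2 : HasFDerivAt (fun z : SpaceTime d => m z.2) ((fderiv ℝ m z.2).comp (snd ℝ _ _)) z :=
    (hm z.2).hasFDerivAt.comp z hasFDerivAt_snd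
  have h3 : HasFDerivAt (fun z : SpaceTime d => ζ z.1 ^ 2 * m z.2) _ z := (h1.pow 2).mul h2
  rw [h3.fderiv]
  simp [timeDir]

namespace IsEnergySolution

variable {d : ℕ} {U : Set (Space d)} {T : ℝ} {A : Space d → Matrix (Fin d) (Fin d) ℝ}
  {B : Space d → Space d} {ψ : Space d → ℝ} {lam M c₀ L : ℝ} {u : SpaceTime d → ℝ}
  {Du : SpaceTime d → Space d} {ut : SpaceTime d → ℝ}

theorem integrable_comp_fst {f : Space d → ℝ} (hf : Integrable f (volume.restrict U)) :
    Integrable (fun z : SpaceTime d => f z.1) (volume.restrict (U ×ˢ Ioo 0 T)) := by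
  rw [restrict_prod]
  exact hf.comp_fst _

theorem integrable_norm_Du_sq (h : IsEnergySolution U T A B ψ lam M c₀ L u Du ut) :
    Integrable (fun z => ‖Du z‖ ^ 2) (volume.restrict (U ×ˢ Ioo 0 T)) :=
  h.grad.memLp.norm.integrable_sq

theorem integrable_norm_B_sq (h : IsEnergySolution U T A B ψ lam M c₀ L u Du ut) :
    Integrable (fun x => ‖B x‖ ^ 2) (volume.restrict U) :=
  h.memLp_B.norm.integrable_sq

theorem integrable_ψ (h : IsEnergySolution U T A B ψ lam M c₀ L u Du ut) :
    Integrable ψ (volume.restrict U) := by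
  have : IsFiniteMeasure (volume.restrict U) :=
    ⟨by rw [Measure.restrict_apply_univ]; exact h.isBounded.measure_lt_top⟩
  exact h.memLp_ψ.integrable (by norm_num)

theorem aestronglyMeasurable_comp (h : IsEnergySolution U T A B ψ lam M c₀ L u Du ut)
    {Φ : ℝ → ℝ} (hΦ : Continuous Φ) {ν : Measure (SpaceTime d)} :
    AEStronglyMeasurable (fun z => Φ (u z)) ν :=
  (hΦ.measurable.comp h.measurable_u).aestronglyMeasurable

theorem exists_abs_comp_le (h : IsEnergySolution U T A B ψ lam M c₀ L u Du ut)
    {Φ : ℝ → ℝ} (hΦ : Continuous Φ) : ∃ C, ∀ z, |Φ (u z)| ≤ C := by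
  obtain ⟨C, hC⟩ := hΦ.exists_forall_abs_le L
  exact ⟨C, fun z => hC _ (h.bound_u z)⟩

/-- An integrable function times bounded functions of `x`, `t` and `u`. -/
theorem integrable_mul_mul_mul (h : IsEnergySolution U T A B ψ lam M c₀ L u Du ut)
    {f : SpaceTime d → ℝ} (hf : Integrable f (volume.restrict (U ×ˢ Ioo 0 T))) {Φ : ℝ → ℝ}
    (hΦ : Continuous Φ) {ζ : Space d → ℝ} (hζ : Continuous ζ) {m : ℝ → ℝ} (hm : Continuous m) :
    Integrable (fun z => f z * Φ (u z) * ζ z.1 * m z.2) (volume.restrict (U ×ˢ Ioo 0 T)) := by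
  obtain ⟨C, hC⟩ := h.exists_abs_comp_le hΦ
  obtain ⟨C₁, hC₁⟩ := h.isBounded.isCompact_closure.exists_bound_of_continuousOn hζ.continuousOn
  obtain ⟨C₂, hC₂⟩ := (isCompact_Icc (a := 0) (b := T)).exists_bound_of_continuousOn hm.continuousOn
  refine ((hf.mul_bdd (c := C) (h.aestronglyMeasurable_comp hΦ) (Eventually.of_forall hC)).mul_bdd
    (c := C₁) (hζ.comp continuous_fst).aestronglyMeasurable ?_).mul_bdd (c := C₂)
    (hm.comp continuous_snd).aestronglyMeasurable ?_
  · filter_upwards [ae_restrict_mem h.isOpen_prod.measurableSet] with z hz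
    exact hC₁ _ (subset_closure hz.1)
  · filter_upwards [ae_restrict_mem h.isOpen_prod.measurableSet] with z hz
    exact hC₂ _ (Ioo_subset_Icc_self hz.2)

/-- The energy (Caccioppoli) inequality for `h(u)`, `h` convex and nonnegative, with cut-off
`ζ(x)² m(t)`. The constants do not depend on `h`. -/
theorem energy_inequality (hs : IsEnergySolution U T A B ψ lam M c₀ L u Du ut)
    {h : ℝ → ℝ} (hsm : ContDiff ℝ ∞ h) (hpos : ∀ s, 0 ≤ h s) (hconv : ∀ s, 0 ≤ deriv (deriv h) s)
    {ζ : Space d → ℝ} {m : ℝ → ℝ} (hζ : ContDiff ℝ ∞ ζ) (hm : ContDiff ℝ ∞ m) (hm0 : ∀ t, 0 ≤ m t)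
    (htest : IsTestFunction (U ×ˢ Ioo 0 T) (fun z => ζ z.1 ^ 2 * m z.2)) :
    lam / 2 * ∫ z in U ×ˢ Ioo 0 T, ‖Du z‖ ^ 2 * deriv h (u z) ^ 2 * ζ z.1 ^ 2 * m z.2
      ≤ (∫ z in U ×ˢ Ioo 0 T, (4 * (M * d ^ 2) ^ 2 / lam * ‖fderiv ℝ ζ z.1‖ ^ 2
          + ‖B z.1‖ ^ 2 / lam * ζ z.1 ^ 2) * h (u z) ^ 2 * m z.2)
        + ∫ z in U ×ˢ Ioo 0 T, ψ z.1 * (ζ z.1 ^ 2 * deriv m z.2) * (h (u z) ^ 2 / 2) := by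
  have hh' : ContDiff ℝ ∞ (deriv h) := (contDiff_infty_iff_deriv.1 hsm).2
  have hd1 : ∀ s, HasDerivAt h (deriv h s) s := fun s =>
    (hsm.differentiable (by simp) s).hasDerivAt
  have hd2 : ∀ s, HasDerivAt (deriv h) (deriv (deriv h) s) s := fun s =>
    (hh'.differentiable (by simp) s).hasDerivAt
  have hζd := hζ.differentiable (by simp)
  have hmd := hm.differentiable (by simp)
  -- the test function is `ζ² m h(u) h'(u)`, and `h h'' ≥ 0` by convexity
  obtain ⟨hint, hid⟩ := hs.integral_identity htest (F := fun s => h s * deriv h s)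
    (G := fun s => h s ^ 2 / 2) (hsm.mul hh') (fun s => by
      have h1 : HasDerivAt (fun s => h s ^ 2 / 2) (((2 : ℕ) * h s ^ (2 - 1) * deriv h s) / 2) s :=
        ((hd1 s).pow 2).div_const 2
      refine h1.congr_deriv ?_
      norm_num
      ring)
  have hFd : ∀ s, deriv (fun s => h s * deriv h s) s = deriv h s ^ 2 + h s * deriv (deriv h) s :=
    fun s => by
      have h1 : HasDerivAt (fun s => h s * deriv h s) _ s := (hd1 s).mul (hd2 s)
      rw [h1.deriv]; ring
  simp_rw [fderiv_sq_mul_timeDir hζd hmd] at hid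
  rw [hid]
  have i1 : Integrable (fun z => ‖Du z‖ ^ 2 * deriv h (u z) ^ 2 * ζ z.1 ^ 2 * m z.2)
      (volume.restrict (U ×ˢ Ioo 0 T)) :=
    hs.integrable_mul_mul_mul hs.integrable_norm_Du_sq (hh'.continuous.pow 2)
      (hζ.continuous.pow 2) hm.continuous
  have hvol : IsFiniteMeasure (volume.restrict (U ×ˢ Ioo 0 T) : Measure (SpaceTime d)) :=
    ⟨by rw [Measure.restrict_apply_univ]; exact hs.volume_lt_top⟩
  have hfζ : Continuous fun x => ‖fderiv ℝ ζ x‖ ^ 2 := (hζ.continuous_fderiv (by simp)).norm.pow 2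
  have i2 : Integrable (fun z : SpaceTime d => (4 * (M * d ^ 2) ^ 2 / lam * ‖fderiv ℝ ζ z.1‖ ^ 2
          + ‖B z.1‖ ^ 2 / lam * ζ z.1 ^ 2) * h (u z) ^ 2 * m z.2)
      (volume.restrict (U ×ˢ Ioo 0 T)) := by
    have a := hs.integrable_mul_mul_mul (integrable_const (4 * (M * d ^ 2) ^ 2 / lam))
      (hsm.continuous.pow 2) hfζ hm.continuous
    have b := hs.integrable_mul_mul_mul
      (integrable_comp_fst (T := T) (hs.integrable_norm_B_sq.div_const lam))
      (hsm.continuous.pow 2) (hζ.continuous.pow 2) hm.continuous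
    refine (a.add b).congr (Eventually.of_forall fun z => ?_)
    simp only [Pi.add_apply, Pi.pow_apply]
    ring
  rw [← integral_const_mul, ← sub_le_iff_le_add', ← integral_sub (i1.const_mul _) i2]
  refine integral_mono_ae ((i1.const_mul _).sub i2) hint ?_
  filter_upwards [ae_comp_fst hs.elliptic, ae_comp_fst hs.bound_A] with z hell hbd
  have hX : lam * ‖Du z‖ ^ 2 ≤ ∑ i, ∑ j, A z.1 i j * Du z j * Du z i := by
    refine (hell (Du z)).trans (le_of_eq ?_)
    exact Finset.sum_congr rfl fun i _ => Finset.sum_congr rfl fun j _ => by ring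
  have hY : |∑ i, ∑ j, A z.1 i j * Du z j * fderiv ℝ ζ z.1 (EuclideanSpace.single i 1)|
      ≤ M * d ^ 2 * (‖Du z‖ * ‖fderiv ℝ ζ z.1‖) := by
    have hterm : ∀ i j, |A z.1 i j * Du z j * fderiv ℝ ζ z.1 (EuclideanSpace.single i 1)|
        ≤ M * ‖Du z‖ * ‖fderiv ℝ ζ z.1‖ := by
      intro i j
      rw [abs_mul, abs_mul]
      have := abs_apply_le_norm (Du z) j
      have := abs_fderiv_single_le ζ z.1 i
      have := hbd i j
      have := hs.M_pos
      gcongr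
    calc _ ≤ ∑ i : Fin d, ∑ j : Fin d, M * ‖Du z‖ * ‖fderiv ℝ ζ z.1‖ :=
          (Finset.abs_sum_le_sum_abs _ _).trans (Finset.sum_le_sum fun i _ =>
            (Finset.abs_sum_le_sum_abs _ _).trans (Finset.sum_le_sum fun j _ => hterm i j))
      _ = _ := by simp; ring
  have hZ : |∑ i, B z.1 i * Du z i| ≤ ‖B z.1‖ * ‖Du z‖ := by
    have := abs_real_inner_le_norm (Du z) (B z.1)
    rw [PiLp.inner_apply] at this
    simpa [mul_comm] using this
  refine (energy_pointwise (h₁ := deriv h (u z)) (ζ := ζ z.1) hs.lam_pos hX hY hZ (hpos (u z))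
    (hconv (u z)) (hm0 z.2)).trans (le_of_eq ?_)
  rw [Finset.sum_mul, Finset.sum_mul, Finset.sum_mul, ← Finset.sum_add_distrib]
  congr 1
  · refine Finset.sum_congr rfl fun i _ => ?_
    rw [Finset.sum_mul, Finset.sum_mul, ← Finset.sum_add_distrib]
    refine Finset.sum_congr rfl fun j _ => ?_
    rw [fderiv_sq_mul_spaceDir hζd hmd, hFd]
    ring
  · exact Finset.sum_congr rfl fun i _ => by ring

end IsEnergySolution

/-! ### Parabolic cut-offs -/

/-- The primitive of a normalised bump function on the line: a smooth step from `0` to `1`. -/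
theorem exists_primitive_bump (φ : ContDiffBump (0 : ℝ)) :
    ∃ Θ : ℝ → ℝ, ContDiff ℝ ∞ Θ ∧ (∀ y, HasDerivAt Θ (φ.normed volume y) y) ∧
      (∀ y, 0 ≤ Θ y) ∧ (∀ y, Θ y ≤ 1) ∧ (∀ y, y ≤ -φ.rOut → Θ y = 0) ∧
      (∀ y, φ.rOut ≤ y → Θ y = 1) := by
  have hr := φ.rOut_pos
  have hder : ∀ y, HasDerivAt (fun y => ∫ s in (-φ.rOut)..y, φ.normed volume s)
      (φ.normed volume y) y := fun y =>
    (φ.continuous_normed.integral_hasStrictDerivAt _ y).hasDerivAt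
  have hmono : Monotone (fun y => ∫ s in (-φ.rOut)..y, φ.normed volume s) :=
    monotone_of_deriv_nonneg (fun y => (hder y).differentiableAt) fun y => by
      rw [(hder y).deriv]; exact φ.nonneg_normed y
  have hsupp : Function.support (φ.normed (volume : Measure ℝ)) = Ioo (-φ.rOut) φ.rOut := by
    rw [φ.support_normed_eq, Real.ball_eq_Ioo, zero_sub, zero_add]
  have hone : ∀ y, φ.rOut ≤ y → ∫ s in (-φ.rOut)..y, φ.normed volume s = 1 := by
    intro y hy
    rw [intervalIntegral.integral_eq_integral_of_support_subset, φ.integral_normed]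
    rw [hsupp]
    exact fun s hs => ⟨hs.1, hs.2.le.trans hy⟩
  have hzero : ∀ y, y ≤ -φ.rOut → ∫ s in (-φ.rOut)..y, φ.normed volume s = 0 := by
    intro y hy
    rw [intervalIntegral.integral_symm, intervalIntegral.integral_of_le hy, neg_eq_zero]
    refine setIntegral_eq_zero_of_forall_eq_zero fun s hs => ?_
    by_contra hne
    have : s ∈ Ioo (-φ.rOut) φ.rOut := hsupp ▸ hne
    exact absurd this.1 (not_lt.2 hs.2)
  refine ⟨_, ?_, hder, fun y => ?_, fun y => ?_, hzero, hone⟩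
  · rw [contDiff_infty_iff_deriv]
    refine ⟨fun y => (hder y).differentiableAt, ?_⟩
    rw [show deriv (fun y => ∫ s in (-φ.rOut)..y, φ.normed volume s) = φ.normed volume from
      funext fun y => (hder y).deriv]
    exact φ.contDiff_normed
  · rcases le_total y (-φ.rOut) with hy | hy
    · exact (hzero y hy).ge
    · have := hmono hy
      simpa using this
  · rcases le_total φ.rOut y with hy | hy
    · exact (hone y hy).le
    · exact (hmono hy).trans (hone _ le_rfl).le

theorem isOpen_cube {d : ℕ} (x₀ : Space d) (ρ : ℝ) : IsOpen (cube x₀ ρ) := by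
  have : cube x₀ ρ = ⋂ i, {y : Space d | |y i - x₀ i| < ρ / 2} := by
    ext y; simp [cube]
  rw [this]
  exact isOpen_iInter_of_finite fun i => isOpen_lt (by fun_prop) continuous_const

theorem isBounded_cube {d : ℕ} (x₀ : Space d) (ρ : ℝ) : Bornology.IsBounded (cube x₀ ρ) := by
  refine (isBounded_iff_subset_closedBall x₀).2 ⟨√(d * (ρ / 2) ^ 2), fun y hy => ?_⟩
  rw [mem_closedBall, EuclideanSpace.dist_eq]
  refine Real.sqrt_le_sqrt ?_
  calc ∑ i, dist (y i) (x₀ i) ^ 2 ≤ ∑ _i : Fin d, (ρ / 2) ^ 2 := by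
        refine Finset.sum_le_sum fun i _ => ?_
        rw [Real.dist_eq]
        have := hy i
        exact pow_le_pow_left₀ (abs_nonneg _) this.le 2
    _ = _ := by simp

theorem cube_subset_cube {d : ℕ} (x₀ : Space d) {ρ ρ' : ℝ} (h : ρ ≤ ρ') :
    cube x₀ ρ ⊆ cube x₀ ρ' := fun y hy i => (hy i).trans_le (by linarith)

theorem measurableSet_paraCylinder {d : ℕ} (x₀ : Space d) (t₀ ρ : ℝ) :
    MeasurableSet (paraCylinder x₀ t₀ ρ) :=
  (isOpen_cube x₀ ρ).measurableSet.prod measurableSet_Ioo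

/-- `ζ` and `χ` are cut-off functions in space and time which are `1` on the parabolic cylinder of
size `ρ` and vanish outside the one of size `ρ'` (except that `χ` is not cut off at the
top), with derivatives controlled by `D` (space) and `D²` (time). -/
structure IsParabolicCutoff {d : ℕ} (x₀ : Space d) (t₀ ρ ρ' D : ℝ) (ζ : Space d → ℝ)
    (χ : ℝ → ℝ) : Prop where
  one_le : 1 ≤ D
  smooth_space : ContDiff ℝ ∞ ζ
  space_nonneg : ∀ x, 0 ≤ ζ x
  space_le_one : ∀ x, ζ x ≤ 1
  space_eq_one : ∀ x ∈ cube x₀ ρ, ζ x = 1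
  tsupport_space : tsupport ζ ⊆ cube x₀ ρ'
  norm_fderiv_le : ∀ x, ‖fderiv ℝ ζ x‖ ≤ D
  smooth_time : ContDiff ℝ ∞ χ
  time_nonneg : ∀ t, 0 ≤ χ t
  time_le_one : ∀ t, χ t ≤ 1
  time_eq_one : ∀ t, t₀ - ρ ^ 2 ≤ t → χ t = 1
  time_eq_zero : ∀ t, t ≤ t₀ - ρ' ^ 2 → χ t = 0
  abs_deriv_le : ∀ t, |deriv χ t| ≤ D ^ 2

namespace IsParabolicCutoff

variable {d : ℕ} {x₀ : Space d} {t₀ ρ ρ' D : ℝ} {ζ : Space d → ℝ} {χ : ℝ → ℝ}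

theorem space_eq_zero (hc : IsParabolicCutoff x₀ t₀ ρ ρ' D ζ χ) {x : Space d}
    (hx : x ∉ cube x₀ ρ') : ζ x = 0 :=
  image_eq_zero_of_notMem_tsupport fun h => hx (hc.tsupport_space h)

theorem fderiv_space_eq_zero (hc : IsParabolicCutoff x₀ t₀ ρ ρ' D ζ χ) {x : Space d}
    (hx : x ∉ cube x₀ ρ') : fderiv ℝ ζ x = 0 :=
  image_eq_zero_of_notMem_tsupport fun h => hx (hc.tsupport_space (tsupport_fderiv_subset ℝ h))

theorem isCompact_tsupport (hc : IsParabolicCutoff x₀ t₀ ρ ρ' D ζ χ) : IsCompact (tsupport ζ) :=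
  isCompact_of_isClosed_isBounded (isClosed_tsupport ζ)
    ((isBounded_cube x₀ ρ').subset hc.tsupport_space)

theorem isTestFunction (hc : IsParabolicCutoff x₀ t₀ ρ ρ' D ζ χ) {U : Set (Space d)} {T t₁ : ℝ}
    (hU : cube x₀ ρ' ⊆ U) (h0 : 0 < t₀ - ρ' ^ 2) (ht₁ : t₁ < T) {θ : ℝ → ℝ}
    (hθ : ContDiff ℝ ∞ θ) (hθ0 : ∀ t, t₁ ≤ t → θ t = 0) :
    IsTestFunction (U ×ˢ Ioo 0 T) (fun z => ζ z.1 ^ 2 * (χ z.2 ^ 2 * θ z.2)) := by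
  have hsub : tsupport (fun z : SpaceTime d => ζ z.1 ^ 2 * (χ z.2 ^ 2 * θ z.2))
      ⊆ tsupport ζ ×ˢ Icc (t₀ - ρ' ^ 2) t₁ := by
    refine closure_minimal (fun z hz => ?_) ((isClosed_tsupport ζ).prod isClosed_Icc)
    rw [Function.mem_support] at hz
    refine ⟨subset_tsupport ζ fun h => hz (by simp [h]), ?_, ?_⟩
    · by_contra hlt
      exact hz (by simp [hc.time_eq_zero _ (not_le.1 hlt).le])
    · by_contra hlt
      exact hz (by simp [hθ0 _ (not_le.1 hlt).le])
  refine ⟨?_, ?_, ?_⟩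
  · exact ((hc.smooth_space.comp contDiff_fst).pow 2).mul
      (((hc.smooth_time.comp contDiff_snd).pow 2).mul (hθ.comp contDiff_snd))
  · exact (hc.isCompact_tsupport.prod isCompact_Icc).of_isClosed_subset (isClosed_tsupport _) hsub
  · refine hsub.trans (Set.prod_mono (hc.tsupport_space.trans hU) fun t ht => ?_)
    exact ⟨h0.trans_le ht.1, ht.2.trans_lt ht₁⟩

end IsParabolicCutoff

namespace IsEnergySolution

variable {d : ℕ} {U : Set (Space d)} {T : ℝ} {A : Space d → Matrix (Fin d) (Fin d) ℝ}
  {B : Space d → Space d} {ψ : Space d → ℝ} {lam M c₀ L : ℝ} {u : SpaceTime d → ℝ}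
  {Du : SpaceTime d → Space d} {ut : SpaceTime d → ℝ}
  {x₀ : Space d} {t₀ ρ ρ' D : ℝ} {ζ : Space d → ℝ} {χ : ℝ → ℝ} {h : ℝ → ℝ}

/-- The right-hand side of the energy estimates: up to a constant, the integral of
`(ψ + 1 + |B|²) h(u)²` over the larger cylinder. -/
def energyBound (B : Space d → Space d) (ψ : Space d → ℝ) (lam M : ℝ) (u : SpaceTime d → ℝ)
    (h : ℝ → ℝ) (x₀ : Space d) (t₀ ρ' D : ℝ) : ℝ :=
  (4 * (M * d ^ 2) ^ 2 / lam + 1 / lam + 1) * D ^ 2 *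
    ∫ z in paraCylinder x₀ t₀ ρ', (ψ z.1 + 1 + ‖B z.1‖ ^ 2) * h (u z) ^ 2

theorem integrable_weight (hs : IsEnergySolution U T A B ψ lam M c₀ L u Du ut) :
    Integrable (fun x => ψ x + 1 + ‖B x‖ ^ 2) (volume.restrict U) := by
  have : IsFiniteMeasure (volume.restrict U) :=
    ⟨by rw [Measure.restrict_apply_univ]; exact hs.isBounded.measure_lt_top⟩
  exact (hs.integrable_ψ.add (integrable_const 1)).add hs.integrable_norm_B_sq

theorem paraCylinder_subset (hU : cube x₀ ρ' ⊆ U) (h0 : 0 < t₀ - ρ' ^ 2) (hT : t₀ < T) :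
    paraCylinder x₀ t₀ ρ' ⊆ U ×ˢ Ioo 0 T :=
  Set.prod_mono hU fun _ ht => ⟨h0.trans ht.1, ht.2.trans hT⟩

/-- The energy inequality with the space-time cut-off `ζ² χ² θ`, `θ` a nonincreasing cut-off at the
top of the cylinder. -/
theorem energy_le (hs : IsEnergySolution U T A B ψ lam M c₀ L u Du ut)
    (hsm : ContDiff ℝ ∞ h) (hpos : ∀ s, 0 ≤ h s) (hconv : ∀ s, 0 ≤ deriv (deriv h) s)
    (hc : IsParabolicCutoff x₀ t₀ ρ ρ' D ζ χ)
    (hU : cube x₀ ρ' ⊆ U) (h0 : 0 < t₀ - ρ' ^ 2) (hT : t₀ < T) {θ : ℝ → ℝ} (hθ : ContDiff ℝ ∞ θ)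
    (hθ0 : ∀ t, 0 ≤ θ t) (hθ1 : ∀ t, θ t ≤ 1) {t₁ : ℝ} (ht₁ : t₁ < t₀)
    (hθz : ∀ t, t₁ ≤ t → θ t = 0) :
    lam / 2 * (∫ z in U ×ˢ Ioo 0 T,
        ‖Du z‖ ^ 2 * deriv h (u z) ^ 2 * ζ z.1 ^ 2 * (χ z.2 ^ 2 * θ z.2))
      + 1 / 2 * (∫ z in U ×ˢ Ioo 0 T, ψ z.1 * h (u z) ^ 2 * ζ z.1 ^ 2 * (χ z.2 ^ 2 * -deriv θ z.2))
      ≤ energyBound B ψ lam M u h x₀ t₀ ρ' D := by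
  have hlam := hs.lam_pos
  have hχd := hc.smooth_time.differentiable (by simp)
  have hθd := hθ.differentiable (by simp)
  have hχ'c : Continuous (deriv χ) := hc.smooth_time.continuous_deriv (by simp)
  have hθ'c : Continuous (deriv θ) := hθ.continuous_deriv (by simp)
  have hm' : ∀ t, deriv (fun t => χ t ^ 2 * θ t) t
      = 2 * χ t * deriv χ t * θ t + χ t ^ 2 * deriv θ t := by
    intro t
    have h1 : HasDerivAt (fun t => χ t ^ 2 * θ t) _ t :=
      ((hχd t).hasDerivAt.pow 2).mul (hθd t).hasDerivAt
    rw [h1.deriv]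
    norm_num
  have e := hs.energy_inequality hsm hpos hconv hc.smooth_space
    (m := fun t => χ t ^ 2 * θ t) ((hc.smooth_time.pow 2).mul hθ)
    (fun t => mul_nonneg (sq_nonneg _) (hθ0 t)) (hc.isTestFunction hU h0 (ht₁.trans hT) hθ hθz)
  simp_rw [hm'] at e
  have hvol : IsFiniteMeasure (volume.restrict (U ×ˢ Ioo 0 T) : Measure (SpaceTime d)) :=
    ⟨by rw [Measure.restrict_apply_univ]; exact hs.volume_lt_top⟩
  have hζ2 : Continuous fun x => ζ x ^ 2 := hc.smooth_space.continuous.pow 2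
  have hh2 : Continuous fun s => h s ^ 2 := hsm.continuous.pow 2
  have hm2 : Continuous fun t => χ t ^ 2 * θ t :=
    (hc.smooth_time.continuous.pow 2).mul hθ.continuous
  have hfζ : Continuous fun x => ‖fderiv ℝ ζ x‖ ^ 2 :=
    (hc.smooth_space.continuous_fderiv (by simp)).norm.pow 2
  have i2 : Integrable (fun z : SpaceTime d => (4 * (M * d ^ 2) ^ 2 / lam * ‖fderiv ℝ ζ z.1‖ ^ 2
          + ‖B z.1‖ ^ 2 / lam * ζ z.1 ^ 2) * h (u z) ^ 2 * (χ z.2 ^ 2 * θ z.2))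
      (volume.restrict (U ×ˢ Ioo 0 T)) := by
    have a := hs.integrable_mul_mul_mul (integrable_const (4 * (M * d ^ 2) ^ 2 / lam)) hh2 hfζ hm2
    have b := hs.integrable_mul_mul_mul
      (integrable_comp_fst (T := T) (hs.integrable_norm_B_sq.div_const lam)) hh2 hζ2 hm2
    refine (a.add b).congr (Eventually.of_forall fun z => ?_)
    simp only [Pi.add_apply]
    ring
  have i3 : Integrable (fun z : SpaceTime d => ψ z.1 * h (u z) ^ 2 * ζ z.1 ^ 2
      * (χ z.2 * deriv χ z.2 * θ z.2)) (volume.restrict (U ×ˢ Ioo 0 T)) :=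
    hs.integrable_mul_mul_mul (integrable_comp_fst (T := T) hs.integrable_ψ) hh2 hζ2
      ((hc.smooth_time.continuous.mul hχ'c).mul hθ.continuous)
  have i4 : Integrable (fun z : SpaceTime d => ψ z.1 * h (u z) ^ 2 * ζ z.1 ^ 2
      * (χ z.2 ^ 2 * -deriv θ z.2)) (volume.restrict (U ×ˢ Ioo 0 T)) :=
    hs.integrable_mul_mul_mul (integrable_comp_fst (T := T) hs.integrable_ψ) hh2 hζ2
      ((hc.smooth_time.continuous.pow 2).mul hθ'c.neg)
  have hsplit : ∫ z in U ×ˢ Ioo 0 T, ψ z.1 * (ζ z.1 ^ 2 * (2 * χ z.2 * deriv χ z.2 * θ z.2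
        + χ z.2 ^ 2 * deriv θ z.2)) * (h (u z) ^ 2 / 2)
      = (∫ z in U ×ˢ Ioo 0 T, ψ z.1 * h (u z) ^ 2 * ζ z.1 ^ 2 * (χ z.2 * deriv χ z.2 * θ z.2))
        - 1 / 2 * ∫ z in U ×ˢ Ioo 0 T, ψ z.1 * h (u z) ^ 2 * ζ z.1 ^ 2
          * (χ z.2 ^ 2 * -deriv θ z.2) := by
    rw [← integral_const_mul, ← integral_sub i3 (i4.const_mul _)]
    refine integral_congr_ae (Eventually.of_forall fun z => ?_)
    dsimp only
    ring
  rw [hsplit] at e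
  have hQ := paraCylinder_subset hU h0 hT
  have hQm := measurableSet_paraCylinder x₀ t₀ ρ'
  set C₁ := 4 * (M * d ^ 2) ^ 2 / lam + 1 / lam + 1 with hC₁
  have i5 : Integrable (fun z : SpaceTime d => (ψ z.1 + 1 + ‖B z.1‖ ^ 2) * h (u z) ^ 2)
      (volume.restrict (U ×ˢ Ioo 0 T)) := by
    have := hs.integrable_mul_mul_mul (integrable_comp_fst (T := T) hs.integrable_weight) hh2
      (ζ := fun _ => 1) continuous_const (m := fun _ => 1) continuous_const
    simpa using this
  have key : (∫ z in U ×ˢ Ioo 0 T, (4 * (M * d ^ 2) ^ 2 / lam * ‖fderiv ℝ ζ z.1‖ ^ 2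
          + ‖B z.1‖ ^ 2 / lam * ζ z.1 ^ 2) * h (u z) ^ 2 * (χ z.2 ^ 2 * θ z.2))
      + (∫ z in U ×ˢ Ioo 0 T, ψ z.1 * h (u z) ^ 2 * ζ z.1 ^ 2 * (χ z.2 * deriv χ z.2 * θ z.2))
      ≤ energyBound B ψ lam M u h x₀ t₀ ρ' D := by
    rw [energyBound, ← integral_add i2 i3, ← integral_const_mul,
      ← inter_eq_self_of_subset_right hQ, ← setIntegral_indicator hQm]
    refine integral_mono_ae (i2.add i3) ((i5.const_mul _).indicator hQm) ?_
    filter_upwards [ae_comp_fst hs.le_ψ] with z hψ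
    have hψ0 : 0 ≤ ψ z.1 := hs.c₀_pos.le.trans hψ
    by_cases hz : z ∈ paraCylinder x₀ t₀ ρ'
    · rw [indicator_of_mem hz]
      have hD2 : 1 ≤ D ^ 2 := one_le_pow₀ hc.one_le
      have hm0 : 0 ≤ χ z.2 ^ 2 * θ z.2 := mul_nonneg (sq_nonneg _) (hθ0 _)
      have hm1 : χ z.2 ^ 2 * θ z.2 ≤ 1 :=
        mul_le_one₀ (pow_le_one₀ (hc.time_nonneg _) (hc.time_le_one _)) (hθ0 _) (hθ1 _)
      have hζ0 : ζ z.1 ^ 2 ≤ 1 := pow_le_one₀ (hc.space_nonneg _) (hc.space_le_one _)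
      have hN : ‖fderiv ℝ ζ z.1‖ ^ 2 ≤ D ^ 2 := by
        gcongr; exact hc.norm_fderiv_le _
      have hχ' : χ z.2 * deriv χ z.2 * θ z.2 ≤ D ^ 2 := by
        calc χ z.2 * deriv χ z.2 * θ z.2 ≤ |χ z.2 * deriv χ z.2 * θ z.2| := le_abs_self _
          _ = χ z.2 * |deriv χ z.2| * θ z.2 := by
            rw [abs_mul, abs_mul, abs_of_nonneg (hc.time_nonneg _), abs_of_nonneg (hθ0 _)]
          _ ≤ 1 * D ^ 2 * 1 := by
            have := hc.abs_deriv_le z.2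
            have := hc.time_nonneg z.2
            have := hc.time_le_one z.2
            have := hθ0 z.2
            have := hθ1 z.2
            gcongr
          _ = D ^ 2 := by ring
      have hB : 0 ≤ ‖B z.1‖ ^ 2 := sq_nonneg _
      have hH : 0 ≤ h (u z) ^ 2 := sq_nonneg _
      have hk : 0 ≤ 4 * (M * d ^ 2) ^ 2 / lam := by positivity
      have hl : 0 ≤ 1 / lam := by positivity
      have t1 : (4 * (M * d ^ 2) ^ 2 / lam * ‖fderiv ℝ ζ z.1‖ ^ 2 + ‖B z.1‖ ^ 2 / lam * ζ z.1 ^ 2)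
            * h (u z) ^ 2 * (χ z.2 ^ 2 * θ z.2)
          ≤ (4 * (M * d ^ 2) ^ 2 / lam * D ^ 2 + ‖B z.1‖ ^ 2 / lam * 1) * h (u z) ^ 2 * 1 := by
        gcongr
      have t2 : ψ z.1 * h (u z) ^ 2 * ζ z.1 ^ 2 * (χ z.2 * deriv χ z.2 * θ z.2)
          ≤ ψ z.1 * h (u z) ^ 2 * D ^ 2 := by
        calc _ ≤ ψ z.1 * h (u z) ^ 2 * ζ z.1 ^ 2 * D ^ 2 := by gcongr
          _ ≤ ψ z.1 * h (u z) ^ 2 * 1 * D ^ 2 := by gcongr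
          _ = _ := by ring
      refine (add_le_add t1 t2).trans ?_
      have hbb : ‖B z.1‖ ^ 2 / lam * 1 ≤ 1 / lam * D ^ 2 * ‖B z.1‖ ^ 2 := by
        have : 0 ≤ 1 / lam * ‖B z.1‖ ^ 2 * (D ^ 2 - 1) := by
          have : 0 ≤ D ^ 2 - 1 := by linarith
          positivity
        calc ‖B z.1‖ ^ 2 / lam * 1 = 1 / lam * ‖B z.1‖ ^ 2 := by ring
          _ ≤ 1 / lam * ‖B z.1‖ ^ 2 + 1 / lam * ‖B z.1‖ ^ 2 * (D ^ 2 - 1) := by linarith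
          _ = _ := by ring
      have hw1 : (4 * (M * d ^ 2) ^ 2 / lam) * D ^ 2
          ≤ (4 * (M * d ^ 2) ^ 2 / lam) * D ^ 2 * (ψ z.1 + 1 + ‖B z.1‖ ^ 2) :=
        le_mul_of_one_le_right (by positivity) (by linarith)
      have hw2 : 1 / lam * D ^ 2 * ‖B z.1‖ ^ 2 ≤ 1 / lam * D ^ 2 * (ψ z.1 + 1 + ‖B z.1‖ ^ 2) :=
        mul_le_mul_of_nonneg_left (by linarith) (by positivity)
      have hw3 : D ^ 2 * ψ z.1 ≤ D ^ 2 * (ψ z.1 + 1 + ‖B z.1‖ ^ 2) :=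
        mul_le_mul_of_nonneg_left (by linarith) (by positivity)
      have hsum : 4 * (M * d ^ 2) ^ 2 / lam * D ^ 2 + ‖B z.1‖ ^ 2 / lam * 1 + D ^ 2 * ψ z.1
          ≤ C₁ * D ^ 2 * (ψ z.1 + 1 + ‖B z.1‖ ^ 2) := by
        rw [hC₁]; linarith
      calc _ = (4 * (M * d ^ 2) ^ 2 / lam * D ^ 2 + ‖B z.1‖ ^ 2 / lam * 1 + D ^ 2 * ψ z.1)
            * h (u z) ^ 2 := by ring
        _ ≤ C₁ * D ^ 2 * (ψ z.1 + 1 + ‖B z.1‖ ^ 2) * h (u z) ^ 2 := by gcongr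
        _ = _ := by ring
    · rw [indicator_of_notMem hz]
      by_cases hx : z.1 ∈ cube x₀ ρ'
      · have ht : ¬ (t₀ - ρ' ^ 2 < z.2 ∧ z.2 < t₀) := fun ht => hz ⟨hx, ht⟩
        have : χ z.2 = 0 ∨ θ z.2 = 0 := by
          by_cases h1 : t₀ - ρ' ^ 2 < z.2
          · exact Or.inr (hθz _ (ht₁.le.trans (not_lt.1 fun h2 => ht ⟨h1, h2⟩)))
          · exact Or.inl (hc.time_eq_zero _ (not_lt.1 h1))
        rcases this with h1 | h1 <;> simp [h1]
      · simp [hc.space_eq_zero hx, hc.fderiv_space_eq_zero hx]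
  linarith

end IsEnergySolution

/-! ### Energy bounds for the gradient and at fixed times -/

/-- Smooth nonincreasing cut-offs from `1` to `0` at time `τ` whose negative derivative is a
translated bump. -/
theorem exists_time_step (φ : ContDiffBump (0 : ℝ)) (τ : ℝ) :
    ∃ θ : ℝ → ℝ, ContDiff ℝ ∞ θ ∧ (∀ t, deriv θ t = -φ.normed volume (τ - t)) ∧
      (∀ t, 0 ≤ θ t) ∧ (∀ t, θ t ≤ 1) ∧ (∀ t, τ + φ.rOut ≤ t → θ t = 0) ∧
      (∀ t, t ≤ τ - φ.rOut → θ t = 1) := by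
  obtain ⟨Θ, hs, hd, h0, h1, hz, hone⟩ := exists_primitive_bump φ
  refine ⟨fun t => Θ (τ - t), hs.comp (contDiff_const.sub contDiff_id), fun t => ?_,
    fun t => h0 _, fun t => h1 _, fun t ht => hz _ (by linarith), fun t ht => hone _ (by linarith)⟩
  have := (hd (τ - t)).comp t ((hasDerivAt_id t).const_sub τ)
  have h2 : HasDerivAt (fun t => Θ (τ - t)) (φ.normed volume (τ - t) * -1) t := this
  rw [h2.deriv, mul_neg_one]

namespace IsEnergySolution

variable {d : ℕ} {U : Set (Space d)} {T : ℝ} {A : Space d → Matrix (Fin d) (Fin d) ℝ}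
  {B : Space d → Space d} {ψ : Space d → ℝ} {lam M c₀ L : ℝ} {u : SpaceTime d → ℝ}
  {Du : SpaceTime d → Space d} {ut : SpaceTime d → ℝ}
  {x₀ : Space d} {t₀ ρ ρ' D : ℝ} {ζ : Space d → ℝ} {χ : ℝ → ℝ} {h : ℝ → ℝ}

/-- Bound for the gradient of `h(u)` up to the top of the cylinder. The upper end `t₀` is approached
from below by cut-offs in time. -/
theorem lintegral_gradient_le (hs : IsEnergySolution U T A B ψ lam M c₀ L u Du ut)
    (hsm : ContDiff ℝ ∞ h) (hpos : ∀ s, 0 ≤ h s) (hconv : ∀ s, 0 ≤ deriv (deriv h) s)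
    (hc : IsParabolicCutoff x₀ t₀ ρ ρ' D ζ χ)
    (hU : cube x₀ ρ' ⊆ U) (h0 : 0 < t₀ - ρ' ^ 2) (hT : t₀ < T) :
    ∫⁻ z in U ×ˢ Ioo 0 t₀,
        ENNReal.ofReal (‖Du z‖ ^ 2 * deriv h (u z) ^ 2 * ζ z.1 ^ 2 * χ z.2 ^ 2)
      ≤ ENNReal.ofReal (2 / lam * energyBound B ψ lam M u h x₀ t₀ ρ' D) := by
  have hlam := hs.lam_pos
  set E : SpaceTime d → ℝ := fun z => ‖Du z‖ ^ 2 * deriv h (u z) ^ 2 * ζ z.1 ^ 2 * χ z.2 ^ 2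
    with hE
  set ε : ℕ → ℝ := fun n => 1 / ((n : ℝ) + 1) with hε
  have hεpos : ∀ n, 0 < ε n := fun n => by positivity
  have hεlim : Tendsto ε atTop (𝓝 0) := tendsto_one_div_add_atTop_nhds_zero_nat
  have hεanti : Antitone ε := fun m n hmn => by
    have : (m : ℝ) ≤ n := by exact_mod_cast hmn
    exact one_div_le_one_div_of_le (by positivity) (by linarith)
  have hunion : (⋃ n, U ×ˢ Ioo 0 (t₀ - 3 * ε n)) = U ×ˢ Ioo 0 t₀ := by
    ext z
    simp only [mem_iUnion, mem_prod, mem_Ioo]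
    constructor
    · rintro ⟨n, h1, h2, h3⟩
      exact ⟨h1, h2, by linarith [hεpos n]⟩
    · rintro ⟨h1, h2, h3⟩
      obtain ⟨n, hn⟩ := (hεlim.eventually_lt_const (show 0 < (t₀ - z.2) / 3 by linarith)).exists
      exact ⟨n, h1, h2, by linarith⟩
  have hdir : Directed (· ⊆ ·) fun n => U ×ˢ Ioo 0 (t₀ - 3 * ε n) := by
    refine Monotone.directed_le fun m n hmn => Set.prod_mono le_rfl (Ioo_subset_Ioo_right ?_)
    linarith [hεanti hmn]
  have hmeas : ∀ n, MeasurableSet (U ×ˢ Ioo 0 (t₀ - 3 * ε n)) := fun n =>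
    hs.isOpen.measurableSet.prod measurableSet_Ioo
  rw [← withDensity_apply _ (hs.isOpen.measurableSet.prod measurableSet_Ioo), ← hunion,
    hdir.measure_iUnion]
  refine iSup_le fun n => ?_
  rw [withDensity_apply _ (hmeas n)]
  obtain ⟨θ, hθs, hθd, hθ0, hθ1, hθz, hθone⟩ := exists_time_step
    (⟨ε n / 2, ε n, half_pos (hεpos n), half_lt_self (hεpos n)⟩ : ContDiffBump (0 : ℝ))
    (t₀ - 2 * ε n)
  have e := hs.energy_le hsm hpos hconv hc hU h0 hT hθs hθ0 hθ1
    (t₁ := t₀ - ε n) (by linarith [hεpos n]) (fun t ht => hθz _ (by dsimp only; linarith))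
  have hpos2 : 0 ≤ ∫ z in U ×ˢ Ioo 0 T,
      ψ z.1 * h (u z) ^ 2 * ζ z.1 ^ 2 * (χ z.2 ^ 2 * -deriv θ z.2) := by
    refine integral_nonneg_of_ae ?_
    filter_upwards [ae_comp_fst hs.le_ψ] with z hz
    have h1 : 0 ≤ ψ z.1 := hs.c₀_pos.le.trans hz
    have h2 : 0 ≤ -deriv θ z.2 := by
      rw [hθd, neg_neg]; exact ContDiffBump.nonneg_normed _ _
    simp only [Pi.zero_apply]
    positivity
  have hint : Integrable (fun z => ‖Du z‖ ^ 2 * deriv h (u z) ^ 2 * ζ z.1 ^ 2 * (χ z.2 ^ 2 * θ z.2))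
      (volume.restrict (U ×ˢ Ioo 0 T)) :=
    hs.integrable_mul_mul_mul hs.integrable_norm_Du_sq ((hsm.continuous_deriv (by simp)).pow 2)
      (hc.smooth_space.continuous.pow 2) ((hc.smooth_time.continuous.pow 2).mul hθs.continuous)
  have hle : (∫ z in U ×ˢ Ioo 0 T,
        ‖Du z‖ ^ 2 * deriv h (u z) ^ 2 * ζ z.1 ^ 2 * (χ z.2 ^ 2 * θ z.2))
      ≤ 2 / lam * energyBound B ψ lam M u h x₀ t₀ ρ' D := by
    have : lam / 2 * (∫ z in U ×ˢ Ioo 0 T,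
        ‖Du z‖ ^ 2 * deriv h (u z) ^ 2 * ζ z.1 ^ 2 * (χ z.2 ^ 2 * θ z.2))
      ≤ energyBound B ψ lam M u h x₀ t₀ ρ' D := by linarith
    calc _ = 2 / lam * (lam / 2 * (∫ z in U ×ˢ Ioo 0 T,
        ‖Du z‖ ^ 2 * deriv h (u z) ^ 2 * ζ z.1 ^ 2 * (χ z.2 ^ 2 * θ z.2))) := by field_simp
      _ ≤ _ := by gcongr
  refine le_trans ?_ (ENNReal.ofReal_le_ofReal hle)
  rw [ofReal_integral_eq_lintegral_ofReal hint (Eventually.of_forall fun z => by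
    have := hθ0 z.2
    simp only [Pi.zero_apply]
    positivity)]
  calc _ = ∫⁻ z in U ×ˢ Ioo 0 (t₀ - 3 * ε n), ENNReal.ofReal
        (‖Du z‖ ^ 2 * deriv h (u z) ^ 2 * ζ z.1 ^ 2 * (χ z.2 ^ 2 * θ z.2)) := by
        refine setLIntegral_congr_fun (hmeas n) fun z hz => ?_
        rw [hθone z.2 (by have := hz.2.2; dsimp only; linarith), mul_one]
    _ ≤ _ := by
        refine lintegral_mono_set (Set.prod_mono le_rfl (Ioo_subset_Ioo_right ?_))
        linarith [hεpos n]

/-- Bound for the spatial `L²` norm of `h(u)` at almost every time `τ`. The energy inequality with a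
cut-off in time that steps down near `τ` bounds the mollifications of `t ↦ ∫ ψ h(u)² ζ² χ² dx`
at `τ`, and these converge at almost every `τ`. -/
theorem ae_lintegral_slice_le (hs : IsEnergySolution U T A B ψ lam M c₀ L u Du ut)
    (hsm : ContDiff ℝ ∞ h) (hpos : ∀ s, 0 ≤ h s) (hconv : ∀ s, 0 ≤ deriv (deriv h) s)
    (hc : IsParabolicCutoff x₀ t₀ ρ ρ' D ζ χ)
    (hU : cube x₀ ρ' ⊆ U) (h0 : 0 < t₀ - ρ' ^ 2) (hT : t₀ < T) :
    ∀ᵐ τ ∂(volume.restrict (Ioo 0 t₀)),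
      ∫⁻ x in U, ENNReal.ofReal (h (u (x, τ)) ^ 2 * ζ x ^ 2 * χ τ ^ 2)
        ≤ ENNReal.ofReal (2 / c₀ * energyBound B ψ lam M u h x₀ t₀ ρ' D) := by
  have hlam := hs.lam_pos
  have hc₀ := hs.c₀_pos
  set f : SpaceTime d → ℝ := fun z => ψ z.1 * h (u z) ^ 2 * ζ z.1 ^ 2 * χ z.2 ^ 2 with hf
  have hfint : Integrable f (volume.restrict (U ×ˢ Ioo 0 T)) :=
    hs.integrable_mul_mul_mul (integrable_comp_fst (T := T) hs.integrable_ψ)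
      (hsm.continuous.pow 2) (hc.smooth_space.continuous.pow 2) (hc.smooth_time.continuous.pow 2)
  rw [restrict_prod] at hfint
  set g : ℝ → ℝ := (Ioo 0 T).indicator (fun t => ∫ x in U, f (x, t)) with hg
  have hgint : Integrable g := (integrable_indicator_iff measurableSet_Ioo).2
    hfint.integral_prod_right
  let φ : ℕ → ContDiffBump (0 : ℝ) := fun n =>
    ⟨1 / ((n : ℝ) + 1) / 2, 1 / ((n : ℝ) + 1), by positivity, half_lt_self (by positivity)⟩
  have hφ : Tendsto (fun n => (φ n).rOut) atTop (𝓝 0) := tendsto_one_div_add_atTop_nhds_zero_nat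
  have hφ2 : ∀ᶠ n in atTop, (φ n).rOut ≤ 2 * (φ n).rIn :=
    Eventually.of_forall fun n => by simp only [φ]; linarith
  have hlim := ContDiffBump.ae_convolution_tendsto_right_of_locallyIntegrable
    (μ := (volume : Measure ℝ)) hφ hφ2 hgint.locallyIntegrable
  have hslice := hfint.prod_left_ae
  rw [ae_restrict_iff' measurableSet_Ioo] at hslice
  filter_upwards [ae_restrict_of_ae hlim, ae_restrict_of_ae hslice,
    ae_restrict_mem measurableSet_Ioo] with τ hτ hτi hτm
  have hτT : τ ∈ Ioo 0 T := ⟨hτm.1, hτm.2.trans hT⟩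
  have hgle : g τ ≤ 2 * energyBound B ψ lam M u h x₀ t₀ ρ' D := by
    refine le_of_tendsto hτ ?_
    filter_upwards [hφ.eventually_lt_const (show 0 < t₀ - τ by linarith [hτm.2])] with n hn
    obtain ⟨θ, hθs, hθd, hθ0, hθ1, hθz, -⟩ := exists_time_step (φ n) τ
    have e := hs.energy_le hsm hpos hconv hc hU h0 hT hθs hθ0 hθ1
      (t₁ := τ + (φ n).rOut) (by linarith) hθz
    have hpos1 : 0 ≤ ∫ z in U ×ˢ Ioo 0 T,
        ‖Du z‖ ^ 2 * deriv h (u z) ^ 2 * ζ z.1 ^ 2 * (χ z.2 ^ 2 * θ z.2) := by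
      refine integral_nonneg fun z => ?_
      have := hθ0 z.2
      simp only [Pi.zero_apply]
      positivity
    have heq : ∫ z in U ×ˢ Ioo 0 T, ψ z.1 * h (u z) ^ 2 * ζ z.1 ^ 2 * (χ z.2 ^ 2 * -deriv θ z.2)
        = mollify (φ n) g τ := by
      have hNb : Integrable (fun z : SpaceTime d => f z * (φ n).normed volume (τ - z.2))
          ((volume.restrict U).prod (volume.restrict (Ioo 0 T))) := by
        rw [← restrict_prod]
        have := hs.integrable_mul_mul_mul (integrable_comp_fst (T := T) hs.integrable_ψ)
          (hsm.continuous.pow 2) (hc.smooth_space.continuous.pow 2)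
          ((hc.smooth_time.continuous.pow 2).mul
            ((φ n).continuous_normed.comp (continuous_const.sub continuous_id) :
              Continuous fun t => (φ n).normed volume (τ - t)))
        refine this.congr (Eventually.of_forall fun z => ?_)
        simp only [hf, Pi.pow_apply, Pi.mul_apply, Function.comp_apply]
        ring
      calc _ = ∫ z, f z * (φ n).normed volume (τ - z.2)
            ∂((volume.restrict U).prod (volume.restrict (Ioo 0 T))) := by
            rw [restrict_prod]
            refine integral_congr_ae (Eventually.of_forall fun z => ?_)
            simp only [hf, hθd]
            ring
        _ = ∫ t in Ioo 0 T, ∫ x in U, f (x, t) * (φ n).normed volume (τ - t) :=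
            integral_prod_symm _ hNb
        _ = ∫ t in Ioo 0 T, (φ n).normed volume (τ - t) * ∫ x in U, f (x, t) := by
            refine setIntegral_congr_fun measurableSet_Ioo fun t _ => ?_
            rw [integral_mul_const, mul_comm]
        _ = mollify (φ n) g τ := by
            rw [mollify_apply_swap, ← integral_indicator measurableSet_Ioo]
            congr 1
            ext t
            by_cases ht : t ∈ Ioo 0 T
            · simp [hg, ht]
            · simp [hg, ht]
    rw [heq] at e
    have hm : mollify (φ n) g τ ≤ 2 * energyBound B ψ lam M u h x₀ t₀ ρ' D := by
      have : 0 ≤ lam / 2 * ∫ z in U ×ˢ Ioo 0 T,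
        ‖Du z‖ ^ 2 * deriv h (u z) ^ 2 * ζ z.1 ^ 2 * (χ z.2 ^ 2 * θ z.2) := by positivity
      linarith
    exact hm
  rw [hg, indicator_of_mem hτT] at hgle
  have hτi' := hτi hτT
  have h1 : ENNReal.ofReal (∫ x in U, f (x, τ)) = ∫⁻ x in U, ENNReal.ofReal (f (x, τ)) := by
    refine ofReal_integral_eq_lintegral_ofReal hτi' ?_
    filter_upwards [hs.le_ψ] with x hx
    have : 0 ≤ ψ x := hc₀.le.trans hx
    simp only [Pi.zero_apply, hf]
    positivity
  have h2 : ENNReal.ofReal c₀ * ∫⁻ x in U, ENNReal.ofReal (h (u (x, τ)) ^ 2 * ζ x ^ 2 * χ τ ^ 2)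
      ≤ ENNReal.ofReal (2 * energyBound B ψ lam M u h x₀ t₀ ρ' D) := by
    refine le_trans ?_ (h1.symm.le.trans (ENNReal.ofReal_le_ofReal hgle))
    rw [← lintegral_const_mul' _ _ ENNReal.ofReal_ne_top]
    refine lintegral_mono_ae ?_
    filter_upwards [hs.le_ψ] with x hx
    rw [← ENNReal.ofReal_mul hc₀.le]
    refine ENNReal.ofReal_le_ofReal ?_
    simp only [hf]
    calc c₀ * (h (u (x, τ)) ^ 2 * ζ x ^ 2 * χ τ ^ 2)
        ≤ ψ x * (h (u (x, τ)) ^ 2 * ζ x ^ 2 * χ τ ^ 2) := by gcongr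
      _ = _ := by ring
  calc _ = ENNReal.ofReal (1 / c₀) * (ENNReal.ofReal c₀ *
        ∫⁻ x in U, ENNReal.ofReal (h (u (x, τ)) ^ 2 * ζ x ^ 2 * χ τ ^ 2)) := by
        rw [← mul_assoc, ← ENNReal.ofReal_mul (by positivity), one_div_mul_cancel hc₀.ne',
          ENNReal.ofReal_one, one_mul]
    _ ≤ ENNReal.ofReal (1 / c₀) * ENNReal.ofReal (2 * energyBound B ψ lam M u h x₀ t₀ ρ' D) := by
        gcongr
    _ = _ := by
        rw [← ENNReal.ofReal_mul (by positivity)]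
        congr 1
        ring

end IsEnergySolution

/-! ### Sobolev inequality and interpolation -/

theorem eLpNorm_two_sq {α E : Type*} [MeasurableSpace α] [NormedAddCommGroup E] (f : α → E)
    (μ : Measure α) : eLpNorm f 2 μ ^ 2 = ∫⁻ z, ‖f z‖ₑ ^ 2 ∂μ := by
  rw [eLpNorm_eq_lintegral_rpow_enorm_toReal (by norm_num) (by norm_num), ← ENNReal.rpow_natCast,
    ← ENNReal.rpow_mul]
  simp

theorem enorm_sq_eq_ofReal {a : ℝ} : ‖a‖ₑ ^ 2 = ENNReal.ofReal (a ^ 2) := by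
  rw [Real.enorm_eq_ofReal_abs, ← ENNReal.ofReal_pow (abs_nonneg a), sq_abs]

theorem eLpNorm_le_mul_measure_rpow_of_support_subset {α : Type*} [MeasurableSpace α]
    {μ : Measure α} {f : α → ℝ} {S : Set α} {s : ℝ≥0} (hs2 : s ≤ 2)
    (hf : AEStronglyMeasurable f μ) (hS : Function.support f ⊆ S) :
    eLpNorm f s μ ≤ eLpNorm f 2 μ * μ S ^ (1 / (s : ℝ) - 1 / 2) := by
  rw [← eLpNorm_restrict_eq_of_support_subset hS (p := (s : ℝ≥0∞)),
    ← eLpNorm_restrict_eq_of_support_subset hS (p := 2)]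
  refine (eLpNorm_le_eLpNorm_mul_rpow_measure_univ (p := s) (q := 2)
    (by exact_mod_cast hs2) hf.restrict).trans (le_of_eq ?_)
  rw [Measure.restrict_apply_univ]
  simp

theorem volume_cube_eq {d : ℕ} (x₀ : Space d) (R : ℝ) :
    volume (cube x₀ R) = volume (cube (0 : Space d) R) := by
  have : (fun x => x + -x₀) ⁻¹' cube (0 : Space d) R = cube x₀ R := by
    ext x; simp [cube, sub_eq_add_neg]
  rw [← this, measure_preimage_add_right]

/-- The Sobolev inequality for functions supported in a cube, with the `L²` norm of the gradient on
the right. The constant depends on the cube only through its size. -/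
theorem exists_sobolev_const {d : ℕ} (hd : 0 < d) {s b : ℝ≥0} (hs : 1 ≤ s) (hs2 : s ≤ 2)
    (hb : (b : ℝ)⁻¹ = (s : ℝ)⁻¹ - (d : ℝ)⁻¹) (R : ℝ) :
    ∃ C : ℝ≥0, ∀ (x₀ : Space d) (w : Space d → ℝ), ContDiff ℝ 1 w → HasCompactSupport w →
      tsupport w ⊆ cube x₀ R → eLpNorm w b volume ≤ C * eLpNorm (fderiv ℝ w) 2 volume := by
  have hfin : volume (cube (0 : Space d) R) < ⊤ := (isBounded_cube 0 R).measure_lt_top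
  have hs0 : (0 : ℝ) < s := lt_of_lt_of_le one_pos (by exact_mod_cast hs)
  have he : 0 ≤ 1 / (s : ℝ) - 1 / 2 := by
    have : (s : ℝ) ≤ 2 := by exact_mod_cast hs2
    have := one_div_le_one_div_of_le hs0 this
    linarith
  set V : ℝ≥0∞ := volume (cube (0 : Space d) R) ^ (1 / (s : ℝ) - 1 / 2) with hV
  have hVtop : V ≠ ⊤ := ENNReal.rpow_ne_top_of_nonneg he hfin.ne
  refine ⟨SNormLESNormFDerivOfEqConst ℝ (volume : Measure (Space d)) s * V.toNNReal,
    fun x₀ w hw hwc hws => ?_⟩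
  have h1 := eLpNorm_le_eLpNorm_fderiv_of_eq (volume : Measure (Space d)) hw hwc hs
    (by simpa using hd) (p' := b) (by simpa using hb)
  have hsupp : Function.support (fun x => ‖fderiv ℝ w x‖) ⊆ cube x₀ R := fun x hx =>
    hws (tsupport_fderiv_subset ℝ (subset_tsupport _ fun h0 => hx (by simp [h0])))
  have h2 : eLpNorm (fderiv ℝ w) s volume ≤ eLpNorm (fderiv ℝ w) 2 volume * V := by
    have h3 := eLpNorm_le_mul_measure_rpow_of_support_subset (μ := volume) hs2
      (hw.continuous_fderiv one_ne_zero).norm.aestronglyMeasurable hsupp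
    rw [volume_cube_eq] at h3
    have e1 : eLpNorm (fun x => ‖fderiv ℝ w x‖) (s : ℝ≥0∞) volume
        = eLpNorm (fderiv ℝ w) s volume := eLpNorm_norm _
    have e2 : eLpNorm (fun x => ‖fderiv ℝ w x‖) 2 volume = eLpNorm (fderiv ℝ w) 2 volume :=
      eLpNorm_norm _
    rw [e1, e2] at h3
    exact h3
  calc eLpNorm w b volume ≤ _ := h1
    _ ≤ SNormLESNormFDerivOfEqConst ℝ (volume : Measure (Space d)) s
        * (eLpNorm (fderiv ℝ w) 2 volume * V) := by gcongr
    _ = _ := by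
      rw [ENNReal.coe_mul, ENNReal.coe_toNNReal hVtop]
      ring

theorem norm_le_sum_abs_single {d : ℕ} (ℓ : Space d →L[ℝ] ℝ) :
    ‖ℓ‖ ≤ ∑ i, |ℓ (EuclideanSpace.single i 1)| := by
  refine ℓ.opNorm_le_bound (Finset.sum_nonneg fun i _ => abs_nonneg _) fun x => ?_
  have hx : x = ∑ i, x i • EuclideanSpace.single i (1 : ℝ) := by
    have := (EuclideanSpace.basisFun (Fin d) ℝ).sum_repr x
    simpa using this.symm
  conv_lhs => rw [hx]
  rw [map_sum, Finset.sum_mul]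
  refine (norm_sum_le _ _).trans (Finset.sum_le_sum fun i _ => ?_)
  rw [map_smul, norm_smul, mul_comm, Real.norm_eq_abs (ℓ _)]
  exact mul_le_mul_of_nonneg_left (PiLp.norm_apply_le x i) (abs_nonneg _)

theorem norm_sq_le_sum_single {d : ℕ} (ℓ : Space d →L[ℝ] ℝ) :
    ‖ℓ‖ ^ 2 ≤ d * ∑ i, ℓ (EuclideanSpace.single i 1) ^ 2 := by
  calc ‖ℓ‖ ^ 2 ≤ (∑ i, |ℓ (EuclideanSpace.single i 1)|) ^ 2 := by
        gcongr; exact norm_le_sum_abs_single ℓ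
    _ ≤ (Finset.univ : Finset (Fin d)).card * ∑ i, |ℓ (EuclideanSpace.single i 1)| ^ 2 :=
        sq_sum_le_card_mul_sum_sq
    _ = _ := by simp

/-- Interpolation between `L²` and `L^b`. The condition on `σ` makes the exponents match: then
`a (σ - 1) / 2 + a / b = 1`, so Hölder's inequality applies. -/
theorem lintegral_rpow_interpolation {α : Type*} [MeasurableSpace α] {μ : Measure α}
    {V : α → ℝ≥0∞} (hV : AEMeasurable V μ) {a b σ : ℝ} (ha : 0 < a) (hb : 0 < b) (hσ : 1 ≤ σ)
    (h : (σ - 1) / 2 = 1 / a - 1 / b) :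
    (∫⁻ x, V x ^ (a * σ) ∂μ) ^ (2 / a)
      ≤ (∫⁻ x, V x ^ (2 : ℝ) ∂μ) ^ (σ - 1) * (∫⁻ x, V x ^ b ∂μ) ^ (2 / b) := by
  have hσ' : 0 ≤ σ - 1 := by linarith
  have h1 := ENNReal.lintegral_mul_norm_pow_le (μ := μ) (hV.pow_const (2 : ℝ)) (hV.pow_const b)
    (p := a * (σ - 1) / 2) (q := a / b) (by positivity) (by positivity) (by
      have : a * ((σ - 1) / 2) = a * (1 / a - 1 / b) := by rw [h]
      rw [mul_sub, mul_one_div_cancel ha.ne'] at this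
      linarith [mul_one_div a b])
  have h2 : ∀ x, (V x ^ (2 : ℝ)) ^ (a * (σ - 1) / 2) * (V x ^ b) ^ (a / b) = V x ^ (a * σ) := by
    intro x
    rw [← ENNReal.rpow_mul, ← ENNReal.rpow_mul, ← ENNReal.rpow_add_of_nonneg _ _ (by positivity)
      (by positivity)]
    congr 1
    field_simp
    ring
  simp_rw [h2] at h1
  refine (ENNReal.rpow_le_rpow h1 (by positivity : 0 ≤ 2 / a)).trans (le_of_eq ?_)
  rw [ENNReal.mul_rpow_of_nonneg _ _ (by positivity), ← ENNReal.rpow_mul, ← ENNReal.rpow_mul]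
  congr 2 <;> field_simp

theorem ae_time_slice {d : ℕ} {P : SpaceTime d → Prop} (h : ∀ᵐ z, P z) :
    ∀ᵐ t : ℝ, ∀ᵐ x : Space d, P (x, t) := by
  have h1 : ∀ᵐ z ∂((volume : Measure ℝ).prod (volume : Measure (Space d))), P z.swap :=
    (Measure.measurePreserving_swap (μ := (volume : Measure ℝ))
      (ν := (volume : Measure (Space d)))).quasiMeasurePreserving.ae h
  exact Measure.ae_ae_of_ae_prod h1

/-! ### The Sobolev inequality for the solution -/

theorem measurable_eLpNorm_slice {d : ℕ} {f : SpaceTime d → ℝ} (hf : Measurable f) {p : ℝ≥0∞}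
    (hp : p ≠ 0) (hp' : p ≠ ⊤) (μ : Measure (Space d)) [SFinite μ] :
    Measurable fun t : ℝ => eLpNorm (fun x => f (x, t)) p μ := by
  simp_rw [eLpNorm_eq_lintegral_rpow_enorm_toReal hp hp']
  exact (Measurable.lintegral_prod_left' (hf.enorm.pow_const _)).pow_const _

theorem ofReal_eq_enorm_sq_add {d : ℕ} {a : Fin d → ℝ} {e c : ℝ} (hc : 0 ≤ c) :
    ENNReal.ofReal (c * ∑ i, a i ^ 2 + 2 * e ^ 2)
      = ENNReal.ofReal c * ∑ i, ‖a i‖ₑ ^ 2 + 2 * ‖e‖ₑ ^ 2 := by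
  rw [ENNReal.ofReal_add (mul_nonneg hc (Finset.sum_nonneg fun i _ => sq_nonneg _)) (by positivity),
    ENNReal.ofReal_mul hc, ENNReal.ofReal_sum_of_nonneg fun i _ => sq_nonneg _,
    ENNReal.ofReal_mul zero_le_two]
  simp [enorm_sq_eq_ofReal]

namespace IsEnergySolution

variable {d : ℕ} {U : Set (Space d)} {T : ℝ} {A : Space d → Matrix (Fin d) (Fin d) ℝ}
  {B : Space d → Space d} {ψ : Space d → ℝ} {lam M c₀ L : ℝ} {u : SpaceTime d → ℝ}
  {Du : SpaceTime d → Space d} {ut : SpaceTime d → ℝ}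
  {x₀ : Space d} {t₀ ρ ρ' D : ℝ} {ζ : Space d → ℝ} {χ : ℝ → ℝ} {h : ℝ → ℝ}

/-- The Sobolev inequality at each time for the smooth function `ζ χ h(v)`, integrated in time. -/
theorem _root_.IsParabolicCutoff.lintegral_sobolev_smooth_le
    (hc : IsParabolicCutoff x₀ t₀ ρ ρ' D ζ χ) (hsm : ContDiff ℝ ∞ h) {v : SpaceTime d → ℝ}
    (hv : ContDiff ℝ ∞ v) {b CS : ℝ≥0}
    (hCS : ∀ w : Space d → ℝ, ContDiff ℝ 1 w → HasCompactSupport w → tsupport w ⊆ cube x₀ ρ' →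
      eLpNorm w b volume ≤ CS * eLpNorm (fderiv ℝ w) 2 volume) :
    ∫⁻ t in timeInterval t₀ ρ', eLpNorm (fun x => ζ x * χ t * h (v (x, t))) b volume ^ 2
      ≤ CS ^ 2 * (ENNReal.ofReal (2 * d) * ∑ i, eLpNorm (fun z =>
          χ z.2 * ζ z.1 * deriv h (v z) * fderiv ℝ v z (spaceDir i)) 2
            (volume.restrict (tsupport ζ ×ˢ timeInterval t₀ ρ')) ^ 2
        + 2 * eLpNorm (fun z => h (v z) * (χ z.2 * ‖fderiv ℝ ζ z.1‖)) 2
            (volume.restrict (tsupport ζ ×ˢ timeInterval t₀ ρ')) ^ 2) := by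
  have hζc := hc.smooth_space.continuous
  have hχc := hc.smooth_time.continuous
  have hh'c : Continuous (deriv h) := hsm.continuous_deriv (by simp)
  set a : Fin d → SpaceTime d → ℝ := fun i z =>
    χ z.2 * ζ z.1 * deriv h (v z) * fderiv ℝ v z (spaceDir i) with ha
  set e : SpaceTime d → ℝ := fun z => h (v z) * (χ z.2 * ‖fderiv ℝ ζ z.1‖) with he
  have hac : ∀ i, Continuous (a i) := fun i =>
    (((hχc.comp continuous_snd).mul (hζc.comp continuous_fst)).mul
      (hh'c.comp hv.continuous)).mul ((hv.continuous_fderiv_apply (by simp)).comp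
        (continuous_id.prodMk continuous_const))
  have hec : Continuous e := (hsm.continuous.comp hv.continuous).mul ((hχc.comp continuous_snd).mul
    ((hc.smooth_space.continuous_fderiv (by simp)).norm.comp continuous_fst))
  -- the gradient of `ζ χ h(v)` at a fixed time
  have hgrad : ∀ t x, ‖fderiv ℝ (fun x => ζ x * χ t * h (v (x, t))) x‖ₑ ^ 2
      ≤ (tsupport ζ).indicator (fun x => ENNReal.ofReal (2 * d) * ∑ i, ‖a i (x, t)‖ₑ ^ 2
        + 2 * ‖e (x, t)‖ₑ ^ 2) x := by
    intro t x
    have h1 : HasFDerivAt ζ (fderiv ℝ ζ x) x :=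
      (hc.smooth_space.differentiable (by simp) x).hasFDerivAt
    have h2 : HasFDerivAt (fun x : Space d => ((x, t) : SpaceTime d))
        (ContinuousLinearMap.inl ℝ (Space d) ℝ) x := hasFDerivAt_prodMk_left x t
    have h3 : HasFDerivAt v (fderiv ℝ v (x, t)) (x, t) :=
      (hv.differentiable (by simp) _).hasFDerivAt
    have h4 : HasDerivAt h (deriv h (v (x, t))) (v (x, t)) :=
      (hsm.differentiable (by simp) _).hasDerivAt
    have h5 : HasFDerivAt (fun x : Space d => v (x, t)) _ x := h3.comp x h2
    have h6 : HasFDerivAt (fun x : Space d => h (v (x, t))) _ x := h4.comp_hasFDerivAt x h5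
    have h7 : HasFDerivAt (fun x => ζ x * χ t * h (v (x, t))) _ x := (h1.mul_const (χ t)).mul h6
    rw [h7.fderiv]
    by_cases hx : x ∈ tsupport ζ
    · rw [indicator_of_mem hx, ← ofReal_eq_enorm_sq_add (by positivity), ← ofReal_norm,
        ← ENNReal.ofReal_pow (norm_nonneg _)]
      refine ENNReal.ofReal_le_ofReal ?_
      set ℓ := (fderiv ℝ v (x, t)).comp (ContinuousLinearMap.inl ℝ (Space d) ℝ) with hℓ
      have hℓi : ∀ i, ℓ (EuclideanSpace.single i 1) = fderiv ℝ v (x, t) (spaceDir i) := fun i => by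
        simp [hℓ, spaceDir]
      set k := ζ x * χ t * deriv h (v (x, t)) with hk
      have hn : ‖(ζ x * χ t) • deriv h (v (x, t)) • ℓ + h (v (x, t)) • χ t • fderiv ℝ ζ x‖
          ≤ |k| * ‖ℓ‖ + |e (x, t)| := by
        refine (norm_add_le _ _).trans (add_le_add (le_of_eq ?_) (le_of_eq ?_))
        · rw [smul_smul, norm_smul, Real.norm_eq_abs]
        · rw [smul_smul, norm_smul, Real.norm_eq_abs, he]
          simp only [abs_mul, abs_norm]
          ring
      calc _ ≤ (|k| * ‖ℓ‖ + |e (x, t)|) ^ 2 := by gcongr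
        _ ≤ 2 * ((|k| * ‖ℓ‖) ^ 2 + |e (x, t)| ^ 2) := add_sq_le
        _ = 2 * (k ^ 2 * ‖ℓ‖ ^ 2) + 2 * e (x, t) ^ 2 := by rw [mul_pow, sq_abs, sq_abs]; ring
        _ ≤ 2 * (k ^ 2 * (d * ∑ i, ℓ (EuclideanSpace.single i 1) ^ 2)) + 2 * e (x, t) ^ 2 := by
          gcongr; exact norm_sq_le_sum_single ℓ
        _ = _ := by
          congr 1
          rw [Finset.mul_sum, Finset.mul_sum, Finset.mul_sum, Finset.mul_sum]
          refine Finset.sum_congr rfl fun i _ => ?_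
          rw [hℓi, ha, hk]
          ring
    · have hz : ζ x = 0 := image_eq_zero_of_notMem_tsupport hx
      have hz' : fderiv ℝ ζ x = 0 :=
        image_eq_zero_of_notMem_tsupport fun h => hx (tsupport_fderiv_subset ℝ h)
      rw [indicator_of_notMem hx, hz, hz', ← ofReal_norm]
      simp
  have hslice : ∀ t, eLpNorm (fun x => ζ x * χ t * h (v (x, t))) b volume ^ 2
      ≤ CS ^ 2 * ∫⁻ x in tsupport ζ, (ENNReal.ofReal (2 * d) * ∑ i, ‖a i (x, t)‖ₑ ^ 2
        + 2 * ‖e (x, t)‖ₑ ^ 2) := by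
    intro t
    have hsub : tsupport (fun x => ζ x * χ t * h (v (x, t))) ⊆ tsupport ζ := by
      refine closure_mono fun x hx => ?_
      rw [Function.mem_support] at hx ⊢
      exact fun h0 => hx (by simp [h0])
    have hw1 : ContDiff ℝ 1 fun x => ζ x * χ t * h (v (x, t)) :=
      ((hc.smooth_space.mul contDiff_const).mul
        (hsm.comp (hv.comp (contDiff_id.prodMk contDiff_const)))).of_le (by simp)
    have hw := hCS _ hw1 (hc.isCompact_tsupport.of_isClosed_subset (isClosed_tsupport _) hsub)
      (hsub.trans hc.tsupport_space)
    calc _ ≤ (CS * eLpNorm (fderiv ℝ (fun x => ζ x * χ t * h (v (x, t)))) 2 volume) ^ 2 := by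
          gcongr
      _ = CS ^ 2 * ∫⁻ x, ‖fderiv ℝ (fun x => ζ x * χ t * h (v (x, t))) x‖ₑ ^ 2 := by
          rw [mul_pow, eLpNorm_two_sq]
      _ ≤ _ := by
          rw [← lintegral_indicator (isClosed_tsupport ζ).measurableSet]
          gcongr with x
          exact hgrad t x
  have ham : ∀ i, Measurable fun z => ‖a i z‖ₑ ^ 2 := fun i => (hac i).measurable.enorm.pow_const 2
  have hem : Measurable fun z => ‖e z‖ₑ ^ 2 := hec.measurable.enorm.pow_const 2
  have hsm' : Measurable fun z => ∑ i, ‖a i z‖ₑ ^ 2 := Finset.measurable_fun_sum _ fun i _ => ham i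
  have hPhi : Measurable fun z : SpaceTime d => ENNReal.ofReal (2 * d) * ∑ i, ‖a i z‖ₑ ^ 2
        + 2 * ‖e z‖ₑ ^ 2 := (hsm'.const_mul _).add (hem.const_mul _)
  calc _ ≤ ∫⁻ t in timeInterval t₀ ρ', CS ^ 2 * ∫⁻ x in tsupport ζ,
        (ENNReal.ofReal (2 * d) * ∑ i, ‖a i (x, t)‖ₑ ^ 2 + 2 * ‖e (x, t)‖ₑ ^ 2) :=
        lintegral_mono fun t => hslice t
    _ = CS ^ 2 * ∫⁻ z in tsupport ζ ×ˢ timeInterval t₀ ρ',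
        (ENNReal.ofReal (2 * d) * ∑ i, ‖a i z‖ₑ ^ 2 + 2 * ‖e z‖ₑ ^ 2) := by
        rw [lintegral_const_mul' _ _ (by finiteness), Measure.volume_eq_prod,
          ← Measure.prod_restrict, lintegral_prod_symm _ hPhi.aemeasurable]
    _ = _ := by
        rw [lintegral_add_left (hsm'.const_mul _), lintegral_const_mul _ hsm',
          lintegral_const_mul _ hem, lintegral_finsetSum _ fun i _ => ham i]
        simp_rw [eLpNorm_two_sq]
        rfl

theorem ofReal_energyBound (hs : IsEnergySolution U T A B ψ lam M c₀ L u Du ut)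
    (hsm : ContDiff ℝ ∞ h) (hU : cube x₀ ρ' ⊆ U) (h0 : 0 < t₀ - ρ' ^ 2) (hT : t₀ < T) :
    ENNReal.ofReal (energyBound B ψ lam M u h x₀ t₀ ρ' D) =
      ENNReal.ofReal ((4 * (M * d ^ 2) ^ 2 / lam + 1 / lam + 1) * D ^ 2) *
        ∫⁻ z in paraCylinder x₀ t₀ ρ',
          ENNReal.ofReal ((ψ z.1 + 1 + ‖B z.1‖ ^ 2) * h (u z) ^ 2) := by
  have hlam := hs.lam_pos
  have hQ := paraCylinder_subset hU h0 hT
  have i5 : Integrable (fun z : SpaceTime d => (ψ z.1 + 1 + ‖B z.1‖ ^ 2) * h (u z) ^ 2)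
      (volume.restrict (U ×ˢ Ioo 0 T)) := by
    have := hs.integrable_mul_mul_mul (integrable_comp_fst (T := T) hs.integrable_weight)
      (hsm.continuous.pow 2) (ζ := fun _ => 1) continuous_const (m := fun _ => 1) continuous_const
    simpa using this
  rw [energyBound, ENNReal.ofReal_mul (by positivity), ofReal_integral_eq_lintegral_ofReal
    (i5.mono_measure (Measure.restrict_mono hQ le_rfl))]
  refine ae_mono (Measure.restrict_mono hQ le_rfl) ?_
  filter_upwards [ae_comp_fst hs.le_ψ] with z hz
  have : 0 ≤ ψ z.1 := hs.c₀_pos.le.trans hz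
  simp only [Pi.zero_apply]
  positivity

theorem energyBound_nonneg (hs : IsEnergySolution U T A B ψ lam M c₀ L u Du ut)
    (hU : cube x₀ ρ' ⊆ U) (h0 : 0 < t₀ - ρ' ^ 2) (hT : t₀ < T) :
    0 ≤ energyBound B ψ lam M u h x₀ t₀ ρ' D := by
  have hlam := hs.lam_pos
  refine mul_nonneg (by positivity) (integral_nonneg_of_ae ?_)
  refine ae_mono (Measure.restrict_mono (paraCylinder_subset hU h0 hT) le_rfl) ?_
  filter_upwards [ae_comp_fst hs.le_ψ] with z hz
  have : 0 ≤ ψ z.1 := hs.c₀_pos.le.trans hz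
  simp only [Pi.zero_apply]
  positivity

/-- The Sobolev inequality for `ζ χ h(u)`, integrated in time, with the energy bound for the
gradient. It follows from the smooth case by approximation: the gradients converge strongly in
`L²`, and the left-hand side is lower semicontinuous by Fatou's lemma. -/
theorem lintegral_sobolev_le (hs : IsEnergySolution U T A B ψ lam M c₀ L u Du ut)
    (hsm : ContDiff ℝ ∞ h) (hpos : ∀ s, 0 ≤ h s) (hconv : ∀ s, 0 ≤ deriv (deriv h) s)
    (hc : IsParabolicCutoff x₀ t₀ ρ ρ' D ζ χ)
    (hU : cube x₀ ρ' ⊆ U) (h0 : 0 < t₀ - ρ' ^ 2) (hT : t₀ < T) {b CS : ℝ≥0} (hb : b ≠ 0)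
    (hCS : ∀ w : Space d → ℝ, ContDiff ℝ 1 w → HasCompactSupport w → tsupport w ⊆ cube x₀ ρ' →
      eLpNorm w b volume ≤ CS * eLpNorm (fderiv ℝ w) 2 volume) :
    ∫⁻ t in timeInterval t₀ ρ', eLpNorm (fun x => ζ x * χ t * h (u (x, t))) b volume ^ 2
      ≤ CS ^ 2 * ENNReal.ofReal ((4 * d ^ 2 / lam + 2) * energyBound B ψ lam M u h x₀ t₀ ρ' D) := by
  have hlam := hs.lam_pos
  have hζc := hc.smooth_space.continuous
  have hχc := hc.smooth_time.continuous
  have hh'c : Continuous (deriv h) := hsm.continuous_deriv (by simp)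
  have hkc : Continuous fun z : SpaceTime d => χ z.2 * ‖fderiv ℝ ζ z.1‖ :=
    (hχc.comp continuous_snd).mul
      ((hc.smooth_space.continuous_fderiv (by simp)).norm.comp continuous_fst)
  set K : Set (SpaceTime d) := tsupport ζ ×ˢ Icc (t₀ - ρ' ^ 2) t₀ with hKdef
  have hK : IsCompact K := hc.isCompact_tsupport.prod isCompact_Icc
  have hKΩ : K ⊆ U ×ˢ Ioo 0 T := Set.prod_mono (hc.tsupport_space.trans hU)
    fun t ht => ⟨h0.trans_le ht.1, ht.2.trans_lt hT⟩
  obtain ⟨un, hun⟩ := exists_isSmoothApprox hs.isOpen_prod hK hKΩ hs.measurable_u hs.bound_u hs.grad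
    hs.memLp_ut hs.isWeakDeriv_ut
  set S : Set (SpaceTime d) := tsupport ζ ×ˢ timeInterval t₀ ρ' with hSdef
  have hSm : MeasurableSet S := (isClosed_tsupport ζ).measurableSet.prod measurableSet_Ioo
  have hSK : S ⊆ K := Set.prod_mono le_rfl Ioo_subset_Icc_self
  have hSΩ : S ⊆ U ×ˢ Ioo 0 T := hSK.trans hKΩ
  set μ : Measure (SpaceTime d) := volume.restrict S with hμ
  have hμK : μ ≤ volume.restrict K := Measure.restrict_mono hSK le_rfl
  have : IsFiniteMeasure μ := ⟨by
    rw [hμ, Measure.restrict_apply_univ]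
    exact (measure_mono hSK).trans_lt hK.measure_lt_top⟩
  have hund : ∀ n v, Continuous fun z => fderiv ℝ (un n) z v := fun n v =>
    ((hun.smooth n).continuous_fderiv_apply (by simp)).comp
      (continuous_id.prodMk continuous_const)
  have hae : ∀ᵐ z ∂μ, Tendsto (fun n => un n z) atTop (𝓝 (u z)) := ae_mono hμK hun.tendsto_ae
  obtain ⟨C₁, hC₁⟩ := hh'c.exists_forall_abs_le L
  obtain ⟨C₀, hC₀⟩ := hsm.continuous.exists_forall_abs_le L
  -- strong convergence of the two parts of the gradient
  set g : Fin d → SpaceTime d → ℝ := fun i z =>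
    χ z.2 * ζ z.1 * deriv h (u z) * Du z i with hgdef
  set e : SpaceTime d → ℝ := fun z => h (u z) * (χ z.2 * ‖fderiv ℝ ζ z.1‖) with hedef
  have hDuμ : ∀ i, MemLp (fun z => Du z i) 2 μ := fun i =>
    (hs.memLp_Du i).mono_measure (Measure.restrict_mono hSΩ le_rfl)
  have hkmem : MemLp (fun z : SpaceTime d => χ z.2 * ‖fderiv ℝ ζ z.1‖) 2 μ := by
    obtain ⟨C, hC⟩ := hK.exists_bound_of_continuousOn hkc.continuousOn
    refine MemLp.of_bound hkc.aestronglyMeasurable C ?_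
    filter_upwards [ae_restrict_mem hSm] with z hz using hC z (hSK hz)
  have lim1 : ∀ i, Tendsto (fun n => eLpNorm (fun z =>
      χ z.2 * ζ z.1 * deriv h (un n z) * fderiv ℝ (un n) z (spaceDir i) - g i z) 2 μ)
      atTop (𝓝 0) := by
    intro i
    refine tendsto_eLpNorm_mul_of_bounded (C := C₁) (hDuμ i)
      (fun n => (hund n _).aestronglyMeasurable) ?_ (fun n => ?_) (fun n z => ?_) ?_
    · exact tendsto_of_tendsto_of_tendsto_of_le_of_le tendsto_const_nhds (hun.tendsto_space i)
        (fun _ => zero_le) fun n => eLpNorm_mono_measure _ hμK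
    · exact (((hχc.comp continuous_snd).mul (hζc.comp continuous_fst)).mul
        (hh'c.comp (hun.smooth n).continuous)).aestronglyMeasurable
    · rw [abs_mul, abs_mul, abs_of_nonneg (hc.time_nonneg _), abs_of_nonneg (hc.space_nonneg _)]
      calc χ z.2 * ζ z.1 * |deriv h (un n z)| ≤ 1 * 1 * |deriv h (un n z)| := by
            have := hc.time_nonneg z.2
            have := hc.time_le_one z.2
            have := hc.space_nonneg z.1
            have := hc.space_le_one z.1
            gcongr
        _ ≤ C₁ := by
            rw [one_mul, one_mul]
            exact hC₁ _ (hun.bound n z)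
    · filter_upwards [hae] with z hz
      exact ((hh'c.tendsto _).comp hz).const_mul _
  have lim0 : Tendsto (fun n => eLpNorm (fun z =>
      h (un n z) * (χ z.2 * ‖fderiv ℝ ζ z.1‖) - e z) 2 μ) atTop (𝓝 0) := by
    refine tendsto_eLpNorm_mul_of_bounded (C := C₀) hkmem
      (fun n => hkc.aestronglyMeasurable) (by simp) (fun n => ?_) (fun n z => ?_) ?_
    · exact (hsm.continuous.comp (hun.smooth n).continuous).aestronglyMeasurable
    · exact hC₀ _ (hun.bound n z)
    · filter_upwards [hae] with z hz using (hsm.continuous.tendsto _).comp hz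
  have hgm : ∀ i, AEStronglyMeasurable (g i) μ := fun i =>
    (((hχc.comp continuous_snd).mul (hζc.comp continuous_fst)).aestronglyMeasurable.mul
      (hs.aestronglyMeasurable_comp hh'c)).mul (hDuμ i).1
  have hem : AEStronglyMeasurable e μ :=
    (hs.aestronglyMeasurable_comp hsm.continuous).mul hkc.aestronglyMeasurable
  have up1 : ∀ i n, eLpNorm (fun z =>
      χ z.2 * ζ z.1 * deriv h (un n z) * fderiv ℝ (un n) z (spaceDir i)) 2 μ
      ≤ eLpNorm (g i) 2 μ + eLpNorm (fun z => χ z.2 * ζ z.1 * deriv h (un n z)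
        * fderiv ℝ (un n) z (spaceDir i) - g i z) 2 μ := by
    intro i n
    have hm : AEStronglyMeasurable (fun z : SpaceTime d => χ z.2 * ζ z.1 * deriv h (un n z)
        * fderiv ℝ (un n) z (spaceDir i)) μ :=
      ((((hχc.comp continuous_snd).mul (hζc.comp continuous_fst)).mul
        (hh'c.comp (hun.smooth n).continuous)).mul (hund n _)).aestronglyMeasurable
    refine le_trans (le_of_eq ?_) (eLpNorm_add_le (hgm i) (hm.sub (hgm i)) (by norm_num))
    congr 1
    ext z
    simp
  have up0 : ∀ n, eLpNorm (fun z => h (un n z) * (χ z.2 * ‖fderiv ℝ ζ z.1‖)) 2 μ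
      ≤ eLpNorm e 2 μ + eLpNorm (fun z =>
        h (un n z) * (χ z.2 * ‖fderiv ℝ ζ z.1‖) - e z) 2 μ := by
    intro n
    have hm : AEStronglyMeasurable (fun z => h (un n z) * (χ z.2 * ‖fderiv ℝ ζ z.1‖)) μ :=
      ((hsm.continuous.comp (hun.smooth n).continuous).mul hkc).aestronglyMeasurable
    refine le_trans (le_of_eq ?_) (eLpNorm_add_le hem (hm.sub hem) (by norm_num))
    congr 1
    ext z
    simp
  -- the limit of the right-hand sides
  have hRlim : Tendsto (fun n => (CS : ℝ≥0∞) ^ 2 * (ENNReal.ofReal (2 * d) *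
      ∑ i, (eLpNorm (g i) 2 μ + eLpNorm (fun z => χ z.2 * ζ z.1 * deriv h (un n z)
        * fderiv ℝ (un n) z (spaceDir i) - g i z) 2 μ) ^ 2
      + 2 * (eLpNorm e 2 μ + eLpNorm (fun z =>
        h (un n z) * (χ z.2 * ‖fderiv ℝ ζ z.1‖) - e z) 2 μ) ^ 2)) atTop
      (𝓝 ((CS : ℝ≥0∞) ^ 2 * (ENNReal.ofReal (2 * d) * ∑ i, eLpNorm (g i) 2 μ ^ 2
        + 2 * eLpNorm e 2 μ ^ 2))) := by
    refine ENNReal.Tendsto.const_mul (Tendsto.add (ENNReal.Tendsto.const_mul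
      (tendsto_finsetSum _ fun i _ => ?_) (Or.inr ENNReal.ofReal_ne_top))
      (ENNReal.Tendsto.const_mul ?_ (Or.inr (by norm_num)))) (Or.inr (by finiteness))
    · have := ENNReal.Tendsto.pow (n := 2) ((lim1 i).const_add (eLpNorm (g i) 2 μ))
      rwa [add_zero] at this
    · have := ENNReal.Tendsto.pow (n := 2) (lim0.const_add (eLpNorm e 2 μ))
      rwa [add_zero] at this
  -- Fatou
  have hVm : ∀ n, Measurable fun t : ℝ =>
      eLpNorm (fun x => ζ x * χ t * h (un n (x, t))) b volume ^ 2 := fun n => by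
    have hcont : Continuous fun z : SpaceTime d => ζ z.1 * χ z.2 * h (un n z) :=
      ((hζc.comp continuous_fst).mul (hχc.comp continuous_snd)).mul
        (hsm.continuous.comp (hun.smooth n).continuous)
    exact (measurable_eLpNorm_slice hcont.measurable (by exact_mod_cast hb) ENNReal.coe_ne_top
      volume).pow_const 2
  have hfatou : ∀ᵐ t ∂(volume.restrict (timeInterval t₀ ρ')),
      eLpNorm (fun x => ζ x * χ t * h (u (x, t))) b volume ^ 2
        ≤ liminf (fun n => eLpNorm (fun x => ζ x * χ t * h (un n (x, t))) b volume ^ 2) atTop := by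
    have h1 := hun.tendsto_ae
    rw [ae_restrict_iff' hK.measurableSet] at h1
    filter_upwards [ae_restrict_of_ae (ae_time_slice h1), ae_restrict_mem measurableSet_Ioo]
      with t ht htI
    have hlim : ∀ᵐ x : Space d, Tendsto (fun n => ζ x * χ t * h (un n (x, t))) atTop
        (𝓝 (ζ x * χ t * h (u (x, t)))) := by
      filter_upwards [ht] with x hx
      by_cases hxζ : x ∈ tsupport ζ
      · exact ((hsm.continuous.tendsto _).comp (hx ⟨hxζ, Ioo_subset_Icc_self htI⟩)).const_mul _
      · simp [image_eq_zero_of_notMem_tsupport hxζ]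
    have hle := Lp.eLpNorm_lim_le_liminf_eLpNorm (p := b) (f := fun n x =>
      ζ x * χ t * h (un n (x, t))) (fun n => by
        have : Continuous fun x : Space d => ζ x * χ t * h (un n (x, t)) :=
          (hζc.mul continuous_const).mul (hsm.continuous.comp ((hun.smooth n).continuous.comp
            (continuous_id.prodMk continuous_const)))
        exact this.aestronglyMeasurable) _ hlim
    have hpow := (ENNReal.orderIsoRpow 2 (by norm_num)).liminf_apply (f := atTop)
      (u := fun n => eLpNorm (fun x => ζ x * χ t * h (un n (x, t))) b volume)
      (by isBoundedDefault) (by isBoundedDefault) (by isBoundedDefault) (by isBoundedDefault)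
    simp only [ENNReal.orderIsoRpow_apply, ENNReal.rpow_ofNat] at hpow
    rw [← hpow]
    gcongr
  -- the limiting right-hand side is controlled by the energy bounds
  set 𝓔 := energyBound B ψ lam M u h x₀ t₀ ρ' D with h𝓔
  have hg2 : ∀ i, eLpNorm (g i) 2 μ ^ 2 ≤ ENNReal.ofReal (2 / lam * 𝓔) := by
    intro i
    refine le_trans ?_ (hs.lintegral_gradient_le hsm hpos hconv hc hU h0 hT)
    rw [eLpNorm_two_sq]
    refine (lintegral_mono fun z => ?_).trans (lintegral_mono_set
      (Set.prod_mono (hc.tsupport_space.trans hU) fun t ht => ⟨h0.trans ht.1, ht.2⟩))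
    rw [enorm_sq_eq_ofReal]
    refine ENNReal.ofReal_le_ofReal ?_
    rw [hgdef]
    calc (χ z.2 * ζ z.1 * deriv h (u z) * Du z i) ^ 2
        = |Du z i| ^ 2 * deriv h (u z) ^ 2 * ζ z.1 ^ 2 * χ z.2 ^ 2 := by rw [sq_abs]; ring
      _ ≤ _ := by
        have := abs_apply_le_norm (Du z) i
        gcongr
  have he2 : eLpNorm e 2 μ ^ 2 ≤ ENNReal.ofReal 𝓔 := by
    rw [eLpNorm_two_sq, h𝓔, hs.ofReal_energyBound hsm hU h0 hT,
      ← lintegral_const_mul' _ _ ENNReal.ofReal_ne_top]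
    refine le_trans ?_ (lintegral_mono_set (Set.prod_mono hc.tsupport_space le_rfl))
    refine lintegral_mono_ae ?_
    filter_upwards [ae_mono (Measure.restrict_mono hSΩ le_rfl) (ae_comp_fst hs.le_ψ)] with z hz
    have hψ0 : 0 ≤ ψ z.1 := hs.c₀_pos.le.trans hz
    rw [enorm_sq_eq_ofReal, ← ENNReal.ofReal_mul (by positivity)]
    refine ENNReal.ofReal_le_ofReal ?_
    rw [hedef]
    have hχ0 := hc.time_nonneg z.2
    have hχ1 := hc.time_le_one z.2
    have hN := hc.norm_fderiv_le z.1
    have hC : 1 ≤ 4 * (M * d ^ 2) ^ 2 / lam + 1 / lam + 1 := by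
      have : 0 ≤ 4 * (M * d ^ 2) ^ 2 / lam + 1 / lam := by positivity
      linarith
    have hw : 1 ≤ ψ z.1 + 1 + ‖B z.1‖ ^ 2 := by
      have : 0 ≤ ‖B z.1‖ ^ 2 := by positivity
      linarith
    calc (h (u z) * (χ z.2 * ‖fderiv ℝ ζ z.1‖)) ^ 2
        = 1 * (χ z.2 * ‖fderiv ℝ ζ z.1‖) ^ 2 * (1 * h (u z) ^ 2) := by ring
      _ ≤ (4 * (M * d ^ 2) ^ 2 / lam + 1 / lam + 1) * (1 * D) ^ 2
          * ((ψ z.1 + 1 + ‖B z.1‖ ^ 2) * h (u z) ^ 2) := by gcongr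
      _ = _ := by ring
  calc _ ≤ ∫⁻ t in timeInterval t₀ ρ',
        liminf (fun n => eLpNorm (fun x => ζ x * χ t * h (un n (x, t))) b volume ^ 2) atTop :=
        lintegral_mono_ae hfatou
    _ ≤ liminf (fun n => ∫⁻ t in timeInterval t₀ ρ',
        eLpNorm (fun x => ζ x * χ t * h (un n (x, t))) b volume ^ 2) atTop :=
        lintegral_liminf_le hVm
    _ ≤ (CS : ℝ≥0∞) ^ 2 * (ENNReal.ofReal (2 * d) * ∑ i, eLpNorm (g i) 2 μ ^ 2
        + 2 * eLpNorm e 2 μ ^ 2) := by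
        rw [← hRlim.liminf_eq]
        refine liminf_le_liminf (Eventually.of_forall fun n => ?_)
        refine (hc.lintegral_sobolev_smooth_le hsm (hun.smooth n) hCS).trans ?_
        have := up0 n
        have := fun i => up1 i n
        gcongr
        · rename_i i _
          exact up1 i n
    _ ≤ (CS : ℝ≥0∞) ^ 2 * (ENNReal.ofReal (2 * d) * ∑ _i : Fin d, ENNReal.ofReal (2 / lam * 𝓔)
        + 2 * ENNReal.ofReal 𝓔) := by
        gcongr with i
        exact hg2 i
    _ = _ := by
        have h𝓔0 : 0 ≤ 𝓔 := hs.energyBound_nonneg hU h0 hT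
        congr 1
        rw [Finset.sum_const, Finset.card_univ, Fintype.card_fin, nsmul_eq_mul,
          ← ENNReal.ofReal_natCast, ← ENNReal.ofReal_mul (by positivity),
          ← ENNReal.ofReal_mul (by positivity),
          show (2 : ℝ≥0∞) = ENNReal.ofReal 2 by simp, ← ENNReal.ofReal_mul (by positivity),
          ← ENNReal.ofReal_add (by positivity) (by positivity)]
        congr 1
        ring

end IsEnergySolution

/-! ### One step of the iteration -/

/-- The square of the mixed `L^{a,2}` norm of `|v|^k` on the parabolic cylinder, for `v ≥ 0`. -/
def mixedPower {d : ℕ} (v : SpaceTime d → ℝ) (a k : ℝ) (x₀ : Space d) (t₀ ρ : ℝ) : ℝ≥0∞ :=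
  ∫⁻ t in timeInterval t₀ ρ, (∫⁻ x in cube x₀ ρ, ENNReal.ofReal (v (x, t)) ^ (a * k)) ^ (2 / a)

namespace IsEnergySolution

variable {d : ℕ} {U : Set (Space d)} {T : ℝ} {A : Space d → Matrix (Fin d) (Fin d) ℝ}
  {B : Space d → Space d} {ψ : Space d → ℝ} {lam M c₀ L : ℝ} {u : SpaceTime d → ℝ}
  {Du : SpaceTime d → Space d} {ut : SpaceTime d → ℝ}
  {x₀ : Space d} {t₀ ρ ρ' D : ℝ} {ζ : Space d → ℝ} {χ : ℝ → ℝ} {h : ℝ → ℝ}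

/-- Hölder's inequality for the energy bound: the weight is taken in `L^{p/2}`, which leaves the
`L^{a,2}` norm of `h(u)` with `2/p + 2/a = 1`. -/
theorem ofReal_energyBound_le (hs : IsEnergySolution U T A B ψ lam M c₀ L u Du ut)
    (hsm : ContDiff ℝ ∞ h) (hpos : ∀ s, 0 ≤ h s)
    (hU : cube x₀ ρ' ⊆ U) (h0 : 0 < t₀ - ρ' ^ 2) (hT : t₀ < T)
    {p a : ℝ} (hp : 0 < p) (ha : 0 < a) (hpa : 2 / p + 2 / a = 1) {R : ℝ} (hR : ρ' ≤ R)
    {N : ℝ≥0∞}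
    (hN : (∫⁻ x in cube x₀ R, ENNReal.ofReal (ψ x + 1 + ‖B x‖ ^ 2) ^ (p / 2)) ^ (2 / p) ≤ N) :
    ENNReal.ofReal (energyBound B ψ lam M u h x₀ t₀ ρ' D) ≤
      ENNReal.ofReal ((4 * (M * d ^ 2) ^ 2 / lam + 1 / lam + 1) * D ^ 2) *
        (N * mixedPower (fun z => h (u z)) a 1 x₀ t₀ ρ') := by
  rw [hs.ofReal_energyBound hsm hU h0 hT]
  gcongr
  have hwm : AEMeasurable (fun x => ENNReal.ofReal (ψ x + 1 + ‖B x‖ ^ 2))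
      (volume.restrict (cube x₀ ρ')) :=
    (hs.integrable_weight.mono_measure
      (Measure.restrict_mono hU le_rfl)).1.aemeasurable.ennreal_ofReal
  have hhm : Measurable fun z => ENNReal.ofReal (h (u z)) :=
    (hsm.continuous.measurable.comp hs.measurable_u).ennreal_ofReal
  have hslice : ∀ t, ∫⁻ x in cube x₀ ρ', ENNReal.ofReal ((ψ x + 1 + ‖B x‖ ^ 2) * h (u (x, t)) ^ 2)
      ≤ N * (∫⁻ x in cube x₀ ρ', ENNReal.ofReal (h (u (x, t))) ^ (a * 1)) ^ (2 / a) := by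
    intro t
    have hhmt : Measurable fun x => ENNReal.ofReal (h (u (x, t))) :=
      hhm.comp measurable_prodMk_right
    have h1 := ENNReal.lintegral_mul_norm_pow_le (μ := volume.restrict (cube x₀ ρ'))
      (hwm.pow_const (p / 2)) (hhmt.pow_const a).aemeasurable (p := 2 / p) (q := 2 / a)
      (by positivity) (by positivity) hpa
    refine le_trans (le_of_eq (lintegral_congr fun x => ?_)) (h1.trans ?_)
    · rw [← ENNReal.rpow_mul, ← ENNReal.rpow_mul, show p / 2 * (2 / p) = 1 by field_simp,
        show a * (2 / a) = 2 by field_simp, ENNReal.rpow_one, mul_comm (_ + _ : ℝ),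
        ENNReal.ofReal_mul (sq_nonneg _), ENNReal.ofReal_pow (hpos _), mul_comm]
      norm_num
    · rw [mul_one]
      gcongr
      refine le_trans ?_ hN
      gcongr
      exact cube_subset_cube x₀ hR
  have hm : AEMeasurable (fun z : SpaceTime d =>
      ENNReal.ofReal ((ψ z.1 + 1 + ‖B z.1‖ ^ 2) * h (u z) ^ 2))
      ((volume.restrict (cube x₀ ρ')).prod (volume.restrict (timeInterval t₀ ρ'))) := by
    refine AEMeasurable.ennreal_ofReal (AEMeasurable.mul ?_
      ((hsm.continuous.measurable.comp hs.measurable_u).pow_const 2).aemeasurable)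
    exact (hs.integrable_weight.mono_measure
      (Measure.restrict_mono hU le_rfl)).1.aemeasurable.comp_fst
  calc _ = ∫⁻ t in timeInterval t₀ ρ', ∫⁻ x in cube x₀ ρ',
        ENNReal.ofReal ((ψ x + 1 + ‖B x‖ ^ 2) * h (u (x, t)) ^ 2) := by
        rw [paraCylinder, Measure.volume_eq_prod, ← Measure.prod_restrict,
          lintegral_prod_symm _ hm]
    _ ≤ ∫⁻ t in timeInterval t₀ ρ',
        N * (∫⁻ x in cube x₀ ρ', ENNReal.ofReal (h (u (x, t))) ^ (a * 1)) ^ (2 / a) :=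
        lintegral_mono fun t => hslice t
    _ = _ := by
        rw [lintegral_const_mul _ ((((hhm.pow_const _).lintegral_prod_left').pow_const _)),
          mixedPower]

/-- One step of the Moser iteration: from the exponents `(a, 2)` on the larger cylinder to
`(aσ, 2σ)` on the smaller one. -/
theorem mixedPower_step (hs : IsEnergySolution U T A B ψ lam M c₀ L u Du ut)
    (hsm : ContDiff ℝ ∞ h) (hpos : ∀ s, 0 ≤ h s) (hconv : ∀ s, 0 ≤ deriv (deriv h) s)
    (hc : IsParabolicCutoff x₀ t₀ ρ ρ' D ζ χ) (hρ0 : 0 ≤ ρ) (hρ : ρ ≤ ρ')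
    (hU : cube x₀ ρ' ⊆ U) (h0 : 0 < t₀ - ρ' ^ 2) (hT : t₀ < T)
    {p a σ : ℝ} (hp : 0 < p) (ha : 0 < a) (hpa : 2 / p + 2 / a = 1) (hσ : 1 ≤ σ)
    {b CS : ℝ≥0} (hb : 0 < b) (hab : (σ - 1) / 2 = 1 / a - 1 / b) {R : ℝ} (hR : ρ' ≤ R)
    {N : ℝ≥0∞}
    (hN : (∫⁻ x in cube x₀ R, ENNReal.ofReal (ψ x + 1 + ‖B x‖ ^ 2) ^ (p / 2)) ^ (2 / p) ≤ N)
    (hCS : ∀ w : Space d → ℝ, ContDiff ℝ 1 w → HasCompactSupport w → tsupport w ⊆ cube x₀ R →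
      eLpNorm w b volume ≤ CS * eLpNorm (fderiv ℝ w) 2 volume) :
    mixedPower (fun z => h (u z)) a σ x₀ t₀ ρ ≤
      ((ENNReal.ofReal (2 / c₀) + CS ^ 2 * ENNReal.ofReal (4 * d ^ 2 / lam + 2))
        * ENNReal.ofReal (4 * (M * d ^ 2) ^ 2 / lam + 1 / lam + 1) * N
        * ENNReal.ofReal (D ^ 2) * mixedPower (fun z => h (u z)) a 1 x₀ t₀ ρ') ^ σ := by
  have hlam := hs.lam_pos
  have hc₀ := hs.c₀_pos
  have hσ1 : 0 ≤ σ - 1 := by linarith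
  have hbne : (b : ℝ≥0∞) ≠ 0 := by exact_mod_cast hb.ne'
  have hb' : (0 : ℝ) < b := by exact_mod_cast hb
  set 𝓔 := energyBound B ψ lam M u h x₀ t₀ ρ' D with h𝓔
  set α := ENNReal.ofReal (2 / c₀) with hα
  set β := (CS : ℝ≥0∞) ^ 2 * ENNReal.ofReal (4 * d ^ 2 / lam + 2) with hβ
  have hJ : timeInterval t₀ ρ ⊆ timeInterval t₀ ρ' :=
    Ioo_subset_Ioo_left (by have := pow_le_pow_left₀ hρ0 hρ 2; linarith)
  have hJ0 : timeInterval t₀ ρ' ⊆ Ioo 0 t₀ := Ioo_subset_Ioo_left h0.le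
  have hhm : Measurable fun z => h (u z) := hsm.continuous.measurable.comp hs.measurable_u
  have hsob := hs.lintegral_sobolev_le hsm hpos hconv hc hU h0 hT hb.ne' fun w hw hwc hws =>
    hCS w hw hwc (hws.trans (cube_subset_cube x₀ hR))
  have hsup := hs.ae_lintegral_slice_le hsm hpos hconv hc hU h0 hT
  have hpt : ∀ᵐ t ∂(volume.restrict (timeInterval t₀ ρ)),
      (∫⁻ x in cube x₀ ρ, ENNReal.ofReal (h (u (x, t))) ^ (a * σ)) ^ (2 / a)
        ≤ (α * ENNReal.ofReal 𝓔) ^ (σ - 1)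
          * eLpNorm (fun x => ζ x * χ t * h (u (x, t))) b volume ^ 2 := by
    filter_upwards [ae_mono (Measure.restrict_mono (hJ.trans hJ0) le_rfl) hsup,
      ae_restrict_mem measurableSet_Ioo] with t ht htJ
    have hχ : χ t = 1 := hc.time_eq_one t htJ.1.le
    set V : Space d → ℝ≥0∞ := fun x => ENNReal.ofReal (ζ x * χ t * h (u (x, t))) with hV
    have hVm : Measurable V := ((hc.smooth_space.continuous.measurable.mul_const _).mul
      (hhm.comp measurable_prodMk_right)).ennreal_ofReal
    have e1 : ∫⁻ x in cube x₀ ρ, ENNReal.ofReal (h (u (x, t))) ^ (a * σ)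
        ≤ ∫⁻ x, V x ^ (a * σ) := by
      refine le_trans (le_of_eq ?_) (setLIntegral_le_lintegral (cube x₀ ρ) _)
      refine setLIntegral_congr_fun (isOpen_cube x₀ ρ).measurableSet fun x hx => ?_
      simp only [hV, hχ, hc.space_eq_one x hx, one_mul]
    have e2 : ∫⁻ x, V x ^ (2 : ℝ) ≤ α * ENNReal.ofReal 𝓔 := by
      rw [hα, ← ENNReal.ofReal_mul (by positivity)]
      refine le_trans (le_of_eq ?_) ht
      rw [← lintegral_indicator hs.isOpen.measurableSet]
      refine lintegral_congr fun x => ?_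
      have hnn : 0 ≤ ζ x * χ t * h (u (x, t)) := by
        have := hc.space_nonneg x
        have := hpos (u (x, t))
        rw [hχ]; positivity
      by_cases hx : x ∈ U
      · rw [indicator_of_mem hx, ENNReal.rpow_ofNat, ← ENNReal.ofReal_pow hnn]
        congr 1
        ring
      · rw [indicator_of_notMem hx]
        simp [hV, hc.space_eq_zero fun h => hx (hU h)]
    have e3 : (∫⁻ x, V x ^ (b : ℝ)) ^ (2 / (b : ℝ))
        = eLpNorm (fun x => ζ x * χ t * h (u (x, t))) b volume ^ 2 := by
      rw [eLpNorm_eq_lintegral_rpow_enorm_toReal hbne ENNReal.coe_ne_top, ← ENNReal.rpow_natCast,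
        ← ENNReal.rpow_mul, ENNReal.coe_toReal]
      congr 1
      · refine lintegral_congr fun x => ?_
        rw [Real.enorm_of_nonneg]
        have := hc.space_nonneg x
        have := hpos (u (x, t))
        rw [hχ]; positivity
      · push_cast; ring
    calc _ ≤ (∫⁻ x, V x ^ (a * σ)) ^ (2 / a) := by gcongr
      _ ≤ (∫⁻ x, V x ^ (2 : ℝ)) ^ (σ - 1) * (∫⁻ x, V x ^ (b : ℝ)) ^ (2 / (b : ℝ)) :=
        lintegral_rpow_interpolation hVm.aemeasurable ha hb' hσ hab
      _ ≤ _ := by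
        rw [e3]
        gcongr
  have hY : ENNReal.ofReal 𝓔 ≤ ENNReal.ofReal (4 * (M * d ^ 2) ^ 2 / lam + 1 / lam + 1) * N
      * ENNReal.ofReal (D ^ 2) * mixedPower (fun z => h (u z)) a 1 x₀ t₀ ρ' := by
    refine (hs.ofReal_energyBound_le hsm hpos hU h0 hT hp ha hpa hR hN).trans (le_of_eq ?_)
    rw [ENNReal.ofReal_mul (by positivity)]
    ring
  have hXm : Measurable fun t => eLpNorm (fun x => ζ x * χ t * h (u (x, t))) b volume ^ 2 :=
    (measurable_eLpNorm_slice (((hc.smooth_space.continuous.comp continuous_fst).mul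
      (hc.smooth_time.continuous.comp continuous_snd)).measurable.mul hhm) hbne
      ENNReal.coe_ne_top volume).pow_const 2
  calc mixedPower (fun z => h (u z)) a σ x₀ t₀ ρ
      ≤ ∫⁻ t in timeInterval t₀ ρ, (α * ENNReal.ofReal 𝓔) ^ (σ - 1)
          * eLpNorm (fun x => ζ x * χ t * h (u (x, t))) b volume ^ 2 := lintegral_mono_ae hpt
    _ = (α * ENNReal.ofReal 𝓔) ^ (σ - 1) * ∫⁻ t in timeInterval t₀ ρ,
          eLpNorm (fun x => ζ x * χ t * h (u (x, t))) b volume ^ 2 := lintegral_const_mul _ hXm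
    _ ≤ (α * ENNReal.ofReal 𝓔) ^ (σ - 1) * (β * ENNReal.ofReal 𝓔) := by
        gcongr
        refine (lintegral_mono_set hJ).trans (hsob.trans (le_of_eq ?_))
        rw [ENNReal.ofReal_mul (by positivity), ← mul_assoc]
    _ ≤ ((α + β) * ENNReal.ofReal 𝓔) ^ (σ - 1) * ((α + β) * ENNReal.ofReal 𝓔) := by
        gcongr
        · exact le_self_add
        · exact le_add_self
    _ = ((α + β) * ENNReal.ofReal 𝓔) ^ σ := by
        conv_lhs => rw [← ENNReal.rpow_one ((α + β) * ENNReal.ofReal 𝓔), ← ENNReal.rpow_mul,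
          one_mul, ← ENNReal.rpow_add_of_nonneg _ _ hσ1 zero_le_one]
        congr 1
        ring
    _ ≤ _ := by
        refine ENNReal.rpow_le_rpow ?_ (by linarith)
        calc _ ≤ (α + β) * _ := mul_le_mul_right hY _
          _ = _ := by ring

end IsEnergySolution

/-! ### Existence of cut-offs -/

/-- The derivative of the standard smooth transition function is bounded. -/
theorem exists_abs_deriv_smoothTransition_le :
    ∃ c : ℝ, ∀ s, |deriv Real.smoothTransition s| ≤ c := by
  have hcont : Continuous (deriv Real.smoothTransition) :=
    (Real.smoothTransition.contDiff (n := 1)).continuous_deriv le_rfl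
  obtain ⟨c, hc⟩ := (isCompact_Icc (a := (0 : ℝ)) (b := 1)).exists_bound_of_continuousOn
    hcont.continuousOn
  refine ⟨max c 0, fun s => ?_⟩
  rcases lt_or_ge s 0 with hs | hs
  · have : Real.smoothTransition =ᶠ[𝓝 s] fun _ => (0 : ℝ) := by
      filter_upwards [eventually_lt_nhds hs] with x hx
      exact Real.smoothTransition.zero_of_nonpos hx.le
    simp [this.deriv_eq]
  rcases lt_or_ge 1 s with hs' | hs'
  · have : Real.smoothTransition =ᶠ[𝓝 s] fun _ => (1 : ℝ) := by
      filter_upwards [eventually_gt_nhds hs'] with x hx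
      exact Real.smoothTransition.one_of_one_le hx.le
    simp [this.deriv_eq]
  · exact (hc s ⟨hs, hs'⟩).trans (le_max_left _ _)

/-- A smooth bump on the line: `1` on `[-α, α]`, `0` outside `(-β, β)`. -/
def lineBump (α β s : ℝ) : ℝ :=
  Real.smoothTransition ((β - s) / (β - α)) * Real.smoothTransition ((β + s) / (β - α))

theorem contDiff_lineBump (α β : ℝ) : ContDiff ℝ ∞ (lineBump α β) :=
  (Real.smoothTransition.contDiff.comp ((contDiff_const.sub contDiff_id).div_const _)).mul
    (Real.smoothTransition.contDiff.comp ((contDiff_const.add contDiff_id).div_const _))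

theorem lineBump_nonneg (α β s : ℝ) : 0 ≤ lineBump α β s :=
  mul_nonneg (Real.smoothTransition.nonneg _) (Real.smoothTransition.nonneg _)

theorem lineBump_le_one (α β s : ℝ) : lineBump α β s ≤ 1 :=
  mul_le_one₀ (Real.smoothTransition.le_one _) (Real.smoothTransition.nonneg _)
    (Real.smoothTransition.le_one _)

theorem lineBump_eq_one {α β s : ℝ} (h : α < β) (hs : |s| ≤ α) : lineBump α β s = 1 := by
  have := abs_le.1 hs
  rw [lineBump, Real.smoothTransition.one_of_one_le, Real.smoothTransition.one_of_one_le, one_mul]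
  all_goals rw [le_div_iff₀ (by linarith)]; linarith

theorem lineBump_eq_zero {α β s : ℝ} (h : α < β) (hs : β ≤ |s|) : lineBump α β s = 0 := by
  rcases le_abs'.1 hs with h1 | h1
  · rw [lineBump, Real.smoothTransition.zero_of_nonpos (x := (β + s) / _), mul_zero]
    exact div_nonpos_of_nonpos_of_nonneg (by linarith) (by linarith)
  · rw [lineBump, Real.smoothTransition.zero_of_nonpos (x := (β - s) / _), zero_mul]
    exact div_nonpos_of_nonpos_of_nonneg (by linarith) (by linarith)

theorem abs_deriv_lineBump_le {α β c : ℝ} (h : α < β)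
    (hc : ∀ s, |deriv Real.smoothTransition s| ≤ c) (s : ℝ) :
    |deriv (lineBump α β) s| ≤ 2 * c / (β - α) := by
  have hS : ∀ x, HasDerivAt Real.smoothTransition (deriv Real.smoothTransition x) x := fun x =>
    ((Real.smoothTransition.contDiff (n := 1)).differentiable one_ne_zero x).hasDerivAt
  have hδ : 0 < β - α := by linarith
  have h1 : HasDerivAt (fun s => (β - s) / (β - α)) (-1 / (β - α)) s :=
    ((hasDerivAt_id s).const_sub β).div_const _
  have h2 : HasDerivAt (fun s => (β + s) / (β - α)) (1 / (β - α)) s :=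
    ((hasDerivAt_id s).const_add β).div_const _
  have h3 := ((hS _).comp s h1).mul ((hS _).comp s h2)
  have h4 : deriv (lineBump α β) s = _ := h3.deriv
  have hone : ∀ x y, |deriv Real.smoothTransition x * y| ≤ c * |y| := fun x y => by
    rw [abs_mul]; exact mul_le_mul_of_nonneg_right (hc x) (abs_nonneg y)
  have hS1 : ∀ x, |Real.smoothTransition x| ≤ 1 := fun x =>
    (abs_of_nonneg (Real.smoothTransition.nonneg x)).trans_le (Real.smoothTransition.le_one x)
  have hc0 : 0 ≤ c := (abs_nonneg _).trans (hc 0)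
  rw [h4]
  refine (abs_add_le _ _).trans ?_
  have e1 := mul_le_mul (hone ((β - s) / (β - α)) (-1 / (β - α))) (hS1 ((β + s) / (β - α)))
    (abs_nonneg _) (mul_nonneg hc0 (abs_nonneg _))
  have e2 := mul_le_mul (hS1 ((β - s) / (β - α))) (hone ((β + s) / (β - α)) (1 / (β - α)))
    (abs_nonneg _) zero_le_one
  rw [← abs_mul] at e1 e2
  refine (add_le_add e1 e2).trans (le_of_eq ?_)
  rw [abs_div, abs_div, abs_neg, abs_one, abs_of_pos hδ]
  ring

/-- Parabolic cut-offs exist with derivatives controlled by the gap `ρ' - ρ`. The space cut-off is a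
product of bumps in the coordinates. -/
theorem exists_isParabolicCutoff (d : ℕ) : ∃ c : ℝ, 1 ≤ c ∧ ∀ (x₀ : Space d) (t₀ ρ ρ' : ℝ), 0 ≤ ρ →
    ρ < ρ' → ∃ ζ χ, IsParabolicCutoff x₀ t₀ ρ ρ' (1 + c / (ρ' - ρ)) ζ χ := by
  obtain ⟨c, hc⟩ := exists_abs_deriv_smoothTransition_le
  have hc0 : 0 ≤ c := (abs_nonneg _).trans (hc 0)
  refine ⟨8 * d * c + c + 1, by nlinarith [mul_nonneg (Nat.cast_nonneg (α := ℝ) d) hc0],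
    fun x₀ t₀ ρ ρ' hρ hlt => ?_⟩
  have hδ : 0 < ρ' - ρ := by linarith
  -- `β` is strictly below `ρ' / 2`, so that the closed support lies in the open cube of size `ρ'`
  set α := ρ / 2 with hα
  set β := (ρ + ρ') / 4 with hβ
  have hαβ : α < β := by rw [hα, hβ]; linarith
  have hdc : 0 ≤ d * c := mul_nonneg (Nat.cast_nonneg (α := ℝ) d) hc0
  set D := 1 + (8 * d * c + c + 1) / (ρ' - ρ) with hD
  have hD1 : 1 ≤ D := by
    rw [hD]
    have : 0 ≤ (8 * d * c + c + 1) / (ρ' - ρ) := div_nonneg (by linarith) hδ.le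
    linarith
  have hsq : 0 < ρ' ^ 2 - ρ ^ 2 := by nlinarith
  set g : Fin d → Space d → ℝ := fun i x => lineBump α β (x i - x₀ i) with hg
  have hgs : ∀ i, ContDiff ℝ ∞ (g i) := fun i => (contDiff_lineBump α β).comp
    ((EuclideanSpace.proj (𝕜 := ℝ) i).contDiff.sub contDiff_const)
  have hgd : ∀ i x, HasFDerivAt (g i)
      (deriv (lineBump α β) (x i - x₀ i) • (EuclideanSpace.proj (𝕜 := ℝ) i)) x := by
    intro i x
    have h1 : HasDerivAt (lineBump α β) (deriv (lineBump α β) (x i - x₀ i)) (x i - x₀ i) :=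
      ((contDiff_lineBump α β).differentiable (by simp) _).hasDerivAt
    exact h1.comp_hasFDerivAt x ((EuclideanSpace.proj (𝕜 := ℝ) i).hasFDerivAt.sub_const _)
  refine ⟨fun x => ∏ i, g i x,
    fun t => Real.smoothTransition ((t - (t₀ - ρ' ^ 2)) / (ρ' ^ 2 - ρ ^ 2)),
    hD1, contDiff_prod fun i _ => hgs i,
    fun x => Finset.prod_nonneg fun i _ => lineBump_nonneg _ _ _,
    fun x => Finset.prod_le_one (fun i _ => lineBump_nonneg _ _ _) fun i _ => lineBump_le_one _ _ _,
    fun x hx => Finset.prod_eq_one fun i _ => lineBump_eq_one hαβ (hx i).le, ?_, fun x => ?_,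
    Real.smoothTransition.contDiff.comp ((contDiff_id.sub contDiff_const).div_const _),
    fun t => Real.smoothTransition.nonneg _, fun t => Real.smoothTransition.le_one _,
    fun t ht => Real.smoothTransition.one_of_one_le ?_,
    fun t ht => Real.smoothTransition.zero_of_nonpos ?_, fun t => ?_⟩
  · have hcl : IsClosed {x : Space d | ∀ i, |x i - x₀ i| ≤ β} := by
      simp only [ofPred_forall]
      exact isClosed_iInter fun i => isClosed_le (by fun_prop) continuous_const
    refine (closure_minimal (fun x hx i => ?_) hcl).trans fun x hx i => (hx i).trans_lt ?_
    · by_contra h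
      exact hx (Finset.prod_eq_zero (Finset.mem_univ i) (lineBump_eq_zero hαβ (not_le.1 h).le))
    · rw [hβ]; linarith
  · have hf := HasFDerivAt.finsetProd (u := Finset.univ) fun i _ => hgd i x
    rw [hf.fderiv]
    have hK : ∀ i ∈ Finset.univ, ‖(∏ j ∈ Finset.univ.erase i, g j x) •
        deriv (lineBump α β) (x i - x₀ i) • (EuclideanSpace.proj (𝕜 := ℝ) i : Space d →L[ℝ] ℝ)‖
        ≤ 2 * c / (β - α) := by
      intro i _
      have hp : ‖(EuclideanSpace.proj (𝕜 := ℝ) i : Space d →L[ℝ] ℝ)‖ ≤ 1 :=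
        ContinuousLinearMap.opNorm_le_bound _ zero_le_one fun y => by
          simpa using PiLp.norm_apply_le y i
      have hp1 : ‖∏ j ∈ Finset.univ.erase i, g j x‖ ≤ 1 := by
        rw [Real.norm_of_nonneg (Finset.prod_nonneg fun j _ => lineBump_nonneg _ _ _)]
        exact Finset.prod_le_one (fun j _ => lineBump_nonneg _ _ _) fun j _ => lineBump_le_one _ _ _
      rw [norm_smul, norm_smul]
      have h1 := abs_deriv_lineBump_le hαβ hc (x i - x₀ i)
      calc _ ≤ 1 * ((2 * c / (β - α)) * 1) := by gcongr; exact h1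
        _ = _ := by ring
    refine (norm_sum_le_of_le _ hK).trans ?_
    rw [Finset.sum_const, Finset.card_univ, Fintype.card_fin, nsmul_eq_mul,
      show β - α = (ρ' - ρ) / 4 by rw [hα, hβ]; ring]
    calc (d : ℝ) * (2 * c / ((ρ' - ρ) / 4)) = (8 * d * c) / (ρ' - ρ) := by field_simp; ring
      _ ≤ (8 * d * c + c + 1) / (ρ' - ρ) := by gcongr; linarith
      _ ≤ D := by rw [hD]; linarith
  · rw [le_div_iff₀ hsq]; linarith
  · exact div_nonpos_of_nonpos_of_nonneg (by linarith) hsq.le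
  · have h1 : HasDerivAt (fun t => (t - (t₀ - ρ' ^ 2)) / (ρ' ^ 2 - ρ ^ 2))
        (1 / (ρ' ^ 2 - ρ ^ 2)) t :=
      ((hasDerivAt_id t).sub_const _).div_const _
    have h2 : HasDerivAt Real.smoothTransition (deriv Real.smoothTransition
        ((t - (t₀ - ρ' ^ 2)) / (ρ' ^ 2 - ρ ^ 2))) ((t - (t₀ - ρ' ^ 2)) / (ρ' ^ 2 - ρ ^ 2)) :=
      ((Real.smoothTransition.contDiff (n := 1)).differentiable one_ne_zero _).hasDerivAt
    have h3 := (h2.comp t h1).deriv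
    rw [Function.comp_def] at h3
    rw [h3, abs_mul, abs_of_pos (one_div_pos.2 hsq)]
    have hK1 : 1 ≤ 8 * d * c + c + 1 := by linarith
    calc _ ≤ c * (1 / (ρ' ^ 2 - ρ ^ 2)) := by gcongr; exact hc _
      _ ≤ c * (1 / (ρ' - ρ) ^ 2) := by
        gcongr
        nlinarith
      _ ≤ ((8 * d * c + c + 1) / (ρ' - ρ)) ^ 2 := by
        rw [div_pow, mul_one_div]
        gcongr
        nlinarith
      _ ≤ D ^ 2 := by
        have : 0 ≤ (8 * d * c + c + 1) / (ρ' - ρ) := div_nonneg (by linarith) hδ.le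
        rw [hD]
        gcongr
        linarith

/-! ### The weight -/

/-- The `L^{p/2}` norm of the weight `ψ + 1 + ‖B‖²` on a cube is controlled by the norms of `B` in
`L^p` and of `ψ` in `L^q`, because `q ≥ p / 2`. -/
theorem exists_weight_bound (d : ℕ) {p q : ℝ} (hp : 2 < p) (hq : p / 2 ≤ q) (R : ℝ)
    (NB Nψ : ℝ≥0) : ∃ N : ℝ≥0, ∀ (x₀ : Space d) (B : Space d → Space d) (ψ : Space d → ℝ),
      AEStronglyMeasurable B (volume.restrict (cube x₀ R)) →
      AEStronglyMeasurable ψ (volume.restrict (cube x₀ R)) →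
      eLpNorm B (ENNReal.ofReal p) (volume.restrict (cube x₀ R)) ≤ NB →
      eLpNorm ψ (ENNReal.ofReal q) (volume.restrict (cube x₀ R)) ≤ Nψ →
      (∫⁻ x in cube x₀ R, ENNReal.ofReal (ψ x + 1 + ‖B x‖ ^ 2) ^ (p / 2)) ^ (2 / p) ≤ N := by
  have hp2 : 1 ≤ ENNReal.ofReal (p / 2) := ENNReal.one_le_ofReal.2 (by linarith)
  have hp0 : ENNReal.ofReal (p / 2) ≠ 0 := (zero_lt_one.trans_le hp2).ne'
  have hp2r : (ENNReal.ofReal (p / 2)).toReal = p / 2 := ENNReal.toReal_ofReal (by linarith)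
  have hqr : (ENNReal.ofReal q).toReal = q := ENNReal.toReal_ofReal (by linarith)
  set v := volume (cube (0 : Space d) R) with hv
  have hvt : v ≠ ⊤ := (isBounded_cube (0 : Space d) R).measure_lt_top.ne
  have he : 0 ≤ 1 / (p / 2) - 1 / q :=
    sub_nonneg.2 (one_div_le_one_div_of_le (by linarith) hq)
  have hfin : (Nψ : ℝ≥0∞) * v ^ (1 / (p / 2) - 1 / q) + v ^ (1 / (p / 2))
      + (NB : ℝ≥0∞) ^ 2 ≠ ⊤ := by
    have h1 := ENNReal.rpow_ne_top_of_nonneg he hvt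
    have h2 := ENNReal.rpow_ne_top_of_nonneg (y := 1 / (p / 2)) (by positivity) hvt
    finiteness
  refine ⟨_, fun x₀ B ψ hBm hψm hB hψ => (?_ : _ ≤ ((Nψ * v ^ (1 / (p / 2) - 1 / q)
    + v ^ (1 / (p / 2)) + (NB : ℝ≥0∞) ^ 2).toNNReal : ℝ≥0∞))⟩
  rw [ENNReal.coe_toNNReal hfin]
  set μ := volume.restrict (cube x₀ R) with hμ
  have hμu : μ univ = v := by rw [hμ, Measure.restrict_apply_univ, volume_cube_eq]
  have hBm2 : AEStronglyMeasurable (fun x => ‖B x‖ ^ 2) μ := hBm.norm.pow 2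
  have hB2 : eLpNorm (fun x => ‖B x‖ ^ 2) (ENNReal.ofReal (p / 2)) μ ≤ (NB : ℝ≥0∞) ^ 2 := by
    have h := eLpNorm_norm_rpow (p := ENNReal.ofReal (p / 2)) (μ := μ) B (q := 2) two_pos
    rw [← ENNReal.ofReal_mul (by linarith), div_mul_cancel₀ _ (two_ne_zero)] at h
    simp only [Real.rpow_two, ENNReal.rpow_two] at h
    rw [h]
    gcongr
  have hψ2 : eLpNorm ψ (ENNReal.ofReal (p / 2)) μ ≤ (Nψ : ℝ≥0∞) * v ^ (1 / (p / 2) - 1 / q) := by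
    have h := eLpNorm_le_eLpNorm_mul_rpow_measure_univ (ENNReal.ofReal_le_ofReal hq) hψm
    rw [hp2r, hqr, hμu] at h
    exact h.trans (by gcongr)
  have h1 : eLpNorm (fun _ : Space d => (1 : ℝ)) (ENNReal.ofReal (p / 2)) μ
      ≤ v ^ (1 / (p / 2)) := by
    rw [eLpNorm_const' _ hp0 ENNReal.ofReal_ne_top, hμu, hp2r]
    simp
  calc _ ≤ (∫⁻ x, ‖ψ x + 1 + ‖B x‖ ^ 2‖ₑ ^ (p / 2) ∂μ) ^ (2 / p) := by
        gcongr with x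
        exact Real.ofReal_le_enorm _
    _ = eLpNorm (fun x => ψ x + 1 + ‖B x‖ ^ 2) (ENNReal.ofReal (p / 2)) μ := by
        rw [eLpNorm_eq_lintegral_rpow_enorm_toReal hp0 ENNReal.ofReal_ne_top, hp2r, one_div_div]
    _ ≤ eLpNorm (fun x => ψ x + 1) (ENNReal.ofReal (p / 2)) μ
        + eLpNorm (fun x => ‖B x‖ ^ 2) (ENNReal.ofReal (p / 2)) μ :=
        eLpNorm_add_le (hψm.add aestronglyMeasurable_const) hBm2 hp2
    _ ≤ _ := by
        gcongr
        exact (eLpNorm_add_le hψm aestronglyMeasurable_const hp2).trans (by gcongr)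

/-! ### The iteration -/

/-- The convex function `(s² + δ)^{k/2}`, a smooth positive approximation of `|s|^k`. -/
def smoothPower (δ k s : ℝ) : ℝ := (s ^ 2 + δ) ^ (k / 2)

theorem smoothPower_nonneg {δ : ℝ} (hδ : 0 < δ) (k s : ℝ) : 0 ≤ smoothPower δ k s :=
  Real.rpow_nonneg (by positivity) _

theorem contDiff_smoothPower {δ : ℝ} (hδ : 0 < δ) (k : ℝ) : ContDiff ℝ ∞ (smoothPower δ k) :=
  ((contDiff_id.pow 2).add contDiff_const).rpow_const_of_ne fun s => by
    have : (0 : ℝ) < id s ^ 2 + δ := by positivity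
    exact this.ne'

theorem deriv_deriv_smoothPower_nonneg {δ k : ℝ} (hδ : 0 < δ) (hk : 1 ≤ k) (s : ℝ) :
    0 ≤ deriv (deriv (smoothPower δ k)) s := by
  have hw : ∀ s : ℝ, 0 < s ^ 2 + δ := fun s => by positivity
  have hw' : ∀ s : ℝ, HasDerivAt (fun s : ℝ => s ^ 2 + δ) (2 * s) s := fun s => by
    simpa using (hasDerivAt_pow 2 s).add_const δ
  have hd : ∀ e s, HasDerivAt (fun s : ℝ => (s ^ 2 + δ) ^ e)
      (2 * s * e * (s ^ 2 + δ) ^ (e - 1)) s :=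
    fun e s => (hw' s).rpow_const (Or.inl (hw s).ne')
  have h1 : deriv (smoothPower δ k) = fun s => k * (s * (s ^ 2 + δ) ^ (k / 2 - 1)) := by
    ext s
    rw [show smoothPower δ k = fun s => (s ^ 2 + δ) ^ (k / 2) from rfl, (hd _ s).deriv]
    ring
  have h5 := (((hasDerivAt_id' s).mul (hd (k / 2 - 1) s)).const_mul k).deriv
  simp only [Pi.mul_apply] at h5
  rw [h1, h5]
  have h2 : (s ^ 2 + δ) ^ (k / 2 - 1) = (s ^ 2 + δ) * (s ^ 2 + δ) ^ (k / 2 - 1 - 1) := by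
    nth_rw 2 [← Real.rpow_one (s ^ 2 + δ)]
    rw [← Real.rpow_add (hw s)]
    ring_nf
  rw [h2]
  have h3 : 0 ≤ (s ^ 2 + δ) ^ (k / 2 - 1 - 1) := Real.rpow_nonneg (hw s).le _
  have h4 : 0 ≤ (k - 1) * s ^ 2 + δ := by nlinarith [sq_nonneg s]
  have : k * (1 * ((s ^ 2 + δ) * (s ^ 2 + δ) ^ (k / 2 - 1 - 1))
      + s * (2 * s * (k / 2 - 1) * (s ^ 2 + δ) ^ (k / 2 - 1 - 1)))
      = k * (((k - 1) * s ^ 2 + δ) * (s ^ 2 + δ) ^ (k / 2 - 1 - 1)) := by ring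
  rw [this]
  positivity

/-- Raising to the power `k` multiplies the exponents by `k`; this links successive iteration
steps. -/
theorem mixedPower_smoothPower {d : ℕ} (u : SpaceTime d → ℝ) {δ : ℝ} (hδ : 0 < δ) (a k σ : ℝ)
    (x₀ : Space d) (t₀ ρ : ℝ) :
    mixedPower (fun z => smoothPower δ k (u z)) a σ x₀ t₀ ρ
      = mixedPower (fun z => smoothPower δ 1 (u z)) a (k * σ) x₀ t₀ ρ := by
  have : ∀ s, ENNReal.ofReal (smoothPower δ k s) ^ (a * σ)
      = ENNReal.ofReal (smoothPower δ 1 s) ^ (a * (k * σ)) := by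
    intro s
    have hw : 0 < s ^ 2 + δ := by positivity
    rw [smoothPower, smoothPower, ← ENNReal.ofReal_rpow_of_pos hw, ← ENNReal.ofReal_rpow_of_pos hw,
      ← ENNReal.rpow_mul, ← ENNReal.rpow_mul]
    ring_nf
  simp only [mixedPower, this]

/-- The constant produced by iterating `X (n + 1) ≤ (G 4^n X n)^σ`: with `m = 4^{σ/(σ-1)}` it solves
`H^{σ-1} = m G^σ`. -/
def moserConst (σ : ℝ) (G : ℝ≥0∞) : ℝ≥0∞ := (4 ^ (σ / (σ - 1)) * G ^ σ) ^ (σ - 1)⁻¹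

theorem moserConst_ne_top {σ : ℝ} (hσ : 1 < σ) {G : ℝ≥0∞} (hG : G ≠ ⊤) : moserConst σ G ≠ ⊤ := by
  have h1 : 0 < σ - 1 := by linarith
  refine ENNReal.rpow_ne_top_of_nonneg (by positivity) (ENNReal.mul_ne_top ?_ ?_)
  · exact ENNReal.rpow_ne_top_of_nonneg (by positivity) (by simp)
  · exact ENNReal.rpow_ne_top_of_nonneg (by positivity) hG

theorem le_moserConst_mul_rpow {σ : ℝ} (hσ : 1 < σ) {G : ℝ≥0∞} (hG : 1 ≤ G) {X : ℕ → ℝ≥0∞}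
    (hX : ∀ n, X (n + 1) ≤ (G * 4 ^ n * X n) ^ σ) (n : ℕ) :
    X n ≤ (moserConst σ G * X 0) ^ (σ ^ n) := by
  have h1 : 0 < σ - 1 := by linarith
  have hσ0 : 0 ≤ σ := by linarith
  set m : ℝ≥0∞ := 4 ^ (σ / (σ - 1)) with hm
  set H := moserConst σ G with hH
  have hm1 : 1 ≤ m := ENNReal.one_le_rpow (by norm_num) (by positivity)
  have hmσ : m ^ σ = m * 4 ^ σ := by
    rw [hm, ← ENNReal.rpow_mul, ← ENNReal.rpow_add _ _ (by norm_num) (by norm_num)]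
    congr 1
    field_simp
    ring
  have hHσ : H ^ σ = H * (m * G ^ σ) := by
    have : H ^ (σ - 1) = m * G ^ σ := by
      rw [hH, moserConst, ← ENNReal.rpow_mul, inv_mul_cancel₀ h1.ne', ENNReal.rpow_one]
    rw [← this]
    conv_rhs => rw [← ENNReal.rpow_one H, ← ENNReal.rpow_mul, one_mul,
      ← ENNReal.rpow_add_of_nonneg _ _ zero_le_one h1.le]
    congr 1
    ring
  have hcomm : ∀ (y : ℝ≥0∞) (n : ℕ), (y ^ n) ^ σ = (y ^ σ) ^ n := fun y n => by
    rw [← ENNReal.rpow_natCast, ← ENNReal.rpow_natCast, ← ENNReal.rpow_mul, ← ENNReal.rpow_mul,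
      mul_comm]
  have hH1 : 1 ≤ H := ENNReal.one_le_rpow
    (one_le_mul hm1 (ENNReal.one_le_rpow hG (by linarith))) (by positivity)
  -- multiplication by `H m^n` turns the recursion into `Z (n + 1) ≤ (Z n)^σ`
  have key : ∀ n, H * m ^ n * X n ≤ (H * X 0) ^ (σ ^ n) := by
    intro n
    induction n with
    | zero => simp
    | succ n ih =>
      calc H * m ^ (n + 1) * X (n + 1) ≤ H * m ^ (n + 1) * (G * 4 ^ n * X n) ^ σ := by
            gcongr; exact hX n
        _ = (H * (m * G ^ σ)) * (m * 4 ^ σ) ^ n * X n ^ σ := by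
            rw [ENNReal.mul_rpow_of_nonneg _ _ hσ0, ENNReal.mul_rpow_of_nonneg _ _ hσ0, mul_pow,
              hcomm 4 n]
            ring
        _ = (H * m ^ n * X n) ^ σ := by
            rw [← hHσ, ← hmσ, ENNReal.mul_rpow_of_nonneg _ _ hσ0,
              ENNReal.mul_rpow_of_nonneg _ _ hσ0,
              hcomm m n]
        _ ≤ ((H * X 0) ^ (σ ^ n)) ^ σ := by gcongr
        _ = _ := by rw [← ENNReal.rpow_mul, pow_succ]
  exact (le_mul_of_one_le_left (zero_le) (one_le_mul hH1 (one_le_pow₀ hm1))).trans (key n)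

theorem mixedPower_one_eq {d : ℕ} {v : SpaceTime d → ℝ} (hv : ∀ z, 0 ≤ v z) {a : ℝ} (ha : 0 < a)
    (x₀ : Space d) (t₀ ρ : ℝ) :
    mixedPower v a 1 x₀ t₀ ρ
      = mixedNorm v (ENNReal.ofReal a) 2 (cube x₀ ρ) (timeInterval t₀ ρ) ^ 2 := by
  have ha0 : ENNReal.ofReal a ≠ 0 := (ENNReal.ofReal_pos.2 ha).ne'
  rw [mixedNorm, mixedPower,
    eLpNorm_eq_lintegral_rpow_enorm_toReal two_ne_zero ENNReal.ofNat_ne_top, ← ENNReal.rpow_natCast,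
    ← ENNReal.rpow_mul]
  simp only [ENNReal.toReal_ofNat, Nat.cast_ofNat, one_div, inv_mul_cancel₀ (two_ne_zero' ℝ),
    ENNReal.rpow_one, enorm_eq_self]
  refine lintegral_congr fun t => ?_
  rw [eLpNorm_eq_lintegral_rpow_enorm_toReal ha0 ENNReal.ofReal_ne_top, ENNReal.toReal_ofReal ha.le,
    ← ENNReal.rpow_mul]
  simp only [Real.enorm_of_nonneg (hv _), mul_one]
  congr 1
  ring

/-- If the mixed norms of exponents `(aσⁿ, 2σⁿ)` stay bounded by `K^{1/2}` as `n → ∞`, so does the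
supremum. -/
theorem eLpNorm_top_le_of_mixedPower_le {d : ℕ} {v : SpaceTime d → ℝ} (hvm : Measurable v)
    (hv : ∀ z, 0 ≤ v z) {a σ : ℝ} (ha : 0 < a) (hσ : 1 < σ) {x₀ : Space d} {t₀ r : ℝ}
    {K : ℝ≥0∞} (hK : ∀ n : ℕ, mixedPower v a (σ ^ n) x₀ t₀ r ≤ K ^ (σ ^ n)) :
    eLpNorm v ⊤ (volume.restrict (paraCylinder x₀ t₀ r)) ≤ K ^ (2⁻¹ : ℝ) := by
  refine le_of_forall_gt_imp_ge_of_dense fun Λ hΛ => ?_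
  rcases eq_or_ne Λ ⊤ with rfl | hΛt
  · exact le_top
  have hKΛ : K < Λ ^ (2 : ℝ) := by
    have := ENNReal.rpow_lt_rpow hΛ two_pos
    rwa [← ENNReal.rpow_mul, inv_mul_cancel₀ (two_ne_zero' ℝ), ENNReal.rpow_one] at this
  have hΛ0 : Λ ≠ 0 := (bot_le.trans_lt hΛ).ne'
  -- for `Λ² > K`, the superlevel set `{v ≥ Λ}` has to be null, as `(K / Λ²)^(σ^n) → 0`
  set E : Set (SpaceTime d) := {z | Λ ≤ ENNReal.ofReal (v z)} with hE
  have hEm : MeasurableSet E := measurableSet_le measurable_const hvm.ennreal_ofReal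
  set J : ℝ → ℝ≥0∞ := fun t => volume.restrict (cube x₀ r) ((fun x => (x, t)) ⁻¹' E) with hJ
  have hJm : Measurable J := measurable_measure_prodMk_right hEm
  set I := ∫⁻ t in timeInterval t₀ r, J t ^ (2 / a) with hI
  have hΛI : ∀ n : ℕ, (Λ ^ (2 : ℝ)) ^ (σ ^ n) * I ≤ K ^ (σ ^ n) := by
    intro n
    refine le_trans ?_ (hK n)
    have hσn : 0 ≤ σ ^ n := by positivity
    rw [hI, ← lintegral_const_mul _ (hJm.pow_const _), mixedPower]
    refine lintegral_mono fun t => ?_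
    calc _ = (Λ ^ (a * σ ^ n) * J t) ^ (2 / a) := by
          rw [ENNReal.mul_rpow_of_nonneg _ _ (by positivity), ← ENNReal.rpow_mul,
            ← ENNReal.rpow_mul]
          congr 2
          field_simp
      _ ≤ _ := by
          gcongr
          have hEt : MeasurableSet ((fun x => (x, t)) ⁻¹' E) := measurable_prodMk_right hEm
          rw [hJ, ← lintegral_indicator_const hEt]
          refine lintegral_mono fun x => ?_
          by_cases hx : x ∈ (fun x => (x, t)) ⁻¹' E
          · rw [indicator_of_mem hx]
            exact ENNReal.rpow_le_rpow hx (by positivity)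
          · rw [indicator_of_notMem hx]
            exact zero_le
  have hI0 : I = 0 := by
    have hlt : K / Λ ^ (2 : ℝ) < 1 := by
      rw [ENNReal.div_lt_iff (Or.inl (by simp [hΛ0])) (Or.inl (by simp [hΛt]))]
      simpa using hKΛ
    have hle : ∀ n : ℕ, I ≤ (K / Λ ^ (2 : ℝ)) ^ (σ ^ n) := by
      intro n
      have hσn : 0 < σ ^ n := by positivity
      rw [ENNReal.div_rpow_of_nonneg _ _ hσn.le, ENNReal.le_div_iff_mul_le, mul_comm]
      · exact hΛI n
      · left; simp [hΛ0, hΛt]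
      · left
        exact ENNReal.rpow_ne_top_of_nonneg hσn.le (by simp [hΛt])
    exact le_antisymm (ge_of_tendsto' ((ENNReal.tendsto_rpow_atTop_of_base_lt_one hlt).comp
      (tendsto_pow_atTop_atTop_of_one_lt hσ)) hle) zero_le
  have hE0 : volume.restrict (paraCylinder x₀ t₀ r) E = 0 := by
    rw [paraCylinder, Measure.volume_eq_prod, ← Measure.prod_restrict,
      Measure.prod_apply_symm hEm]
    rw [hI, lintegral_eq_zero_iff (hJm.pow_const _)] at hI0
    rw [lintegral_eq_zero_iff hJm]
    filter_upwards [hI0] with t ht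
    exact (ENNReal.rpow_eq_zero_iff_of_pos (by positivity)).1 ht
  rw [eLpNorm_exponent_top]
  refine eLpNormEssSup_le_of_ae_enorm_bound ?_
  rw [ae_iff]
  refine measure_mono_null (fun z hz => ?_) hE0
  rw [mem_ofPred_eq, not_le, Real.enorm_of_nonneg (hv z)] at hz
  exact hz.le

/-! ### The supremum bound for energy solutions -/

/-- By Minkowski's inequality the mixed norm of `(u² + ε²)^{1/2} ≤ |u| + ε` exceeds that of `u` by
at most a multiple of `ε`. -/
theorem mixedNorm_smoothPower_le {d : ℕ} {u : SpaceTime d → ℝ} (hu : Measurable u) {ε : ℝ}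
    (hε : 0 < ε) {a : ℝ} (ha : 1 ≤ a) (x₀ : Space d) (t₀ ρ : ℝ) :
    mixedNorm (fun z => smoothPower (ε ^ 2) 1 (u z)) (ENNReal.ofReal a) 2 (cube x₀ ρ)
        (timeInterval t₀ ρ)
      ≤ mixedNorm u (ENNReal.ofReal a) 2 (cube x₀ ρ) (timeInterval t₀ ρ)
        + ENNReal.ofReal ε * mixedNorm (fun _ => 1) (ENNReal.ofReal a) 2 (cube x₀ ρ)
          (timeInterval t₀ ρ) := by
  have ha1 : 1 ≤ ENNReal.ofReal a := ENNReal.one_le_ofReal.2 ha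
  have ha0 : ENNReal.ofReal a ≠ 0 := (zero_lt_one.trans_le ha1).ne'
  have hle : ∀ s, ‖smoothPower (ε ^ 2) 1 s‖ ≤ ‖|s| + ε‖ := by
    intro s
    have h1 : 0 ≤ |s| + ε := by positivity
    rw [Real.norm_of_nonneg (smoothPower_nonneg (by positivity) _ _), Real.norm_of_nonneg h1,
      smoothPower, ← Real.sqrt_eq_rpow]
    refine Real.sqrt_le_iff.2 ⟨h1, ?_⟩
    rw [← sq_abs s]
    nlinarith [mul_nonneg (abs_nonneg s) hε.le]
  have hslice : ∀ t, eLpNorm (fun x => smoothPower (ε ^ 2) 1 (u (x, t))) (ENNReal.ofReal a)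
      (volume.restrict (cube x₀ ρ))
      ≤ eLpNorm (fun x => u (x, t)) (ENNReal.ofReal a) (volume.restrict (cube x₀ ρ))
        + ENNReal.ofReal ε * eLpNorm (fun _ : Space d => (1 : ℝ)) (ENNReal.ofReal a)
          (volume.restrict (cube x₀ ρ)) := by
    intro t
    have hut : Measurable fun x => u (x, t) := hu.comp measurable_prodMk_right
    refine (eLpNorm_mono fun x => hle _).trans ((eLpNorm_add_le (f := fun x => |u (x, t)|)
      hut.abs.aestronglyMeasurable aestronglyMeasurable_const ha1).trans (le_of_eq ?_))
    congr 1
    · exact eLpNorm_norm fun x => u (x, t)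
    · have := eLpNorm_const_smul ε (fun _ : Space d => (1 : ℝ)) (ENNReal.ofReal a)
        (volume.restrict (cube x₀ ρ))
      rw [Real.enorm_of_nonneg hε.le] at this
      rw [← this]
      congr 1
      ext
      simp
  have hm := measurable_eLpNorm_slice hu ha0 ENNReal.ofReal_ne_top (volume.restrict (cube x₀ ρ))
  refine (eLpNorm_mono_enorm fun t => ?_).trans ((eLpNorm_add_le
    (g := fun _ => ENNReal.ofReal ε * eLpNorm (fun _ : Space d => (1 : ℝ)) (ENNReal.ofReal a)
      (volume.restrict (cube x₀ ρ))) hm.aestronglyMeasurable aestronglyMeasurable_const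
      one_le_two).trans ?_)
  · simpa using hslice t
  · rw [mixedNorm, mixedNorm]
    gcongr
    rw [eLpNorm_const' _ two_ne_zero ENNReal.ofNat_ne_top,
      eLpNorm_const' _ two_ne_zero ENNReal.ofNat_ne_top]
    simp only [enorm_eq_self]
    rw [mul_assoc]

theorem mixedNorm_one_ne_top {d : ℕ} {a : ℝ} (ha : 0 < a) (x₀ : Space d) (t₀ ρ : ℝ) :
    mixedNorm (fun _ : SpaceTime d => 1) (ENNReal.ofReal a) 2 (cube x₀ ρ)
      (timeInterval t₀ ρ) ≠ ⊤ := by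
  have ha0 : ENNReal.ofReal a ≠ 0 := (ENNReal.ofReal_pos.2 ha).ne'
  have h1 : volume (cube x₀ ρ) ≠ ⊤ := (isBounded_cube x₀ ρ).measure_lt_top.ne
  rw [mixedNorm, eLpNorm_const' _ two_ne_zero ENNReal.ofNat_ne_top,
    eLpNorm_const' _ ha0 ENNReal.ofReal_ne_top, Measure.restrict_apply_univ,
    Measure.restrict_apply_univ, timeInterval, Real.volume_Ioo]
  have h2 : volume (cube x₀ ρ) ^ (1 / (ENNReal.ofReal a).toReal) ≠ ⊤ :=
    ENNReal.rpow_ne_top_of_nonneg (by positivity) h1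
  simp only [enorm_eq_self, enorm_one, one_mul]
  exact ENNReal.mul_ne_top h2 (ENNReal.rpow_ne_top_of_nonneg (by positivity) ENNReal.ofReal_ne_top)

/-- The local sup estimate for energy solutions, by iterating `mixedPower_step` on the cylinders of
sizes `r (1 + 2⁻ⁿ)`. -/
theorem IsEnergySolution.eLpNorm_top_le {d : ℕ} {U : Set (Space d)} {T : ℝ}
    {A : Space d → Matrix (Fin d) (Fin d) ℝ} {B : Space d → Space d} {ψ : Space d → ℝ}
    {lam M c₀ L : ℝ} {u : SpaceTime d → ℝ} {Du : SpaceTime d → Space d} {ut : SpaceTime d → ℝ}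
    (hs : IsEnergySolution U T A B ψ lam M c₀ L u Du ut) {x₀ : Space d} {t₀ r : ℝ} (hr : 0 < r)
    (hU : cube x₀ (2 * r) ⊆ U) (h0 : 0 < t₀ - (2 * r) ^ 2) (hT : t₀ < T)
    {p a σ : ℝ} (hp : 0 < p) (ha : 0 < a) (hpa : 2 / p + 2 / a = 1) (hσ : 1 < σ)
    {b CS : ℝ≥0} (hb : 0 < b) (hab : (σ - 1) / 2 = 1 / a - 1 / b) {R : ℝ} (hR : 2 * r ≤ R)
    {N : ℝ≥0∞}
    (hN : (∫⁻ x in cube x₀ R, ENNReal.ofReal (ψ x + 1 + ‖B x‖ ^ 2) ^ (p / 2)) ^ (2 / p) ≤ N)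
    (hCS : ∀ w : Space d → ℝ, ContDiff ℝ 1 w → HasCompactSupport w → tsupport w ⊆ cube x₀ R →
      eLpNorm w b volume ≤ CS * eLpNorm (fderiv ℝ w) 2 volume)
    {c : ℝ} (hc1 : 1 ≤ c) (hc : ∀ (x₀ : Space d) (t₀ ρ ρ' : ℝ), 0 ≤ ρ → ρ < ρ' →
      ∃ ζ χ, IsParabolicCutoff x₀ t₀ ρ ρ' (1 + c / (ρ' - ρ)) ζ χ)
    {G : ℝ≥0∞} (hG1 : 1 ≤ G) (hGt : G ≠ ⊤)
    (hG : (ENNReal.ofReal (2 / c₀) + CS ^ 2 * ENNReal.ofReal (4 * d ^ 2 / lam + 2))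
      * ENNReal.ofReal (4 * (M * d ^ 2) ^ 2 / lam + 1 / lam + 1) * N
      * ENNReal.ofReal ((1 + 2 * c / r) ^ 2) ≤ G) :
    eLpNorm u ⊤ (volume.restrict (paraCylinder x₀ t₀ r)) ≤ moserConst σ G ^ (2⁻¹ : ℝ)
      * mixedNorm u (ENNReal.ofReal a) 2 (cube x₀ (2 * r)) (timeInterval t₀ (2 * r)) := by
  have ha1 : 1 ≤ a := by
    have h1 : 0 < 2 / p := by positivity
    have h2 : 2 / a < 1 := by linarith
    rw [div_lt_one ha] at h2
    linarith
  set H := moserConst σ G ^ (2⁻¹ : ℝ) with hH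
  set ρ : ℕ → ℝ := fun n => r * (1 + (2⁻¹ : ℝ) ^ n) with hρ
  have hpow : ∀ n : ℕ, 0 < (2⁻¹ : ℝ) ^ n := fun n => by positivity
  have hρr : ∀ n, r ≤ ρ n := fun n => by
    have := mul_pos hr (hpow n); simp only [hρ]; linarith
  have hρ2 : ∀ n, ρ n ≤ 2 * r := fun n => by
    have h1 : (2⁻¹ : ℝ) ^ n ≤ 1 := pow_le_one₀ (by norm_num) (by norm_num)
    simp only [hρ]; nlinarith
  have hρd : ∀ n, ρ n - ρ (n + 1) = r * (2⁻¹ : ℝ) ^ n / 2 := fun n => by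
    simp only [hρ, pow_succ]; ring
  -- the estimate for the regularised function
  have hreg : ∀ ε : ℝ, 0 < ε → eLpNorm u ⊤ (volume.restrict (paraCylinder x₀ t₀ r)) ≤
      H * mixedNorm (fun z => smoothPower (ε ^ 2) 1 (u z)) (ENNReal.ofReal a) 2 (cube x₀ (2 * r))
        (timeInterval t₀ (2 * r)) := by
    intro ε hε
    have hδ : 0 < ε ^ 2 := by positivity
    set v : SpaceTime d → ℝ := fun z => smoothPower (ε ^ 2) 1 (u z) with hv
    have hvm : Measurable v :=
      (contDiff_smoothPower hδ 1).continuous.measurable.comp hs.measurable_u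
    have hv0 : ∀ z, 0 ≤ v z := fun z => smoothPower_nonneg hδ 1 _
    have huv : ∀ z, ‖u z‖ ≤ ‖v z‖ := by
      intro z
      rw [Real.norm_of_nonneg (hv0 z), hv]
      simp only [smoothPower]
      rw [← Real.sqrt_eq_rpow]
      exact Real.abs_le_sqrt (by linarith)
    have hstep : ∀ n : ℕ, mixedPower v a (σ ^ (n + 1)) x₀ t₀ (ρ (n + 1))
        ≤ (G * 4 ^ n * mixedPower v a (σ ^ n) x₀ t₀ (ρ n)) ^ σ := by
      intro n
      have hρn : 0 ≤ ρ (n + 1) := hr.le.trans (hρr _)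
      have hlt : ρ (n + 1) < ρ n := by
        rw [← sub_pos, hρd]; have := mul_pos hr (hpow n); linarith
      obtain ⟨ζ, χ, hζχ⟩ := hc x₀ t₀ _ _ hρn hlt
      have h1 := hs.mixedPower_step (contDiff_smoothPower hδ (σ ^ n)) (smoothPower_nonneg hδ _)
        (deriv_deriv_smoothPower_nonneg hδ (one_le_pow₀ hσ.le)) hζχ hρn hlt.le
        ((cube_subset_cube x₀ (hρ2 n)).trans hU)
        (h0.trans_le (by
          have := pow_le_pow_left₀ (hr.le.trans (hρr n)) (hρ2 n) 2
          linarith)) hT hp ha hpa hσ.le hb hab ((hρ2 n).trans hR) hN hCS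
      rw [mixedPower_smoothPower u hδ a _ σ, mixedPower_smoothPower u hδ a _ 1, mul_one,
        ← pow_succ] at h1
      refine h1.trans (ENNReal.rpow_le_rpow (mul_le_mul' ?_ le_rfl) (by linarith))
      have hD : (1 + c / (ρ n - ρ (n + 1))) ^ 2 ≤ (1 + 2 * c / r) ^ 2 * 4 ^ n := by
        have h2 : c / (ρ n - ρ (n + 1)) = 2 * c / r * 2 ^ n := by
          rw [hρd, inv_pow]; field_simp
        have h3 : (1 : ℝ) ≤ 2 ^ n := one_le_pow₀ one_le_two
        have h4 : 0 ≤ 2 * c / r := by positivity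
        rw [h2, show (4 : ℝ) ^ n = (2 ^ n) ^ 2 by rw [← pow_mul, mul_comm, pow_mul]; norm_num,
          ← mul_pow]
        gcongr
        nlinarith
      calc _ ≤ (ENNReal.ofReal (2 / c₀) + CS ^ 2 * ENNReal.ofReal (4 * d ^ 2 / lam + 2))
            * ENNReal.ofReal (4 * (M * d ^ 2) ^ 2 / lam + 1 / lam + 1) * N
            * (ENNReal.ofReal ((1 + 2 * c / r) ^ 2) * 4 ^ n) := by
            refine mul_le_mul' le_rfl ((ENNReal.ofReal_le_ofReal hD).trans (le_of_eq ?_))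
            rw [ENNReal.ofReal_mul (by positivity), ENNReal.ofReal_pow (zero_le_four (α := ℝ)),
              ENNReal.ofReal_ofNat]
        _ ≤ _ := by
            rw [← mul_assoc]
            exact mul_le_mul' hG le_rfl
    have hiter := le_moserConst_mul_rpow hσ hG1
      (X := fun n => mixedPower v a (σ ^ n) x₀ t₀ (ρ n)) hstep
    have hρ0 : ρ 0 = 2 * r := by simp only [hρ]; ring
    simp only [pow_zero, hρ0] at hiter
    have hfin := eLpNorm_top_le_of_mixedPower_le hvm hv0 ha hσ (x₀ := x₀) (t₀ := t₀) (r := r)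
      (K := moserConst σ G * mixedPower v a 1 x₀ t₀ (2 * r)) fun n => by
        refine le_trans ?_ (hiter n)
        rw [mixedPower, mixedPower]
        refine (lintegral_mono_set (Ioo_subset_Ioo_left ?_)).trans (lintegral_mono fun t => ?_)
        · have := pow_le_pow_left₀ hr.le (hρr n) 2
          linarith
        · gcongr
          exact cube_subset_cube x₀ (hρr n)
    refine (eLpNorm_mono huv).trans (hfin.trans (le_of_eq ?_))
    rw [mixedPower_one_eq hv0 ha, ENNReal.mul_rpow_of_nonneg _ _ (by norm_num),
      ← ENNReal.rpow_natCast, ← ENNReal.rpow_mul]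
    norm_num [hH]
  have hHt : H ≠ ⊤ := ENNReal.rpow_ne_top_of_nonneg (by norm_num) (moserConst_ne_top hσ hGt)
  set m := mixedNorm u (ENNReal.ofReal a) 2 (cube x₀ (2 * r)) (timeInterval t₀ (2 * r)) with hm
  have hlim : Tendsto (fun ε : ℝ => H * (m + ENNReal.ofReal ε * mixedNorm (fun _ => 1)
      (ENNReal.ofReal a) 2 (cube x₀ (2 * r)) (timeInterval t₀ (2 * r)))) (𝓝[>] 0) (𝓝 (H * m)) := by
    have h1 : Tendsto (fun ε : ℝ => ENNReal.ofReal ε) (𝓝[>] 0) (𝓝 0) := by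
      simpa using (ENNReal.tendsto_ofReal (tendsto_id (x := 𝓝 (0 : ℝ)))).mono_left
        nhdsWithin_le_nhds
    have h2 := ENNReal.Tendsto.mul_const h1
      (Or.inr (mixedNorm_one_ne_top ha x₀ t₀ (2 * r)))
    simpa using ENNReal.Tendsto.const_mul (h2.const_add m) (Or.inr hHt)
  -- the constant `H` is independent of the regularisation parameter `ε`
  refine ge_of_tendsto hlim ?_
  filter_upwards [self_mem_nhdsWithin] with ε hε
  exact (hreg ε hε).trans (by gcongr; exact mixedNorm_smoothPower_le hs.measurable_u hε ha1 _ _ _)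

/-! ### Passing to a bounded representative -/

/-- A bounded weak solution in `H^{1,2}` agrees almost everywhere with an everywhere bounded and
measurable one, which is an energy solution. -/
theorem exists_isEnergySolution {d : ℕ} {U : Set (Space d)} {T : ℝ}
    {A : Space d → Matrix (Fin d) (Fin d) ℝ} {B : Space d → Space d} {ψ : Space d → ℝ}
    {lam M c₀ : ℝ} {u : SpaceTime d → ℝ} (hlam : 0 < lam) (hM : 0 < M) (hc₀ : 0 < c₀)
    (hU : IsOpen U) (hUb : Bornology.IsBounded U)
    (hAm : ∀ i j, AEStronglyMeasurable (fun x => A x i j) (volume.restrict U))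
    (hAe : ∀ᵐ x ∂(volume.restrict U), ∀ ξ : Space d,
      lam * ‖ξ‖ ^ 2 ≤ ∑ i, ∑ j, A x i j * ξ i * ξ j)
    (hAM : ∀ᵐ x ∂(volume.restrict U), ∀ i j, |A x i j| ≤ M)
    (hB : MemLp B 2 (volume.restrict U)) (hψ : MemLp ψ 2 (volume.restrict U))
    (hψc : ∀ᵐ x ∂(volume.restrict U), c₀ ≤ ψ x) (hu : MemH12 (U ×ˢ Ioo 0 T) u)
    (hub : MemLp u ⊤ (volume.restrict (U ×ˢ Ioo 0 T))) (hsol : IsWeakSolution U T A B ψ u) :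
    ∃ L w Du ut, IsEnergySolution U T A B ψ lam M c₀ L w Du ut ∧
      u =ᵐ[volume.restrict (U ×ˢ Ioo 0 T)] w := by
  set μ : Measure (SpaceTime d) := volume.restrict (U ×ˢ Ioo 0 T) with hμ
  have : IsFiniteMeasure μ :=
    ⟨by rw [hμ, Measure.restrict_apply_univ]; exact (hUb.prod (isBounded_Ioo 0 T)).measure_lt_top⟩
  obtain ⟨ut, hut, hutw⟩ := hu.time_deriv
  obtain ⟨Du, hDu, heq⟩ := hsol
  set L := (eLpNorm u ⊤ μ).toReal with hL
  have hL0 : 0 ≤ L := ENNReal.toReal_nonneg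
  set w : SpaceTime d → ℝ := fun z => max (-L) (min L (hub.1.mk u z)) with hw
  have hwm : Measurable w :=
    measurable_const.max (measurable_const.min hub.1.stronglyMeasurable_mk.measurable)
  have hwL : ∀ z, |w z| ≤ L := fun z =>
    abs_le.2 ⟨le_max_left _ _, max_le (by linarith) (min_le_left _ _)⟩
  have huw : u =ᵐ[μ] w := by
    filter_upwards [hub.1.ae_eq_mk, ae_le_eLpNormEssSup (f := u) (μ := μ)] with z h1 h2
    have h3 : |u z| ≤ L := by
      rw [hL, ← Real.norm_eq_abs, ← toReal_enorm]
      exact ENNReal.toReal_mono hub.2.ne h2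
    have h4 := abs_le.1 h3
    simp only [hw, ← h1]
    rw [min_eq_right h4.2, max_eq_right h4.1]
  have hwi : LocallyIntegrableOn w (U ×ˢ Ioo 0 T) :=
    IntegrableOn.locallyIntegrableOn ((hu.memLp.integrable one_le_two).congr huw)
  have hcongr : ∀ (f g : SpaceTime d → ℝ),
      ∫ z in U ×ˢ Ioo 0 T, u z * f z * g z = ∫ z in U ×ˢ Ioo 0 T, w z * f z * g z := by
    intro f g
    refine integral_congr_ae ?_
    filter_upwards [huw] with z hz
    rw [hz]
  have hweak : ∀ v g, IsWeakDeriv (U ×ˢ Ioo 0 T) v u g → IsWeakDeriv (U ×ˢ Ioo 0 T) v w g := by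
    intro v g h
    refine ⟨hwi, h.locallyIntegrable_deriv, fun φ hφ => ?_⟩
    rw [← h.integral_eq φ hφ]
    simpa using (hcongr (fun z => fderiv ℝ φ z v) fun _ => 1).symm
  exact ⟨L, w, Du, ut, ⟨hU, hUb, hlam, hM, hc₀, hAm, hAe, hAM, hB, hψ, hψc, hwm, hwL,
    ⟨hDu.memLp, fun i => hweak _ _ (hDu.isWeakDeriv i)⟩, hut, hweak _ _ hutw,
    fun φ hφ => by rw [← hcongr]; exact heq φ hφ⟩, huw⟩

theorem mixedNorm_congr_ae {d : ℕ} {f g : SpaceTime d → ℝ} {Ω : Set (SpaceTime d)}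
    (hΩ : MeasurableSet Ω) (h : f =ᵐ[volume.restrict Ω] g) (a b : ℝ≥0∞) {V : Set (Space d)}
    {I : Set ℝ} (hV : MeasurableSet V) (hI : MeasurableSet I) (hVI : V ×ˢ I ⊆ Ω) :
    mixedNorm f a b V I = mixedNorm g a b V I := by
  have h1 := ae_time_slice ((ae_restrict_iff' hΩ).1 h)
  refine eLpNorm_congr_ae ?_
  rw [EventuallyEq, ae_restrict_iff' hI]
  filter_upwards [h1] with t ht htI
  refine eLpNorm_congr_ae ?_
  rw [EventuallyEq, ae_restrict_iff' hV]
  filter_upwards [ht] with x hx hxV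
  exact hx (hVI ⟨hxV, htI⟩)

end

theorem theorem3p2 (d : ℕ) (hd : 2 ≤ d) (p q : ℝ) (hp : (d : ℝ) < p)
    (hq : max 2 (p / 2) ≤ q) (hqp : q < p)
    (r lam M c₀ : ℝ) (hr : 0 < r) (hlam : 0 < lam) (hM : 0 < M) (hc₀ : 0 < c₀)
    (NB Nψ : ℝ≥0) :
    ∃ C : ℝ, 0 < C ∧
      ∀ (U : Set (Space d)) (T : ℝ)
        (A : Space d → Matrix (Fin d) (Fin d) ℝ) (B : Space d → Space d) (ψ : Space d → ℝ)
        (u : SpaceTime d → ℝ) (x₀ : Space d) (t₀ : ℝ),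
        IsOpen U → Bornology.IsBounded U → 0 < T →
        (∀ i j, AEStronglyMeasurable (fun x => A x i j) (volume.restrict U)) →
        (∀ᵐ x ∂(volume.restrict U), ∀ ξ : Space d,
          lam * ‖ξ‖ ^ 2 ≤ ∑ i, ∑ j, A x i j * ξ i * ξ j) →
        (∀ᵐ x ∂(volume.restrict U), ∀ i j, |A x i j| ≤ M) →
        MemLp B (ENNReal.ofReal p) (volume.restrict U) →
        MemLp ψ (ENNReal.ofReal q) (volume.restrict U) →
        (∀ᵐ x ∂(volume.restrict U), c₀ ≤ ψ x) →
        MemH12 (U ×ˢ Ioo 0 T) u →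
        MemLp u ⊤ (volume.restrict (U ×ˢ Ioo 0 T)) →
        IsWeakSolution U T A B ψ u →
        x₀ ∈ U → t₀ ∈ Ioo 0 T →
        paraCylinder x₀ t₀ (3 * r) ⊆ U ×ˢ Ioo 0 T →
        eLpNorm B (ENNReal.ofReal p) (volume.restrict (cube x₀ (3 * r))) ≤ NB →
        eLpNorm ψ (ENNReal.ofReal q) (volume.restrict (cube x₀ (3 * r))) ≤ Nψ →
        eLpNorm u ⊤ (volume.restrict (paraCylinder x₀ t₀ r)) ≤
          ENNReal.ofReal C *
            mixedNorm u (ENNReal.ofReal (2 * p / (p - 2))) 2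
              (cube x₀ (2 * r)) (timeInterval t₀ (2 * r)) := by
  have hd0 : (2 : ℝ) ≤ d := by exact_mod_cast hd
  have hp2 : 2 < p := by linarith
  have hq2 : 2 ≤ q := (le_max_left _ _).trans hq
  have hpq : p / 2 ≤ q := (le_max_right _ _).trans hq
  -- the excess integrability `κ` and the exponents `s`, `b` of the Sobolev inequality
  set κ : ℝ := 1 / d - 1 / p with hκ
  have hd1 : 0 < 1 / (d : ℝ) := by positivity
  have hd2 : 1 / (d : ℝ) ≤ 1 / 2 := one_div_le_one_div_of_le two_pos hd0
  have hp0 : 0 < 1 / p := by positivity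
  have hp1 : 1 / p < 1 / 2 := one_div_lt_one_div_of_lt two_pos hp2
  have hκ0 : 0 < κ := sub_pos.2 (one_div_lt_one_div_of_lt (by linarith) hp)
  set a : ℝ := 2 * p / (p - 2) with ha
  have ha0 : 0 < a := div_pos (by linarith) (by linarith)
  have ha1 : 1 / a = 1 / 2 - 1 / p := by
    have : p - 2 ≠ 0 := by linarith
    rw [ha]; field_simp
  have hpa : 2 / p + 2 / a = 1 := by
    rw [div_eq_mul_one_div 2 p, div_eq_mul_one_div 2 a, ha1]; ring
  obtain ⟨s, hs⟩ : ∃ s : ℝ≥0, (s : ℝ) = (1 / 2 + κ / 2)⁻¹ :=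
    ⟨⟨_, by positivity⟩, rfl⟩
  obtain ⟨b, hb⟩ : ∃ b : ℝ≥0, (b : ℝ) = (1 / a - κ / 2)⁻¹ :=
    ⟨⟨_, inv_nonneg.2 (by rw [ha1, hκ]; linarith)⟩, rfl⟩
  have hb0 : 0 < b := by
    rw [← NNReal.coe_pos, hb]
    exact inv_pos.2 (by rw [ha1, hκ]; linarith)
  have hab : (1 + κ - 1) / 2 = 1 / a - 1 / b := by
    rw [hb, one_div (_⁻¹), inv_inv]; ring
  have hs1 : 1 ≤ s := by
    rw [← NNReal.coe_le_coe, hs]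
    exact (one_le_inv₀ (by positivity)).2 (by rw [hκ]; linarith)
  have hs2 : s ≤ 2 := by
    rw [← NNReal.coe_le_coe, hs]
    exact inv_le_of_inv_le₀ two_pos (by push_cast; linarith)
  have hbs : (b : ℝ)⁻¹ = (s : ℝ)⁻¹ - (d : ℝ)⁻¹ := by
    rw [hb, hs, inv_inv, inv_inv, ha1, hκ]; ring
  obtain ⟨CS, hCS⟩ := exists_sobolev_const (by omega : 0 < d) hs1 hs2 hbs (3 * r)
  obtain ⟨N, hN⟩ := exists_weight_bound d hp2 hpq (3 * r) NB Nψ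
  obtain ⟨c, hc1, hc⟩ := exists_isParabolicCutoff d
  set G : ℝ≥0∞ := max 1 ((ENNReal.ofReal (2 / c₀) + CS ^ 2 * ENNReal.ofReal (4 * d ^ 2 / lam + 2))
      * ENNReal.ofReal (4 * (M * d ^ 2) ^ 2 / lam + 1 / lam + 1) * N
      * ENNReal.ofReal ((1 + 2 * c / r) ^ 2)) with hG
  have hGt : G ≠ ⊤ := by rw [hG]; finiteness
  have hσ : 1 < 1 + κ := by linarith
  have hHt : moserConst (1 + κ) G ^ (2⁻¹ : ℝ) ≠ ⊤ :=
    ENNReal.rpow_ne_top_of_nonneg (by norm_num) (moserConst_ne_top hσ hGt)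
  refine ⟨(moserConst (1 + κ) G ^ (2⁻¹ : ℝ)).toReal + 1, by positivity, ?_⟩
  intro U T A B ψ u x₀ t₀ hU hUb _ hAm hAe hAM hB hψ hψc hu hub hsol _ ht₀ hQ hBN hψN
  have : IsFiniteMeasure (volume.restrict U) :=
    ⟨by rw [Measure.restrict_apply_univ]; exact hUb.measure_lt_top⟩
  have htwo : ∀ e : ℝ, 2 ≤ e → (2 : ℝ≥0∞) ≤ ENNReal.ofReal e := fun e he => by
    simpa using ENNReal.ofReal_le_ofReal he
  obtain ⟨L, w, Du, ut, hw, huw⟩ := exists_isEnergySolution hlam hM hc₀ hU hUb hAm hAe hAM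
    (hB.mono_exponent (htwo p hp2.le)) (hψ.mono_exponent (htwo q hq2)) hψc hu hub hsol
  have h9 : 0 < (3 * r) ^ 2 := by positivity
  have hxc : x₀ ∈ cube x₀ (3 * r) := fun i => by simpa using by linarith
  have hcube : cube x₀ (3 * r) ⊆ U := fun x hx =>
    (hQ (mk_mem_prod hx (⟨by linarith, by linarith⟩ :
      t₀ - (3 * r) ^ 2 / 2 ∈ timeInterval t₀ (3 * r)))).1
  have htime : 0 ≤ t₀ - (3 * r) ^ 2 := by
    have h1 : timeInterval t₀ (3 * r) ⊆ Ioo 0 T := fun t ht =>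
      (hQ (mk_mem_prod hxc ht)).2
    exact ((Ioo_subset_Ioo_iff (by linarith)).1 h1).1
  have hcube' : ∀ ρ ≤ 3 * r, cube x₀ ρ ⊆ U := fun ρ hρ => (cube_subset_cube x₀ hρ).trans hcube
  have hcyl : ∀ ρ, 0 ≤ ρ → ρ ≤ 3 * r → paraCylinder x₀ t₀ ρ ⊆ U ×ˢ Ioo 0 T := fun ρ h0 hρ =>
    prod_mono (hcube' ρ hρ) (Ioo_subset_Ioo (by
      have := pow_le_pow_left₀ h0 hρ 2
      linarith) ht₀.2.le)
  have hmono := Measure.restrict_mono hcube (le_refl (volume : Measure (Space d)))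
  have hmain := hw.eLpNorm_top_le hr (hcube' (2 * r) (by linarith)) (by nlinarith) ht₀.2
    (by linarith) ha0 hpa hσ hb0 hab (by linarith)
    (hN x₀ B ψ (hB.1.mono_measure hmono) (hψ.1.mono_measure hmono) hBN hψN) (hCS x₀) hc1 hc (le_max_left _ _) hGt (le_max_right _ _)
  rw [eLpNorm_congr_ae (ae_mono (Measure.restrict_mono (hcyl r hr.le (by linarith)) le_rfl) huw),
    mixedNorm_congr_ae (I := timeInterval t₀ (2 * r)) (hU.prod isOpen_Ioo).measurableSet huw _ _
      (isOpen_cube x₀ (2 * r)).measurableSet measurableSet_Ioo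
      (hcyl (2 * r) (by linarith) (by linarith))]
  refine hmain.trans (mul_le_mul' ?_ le_rfl)
  rw [ENNReal.le_ofReal_iff_toReal_le hHt (by positivity)]
  linarith
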